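/- Let $n,d\ge 1$, and let $$X^{2n}=\Big\{\sum_{i=0}^n (x_{2i}+x_{2i+1})(x_{2i}^2-x_{2i}x_{2i+1}+x_{2i+1}^2)^d=0\Big\}\subset\mathbb P^{2n+1}.$$ Let $k$ be a field, $\xi\in\bar k$ with $\xi^2=-3$, $a_\pm=(1\pm\xi)/2$, and assume $\operatorname{char}k\ne 2,3$ whenever the following blow-up occurs. Let $\mathcal T\to\mathbb P^{2n+1}$ be the blow-up along the disjoint $n$-planes $H_\pm=\{x_{2i}=a_\pm x_{2i+1},\ 0\le i\le n\}$. In the coordinates $y_{2i}=x_{2i}-a_+x_{2i+1}$, $y_{2i+1}=x_{2i}-a_-x_{2i+1}$ it is the toric variety with Cox ring $k(\xi)[z_0,\dots,z_{2n+1},w_+,w_-]$, $\deg z_{2i}=(1,-1,0)$, $\deg z_{2i+1}=(1,0,-1)$, $\deg w_+=(0,1,0)$, $\deg w_-=(0,0,1)$, irrelevant ideal $(z_0,z_2,\dots,z_{2n})\cap(z_1,z_3,\dots,z_{2n+1})\cap(w_+,w_-)$, and blow-down $y_{2i}=z_{2i}w_+$, $y_{2i+1}=z_{2i+1}w_-$.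 It descends to $k$: an automorphism $\xi\mapsto-\xi$ acts on Cox coordinates by conjugation combined with $z_{2i}\leftrightarrow z_{2i+1}$, $w_+\leftrightarrow w_-$. Put $\widehat F=3\widehat D-\xi\widehat S$, where $$\widehat S=\sum_i z_{2i}^dz_{2i+1}^d(w_+z_{2i}+w_-z_{2i+1}),\qquad \widehat D=\sum_i z_{2i}^dz_{2i+1}^d(w_+z_{2i}-w_-z_{2i+1}),$$ and $\widetilde X^{2n}=V(\widehat F)\subset\mathcal T$. Let $\overline\varphi_{2n}:\mathbb P^{2n}\dashrightarrow\mathbb P^{2n+1}$ be given by $$\overline\varphi_{2i}=\tfrac12\big((u_{2i+1}-3u_{2i+2})\overline A-3(u_{2i+1}+u_{2i+2})\overline B\big),\quad \overline\varphi_{2i+1}=u_{2i+1}\overline A-3u_{2i+2}\overline B\quad(0\le i<n),$$ $$\overline\varphi_{2n}=\tfrac12u_0(\overline A-3\overline B),\quad \overline\varphi_{2n+1}=u_0\overline A,$$ where $$\overline A=u_0^{2d+1}+\sum_{i=0}^{n-1}(u_{2i+1}+3u_{2i+2})(u_{2i+1}^2+3u_{2i+2}^2)^d,\quad \overline B=u_0^{2d+1}+\sum_{i=0}^{n-1}(u_{2i+1}-u_{2i+2})(u_{2i+1}^2+3u_{2i+2}^2)^d.$$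 (i) Suppose that $-3$ is not a square in $k$. Then $\widehat F$ is homogeneous of degree $(2d+1,-d,-d)$; $\widetilde X^{2n}$ is the strict transform of $X^{2n}$, and the pull-back of the equation of $X^{2n}$ is a nonzero constant times $w_+^dw_-^d\widehat F$, with $w_+,w_-\nmid\widehat F$. The coordinates of $\overline\varphi_{2n}$ are forms of degree $2d+2$ without common factor, and $\overline\varphi_{2n}$ is a birational map $\mathbb P^{2n}\dashrightarrow X^{2n}$ over $k$. It factors over $k$ as a birational map $\mathbb P^{2n}\dashrightarrow\widetilde X^{2n}$ followed by the blow-down, which is a birational map $\widetilde X^{2n}\dashrightarrow X^{2n}$; in particular $\widetilde X^{2n}$ is birational to $\mathbb P^{2n}$ over $k$. For $d=1$, $X^{2n}$ is the Fermat cubic. (ii) If $k=\mathbb F_q$ with $q\equiv5\pmod 6$ and $\gcd(2d+1,q-1)=1$, then $|\widetilde X^{2n}(\mathbb F_q)|=|\mathbb P^{2n}(\mathbb F_q)|=(q^{2n+1}-1)/(q-1)$. For $n=1$ and every prime power $q$, with $s=\gcd(2d+1,q-1)$: $|X^2(\mathbb F_q)|=q^2+sq+1$ if $q\equiv 2,5\pmod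 6$; $|X^2(\mathbb F_q)|=q^2+(4+s)q+1$ if $q\equiv1,4\pmod 6$; and $|X^2(\mathbb F_q)|=s'q^2+q+1$ if $3\mid q$, where $s'=\gcd(g,q-1)$ and $2d+1=3^ig$ with $3\nmid g$. If moreover $\gcd(q,6)=1$, the same formula holds for $|\widetilde X^2(\mathbb F_q)|$. (iii) Let $K$ be a number field, let $H$ be the multiplicative height on $\mathbb P^{2n+1}(K)$ relative to $K$ (the product over all places $v$ of $K$ of $\max_j|x_j|_v$, normalised so that the product formula holds in $K$), and define heights on $\widetilde X^{2n}(K)$ through the blow-down. Then, as $B\to\infty$, with implied constants depending only on $n,d,K$, $$B^{\frac{2n+1}{2d+2}}\ll\#\{x\in \widetilde X^{2n}(K):H(x)\le B\}\ll B^{4n+2},$$ with the improved lower bound $B^{3/(2d+1)}$ when $n=1$; here the upper bound is asserted if $-3$ is not a square in $K$ or $n=1$, and the lower bounds always (the set may be infinite if $\sqrt{-3}\in K$ and $n\ge 2$). The same upper and lower bounds hold for $\#\{x\in X^{2n}(K):H(x)\le B\}$ for every number field $K$. -/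

import Mathlib

open scoped ENNReal LinearAlgebra.Projectivization

noncomputable section

/-! ## Spaces with homogeneous (Cox) coordinates, and their twisted forms -/

/-- A space presented by homogeneous coordinates: variables graded by `ℤ^rank`, and the sets of
variables generating the components of the irrelevant ideal (so a coordinate vector is admissible
when, for every `C ∈ irr`, the coordinates in `C` do not all vanish).  The permutation `conj`
(compatible with the grading and with the irrelevant ideal) describes a twisted form: a field
automorphism that does not fix `ξ` acts on coordinates through `conj`. -/
structure CoxSpace where
  Var : Type
  rank : ℕ
  deg : Var → Fin rank → ℤ
  irr : Set (Set Var)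
  conj : Equiv.Perm Var
  conjRank : Equiv.Perm (Fin rank)
  deg_conj : ∀ v j, deg (conj v) (conjRank j) = deg v j
  irr_conj : ∀ C ∈ irr, conj '' C ∈ irr

namespace CoxSpace

/-- Coordinate vectors outside the zero locus of the irrelevant ideal. -/
def Stable (A : CoxSpace) {Ω : Type*} [Field Ω] (x : A.Var → Ω) : Prop :=
  ∀ C ∈ A.irr, ∃ v ∈ C, x v ≠ 0

/-- The character of the torus `(Ωˣ)^rank` by which it scales the variable `v`. -/
def weight (A : CoxSpace) {Ω : Type*} [Field Ω] (t : Fin A.rank → Ωˣ) (v : A.Var) : Ωˣ :=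
  ∏ j, t j ^ A.deg v j

/-- Two coordinate vectors are equivalent when they lie in one torus orbit. -/
def orbitSetoid (A : CoxSpace) (Ω : Type*) [Field Ω] :
    Setoid {x : A.Var → Ω // A.Stable x} where
  r x y := ∃ t : Fin A.rank → Ωˣ, ∀ v, y.1 v = (A.weight t v : Ω) * x.1 v
  iseqv :=
    { refl := fun x => ⟨1, fun v => by simp [weight]⟩
      symm := by
        rintro x y ⟨t, h⟩
        refine ⟨t⁻¹, fun v => ?_⟩
        have : A.weight t⁻¹ v = (A.weight t v)⁻¹ := by simp [weight]
        rw [h v, this]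
        simp
      trans := by
        rintro x y z ⟨t, h⟩ ⟨s, h'⟩
        refine ⟨s * t, fun v => ?_⟩
        have : A.weight (s * t) v = A.weight s v * A.weight t v := by
          simp [weight, mul_zpow, Finset.prod_mul_distrib]
        rw [h' v, h v, this]
        push_cast
        ring }

/-- The points of the quotient over `Ω`. -/
def Pt (A : CoxSpace) (Ω : Type*) [Field Ω] : Type _ := Quotient (A.orbitSetoid Ω)

/-- `x` is a vector of homogeneous coordinates of the point `p`. -/
def Coord (A : CoxSpace) {Ω : Type*} [Field Ω] (x : A.Var → Ω) (p : A.Pt Ω) : Prop :=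
  ∃ h : A.Stable x, Quotient.mk (A.orbitSetoid Ω) ⟨x, h⟩ = p

/-- The zero locus of a (homogeneous) polynomial. -/
def zeroLocus (A : CoxSpace) {Ω : Type*} [Field Ω] (f : MvPolynomial A.Var Ω) : Set (A.Pt Ω) :=
  {p | ∀ x, A.Coord x p → MvPolynomial.eval x f = 0}

/-- The Zariski topology: the closed sets are the common zero loci of homogeneous polynomials. -/
instance zariski (A : CoxSpace) (Ω : Type*) [Field Ω] : TopologicalSpace (A.Pt Ω) :=
  TopologicalSpace.generateFrom
    {U | ∃ (f : MvPolynomial A.Var Ω) (c : Fin A.rank → ℤ),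
      MvPolynomial.IsWeightedHomogeneous A.deg f c ∧ U = (A.zeroLocus f)ᶜ}

section Galois

variable {k Ω : Type*} [Field k] [Field Ω] [Algebra k Ω]

open Classical in
/-- The permutation of the variables through which `τ` acts. -/
def perm (A : CoxSpace) (ξ : Ω) (τ : Ω ≃ₐ[k] Ω) : Equiv.Perm A.Var :=
  if τ ξ = ξ then 1 else A.conj

/-- The (twisted) action of an automorphism `τ` on points: `(τ x) v = τ (x v)` if `τ` fixes `ξ`,
and `(τ x) v = τ (x (conj v))` otherwise. -/
def gal (A : CoxSpace) (ξ : Ω) (τ : Ω ≃ₐ[k] Ω) : A.Pt Ω → A.Pt Ω :=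
  Quotient.map (sa := A.orbitSetoid Ω) (sb := A.orbitSetoid Ω)
    (fun x => ⟨fun v => τ (x.1 (A.perm ξ τ v)), by
      intro C hC
      unfold perm
      split_ifs with h
      · obtain ⟨v, hv, hx⟩ := x.2 C hC
        exact ⟨v, hv, by simpa using hx⟩
      · obtain ⟨_, ⟨v, hv, rfl⟩, hx⟩ := x.2 _ (A.irr_conj C hC)
        exact ⟨v, hv, by simpa using hx⟩⟩)
    (by
      rintro x y ⟨t, ht⟩
      by_cases h : τ ξ = ξ
      · refine ⟨fun j => Units.map (τ : Ω →* Ω) (t j), fun v => ?_⟩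
        simp [perm, h, ht, weight, Units.coe_prod, map_prod, map_zpow₀]
      · refine ⟨fun j => Units.map (τ : Ω →* Ω) (t (A.conjRank j)), fun v => ?_⟩
        simp only [perm, h, if_false, ht, weight, Units.coe_prod, map_prod, map_mul]
        congr 1
        rw [← Equiv.prod_comp A.conjRank]
        refine Finset.prod_congr rfl fun j _ => ?_
        rw [A.deg_conj]
        simp [map_zpow₀])

variable (k) in
/-- The `k`-rational points of the (twisted) form over a perfect field `k` with algebraic closure
`Ω`: the Galois-invariant points. -/
def rationalPts (A : CoxSpace) (ξ : Ω) : Set (A.Pt Ω) :=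
  {p | ∀ τ : Ω ≃ₐ[k] Ω, A.gal ξ τ p = p}

end Galois

/-- The tuple of polynomials `f` is defined at `p` and sends `p` to `q`. -/
def Sends {A B : CoxSpace} {Ω : Type*} [Field Ω] (f : B.Var → MvPolynomial A.Var Ω)
    (p : A.Pt Ω) (q : B.Pt Ω) : Prop :=
  ∀ x, A.Coord x p → B.Coord (fun v => MvPolynomial.eval x (f v)) q

/-- `U` is a relatively open and dense subset of `V`. -/
def OpenDenseIn {P : Type*} [TopologicalSpace P] (U V : Set P) : Prop :=
  (∃ O : Set P, IsOpen O ∧ U = V ∩ O) ∧ V ⊆ closure U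

/-- The tuple of polynomials `f` induces a birational map over `k` from `V` to `W`: `f` restricts
to a bijection between relatively open dense subsets of `V` and `W`, whose inverse is also given by
polynomials; the polynomials have coefficients in `k(ξ)`, and the open sets and the bijection are
compatible with the Galois action, i.e. they descend to `k`. -/
def InducesBirational (k : Type*) {Ω : Type*} [Field k] [Field Ω] [Algebra k Ω] (ξ : Ω)
    {A B : CoxSpace} (V : Set (A.Pt Ω)) (W : Set (B.Pt Ω))
    (f : B.Var → MvPolynomial A.Var Ω) : Prop :=
  (∀ v m, (f v).coeff m ∈ IntermediateField.adjoin k {ξ}) ∧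
  ∃ (g : A.Var → MvPolynomial B.Var Ω) (U : Set (A.Pt Ω)) (U' : Set (B.Pt Ω)) (e : U ≃ U'),
    (∀ v m, (g v).coeff m ∈ IntermediateField.adjoin k {ξ}) ∧
    OpenDenseIn U V ∧ OpenDenseIn U' W ∧
    (∀ p : U, Sends f p.1 (e p).1) ∧
    (∀ q : U', Sends g q.1 (e.symm q).1) ∧
    ∀ (τ : Ω ≃ₐ[k] Ω) (p : U), ∃ h : A.gal ξ τ p.1 ∈ U,
      (e ⟨A.gal ξ τ p.1, h⟩).1 = B.gal ξ τ (e p).1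

end CoxSpace

/-- Projective space with homogeneous coordinates indexed by `ι` (with its split structure). -/
def projCox (ι : Type) : CoxSpace where
  Var := ι
  rank := 1
  deg := fun _ _ => 1
  irr := {Set.univ}
  conj := 1
  conjRank := 1
  deg_conj := fun _ _ => rfl
  irr_conj := by simp

/-! ## The hypersurface in projective space and its parametrisation -/

/-- Indices of the coordinates of `ℙ^{2n+1}`: `(i, 0)` is `x_{2i}` and `(i, 1)` is `x_{2i+1}`,
for `0 ≤ i ≤ n`. -/
abbrev XIdx (n : ℕ) : Type := Fin (n + 1) × Fin 2

/-- Indices of the coordinates of `ℙ^{2n}`: `none` is `u_0`, `some (i, 0)` is `u_{2i+1}` and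
`some (i, 1)` is `u_{2i+2}`, for `0 ≤ i < n`. -/
abbrev UIdx (n : ℕ) : Type := Option (Fin n × Fin 2)

open MvPolynomial

/-- The equation `∑ (x_{2i} + x_{2i+1}) (x_{2i}² - x_{2i} x_{2i+1} + x_{2i+1}²)^d`. -/
def hypersurfaceEq (R : Type*) [CommRing R] (n d : ℕ) : MvPolynomial (XIdx n) R :=
  ∑ i : Fin (n + 1), (X (i, 0) + X (i, 1)) *
    (X (i, 0) ^ 2 - X (i, 0) * X (i, 1) + X (i, 1) ^ 2) ^ d

/-- The geometric points of the hypersurface `X^{2n}`. -/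
def hypersurface (Ω : Type*) [Field Ω] (n d : ℕ) : Set ((projCox (XIdx n)).Pt Ω) :=
  (projCox (XIdx n)).zeroLocus (hypersurfaceEq Ω n d)

/-- The `F`-points of the hypersurface `X^{2n}`. -/
def hypersurfacePts (F : Type*) [Field F] (n d : ℕ) : Set (ℙ F (XIdx n → F)) :=
  {P | eval P.rep (hypersurfaceEq F n d) = 0}

/-- The form `Ā`. -/
def polyA (R : Type*) [CommRing R] (n d : ℕ) : MvPolynomial (UIdx n) R :=
  X none ^ (2 * d + 1) + ∑ i : Fin n, (X (some (i, 0)) + 3 * X (some (i, 1))) *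
    (X (some (i, 0)) ^ 2 + 3 * X (some (i, 1)) ^ 2) ^ d

/-- The form `B̄`. -/
def polyB (R : Type*) [CommRing R] (n d : ℕ) : MvPolynomial (UIdx n) R :=
  X none ^ (2 * d + 1) + ∑ i : Fin n, (X (some (i, 0)) - X (some (i, 1))) *
    (X (some (i, 0)) ^ 2 + 3 * X (some (i, 1)) ^ 2) ^ d

/-- The coordinates of the map `φ̄_{2n} : ℙ^{2n} ⇢ ℙ^{2n+1}`. -/
def phiBar (Ω : Type*) [Field Ω] (n d : ℕ) (v : XIdx n) : MvPolynomial (UIdx n) Ω :=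
  Fin.lastCases
    (motive := fun _ => MvPolynomial (UIdx n) Ω)
    (if v.2 = 0 then C (1 / 2) * (X none * (polyA Ω n d - 3 * polyB Ω n d))
      else X none * polyA Ω n d)
    (fun i : Fin n =>
      if v.2 = 0 then
        C (1 / 2) * ((X (some (i, 0)) - 3 * X (some (i, 1))) * polyA Ω n d
          - 3 * (X (some (i, 0)) + X (some (i, 1))) * polyB Ω n d)
      else X (some (i, 0)) * polyA Ω n d - 3 * X (some (i, 1)) * polyB Ω n d)
    v.1

/-! ## The toric blow-up and the strict transform -/

/-- The variables of the Cox ring: `ev i` is `z_{2i}`, `od i` is `z_{2i+1}` (`0 ≤ i ≤ n`), and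
`wp`, `wm` are `w_+`, `w_-`. -/
inductive CoxVar (n : ℕ) : Type
  | ev (i : Fin (n + 1))
  | od (i : Fin (n + 1))
  | wp
  | wm

namespace CoxVar

/-- The `ℤ³`-grading of the Cox ring. -/
def deg {n : ℕ} : CoxVar n → Fin 3 → ℤ
  | ev _ => ![1, -1, 0]
  | od _ => ![1, 0, -1]
  | wp => ![0, 1, 0]
  | wm => ![0, 0, 1]

/-- The exchange of the coordinates attached to the two conjugate planes. -/
def swap {n : ℕ} : CoxVar n → CoxVar n
  | ev i => od i
  | od i => ev i
  | wp => wm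
  | wm => wp

/-- The exchange of coordinates as a permutation. -/
def swapPerm (n : ℕ) : Equiv.Perm (CoxVar n) where
  toFun := swap
  invFun := swap
  left_inv := by rintro (_ | _ | _ | _) <;> rfl
  right_inv := by rintro (_ | _ | _ | _) <;> rfl

end CoxVar

/-- The toric variety `𝒯`: the blow-up of `ℙ^{2n+1}` along the two disjoint conjugate `n`-planes
`H_+ = {x_{2i} = a_+ x_{2i+1}}` and `H_- = {x_{2i} = a_- x_{2i+1}}`, in Cox coordinates.  Its
irrelevant ideal is `(z_0, z_2, …, z_{2n}) ∩ (z_1, z_3, …, z_{2n+1}) ∩ (w_+, w_-)`.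
An automorphism moving `ξ` exchanges the planes, hence acts through `z_{2i} ↔ z_{2i+1}`,
`w_+ ↔ w_-`; this defines the structure of `𝒯` over the base field. -/
def toricT (n : ℕ) : CoxSpace where
  Var := CoxVar n
  rank := 3
  deg := CoxVar.deg
  irr := {Set.range CoxVar.ev, Set.range CoxVar.od, {CoxVar.wp, CoxVar.wm}}
  conj := CoxVar.swapPerm n
  conjRank := Equiv.swap 1 2
  deg_conj := by
    intro v j
    cases v <;> fin_cases j <;> rfl
  irr_conj := by
    rintro C (rfl | rfl | rfl)
    · right; left
      rw [← Set.range_comp]; rfl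
    · left
      rw [← Set.range_comp]; rfl
    · right; right
      rw [Set.mem_singleton_iff, Set.image_pair]
      exact Set.pair_comm _ _

/-- `Ŝ = ∑ z_{2i}^d z_{2i+1}^d (w_+ z_{2i} + w_- z_{2i+1})`. -/
def coxS (R : Type*) [CommRing R] (n d : ℕ) : MvPolynomial (CoxVar n) R :=
  ∑ i : Fin (n + 1), X (.ev i) ^ d * X (.od i) ^ d * (X .wp * X (.ev i) + X .wm * X (.od i))

/-- `D̂ = ∑ z_{2i}^d z_{2i+1}^d (w_+ z_{2i} - w_- z_{2i+1})`. -/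
def coxD (R : Type*) [CommRing R] (n d : ℕ) : MvPolynomial (CoxVar n) R :=
  ∑ i : Fin (n + 1), X (.ev i) ^ d * X (.od i) ^ d * (X .wp * X (.ev i) - X .wm * X (.od i))

/-- `F̂ = 3 D̂ - ξ Ŝ`. -/
def coxF {R : Type*} [CommRing R] (ξ : R) (n d : ℕ) : MvPolynomial (CoxVar n) R :=
  3 * coxD R n d - C ξ * coxS R n d

/-- The variety `X̃^{2n} = V(F̂)` in `𝒯` (geometric points). -/
def Xtilde {Ω : Type*} [Field Ω] (ξ : Ω) (n d : ℕ) : Set ((toricT n).Pt Ω) :=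
  (toricT n).zeroLocus (coxF ξ n d)

/-- The blow-down `𝒯 → ℙ^{2n+1}`: with `y_{2i} = z_{2i} w_+` and `y_{2i+1} = z_{2i+1} w_-`, it is
`x_{2i} = (a_+ y_{2i+1} - a_- y_{2i}) / ξ`, `x_{2i+1} = (y_{2i+1} - y_{2i}) / ξ`, where
`a_± = (1 ± ξ) / 2`; that is, `y_{2i} = x_{2i} - a_+ x_{2i+1}`, `y_{2i+1} = x_{2i} - a_- x_{2i+1}`. -/
def blowDown {Ω : Type*} [Field Ω] (ξ : Ω) (n : ℕ) (v : XIdx n) : MvPolynomial (CoxVar n) Ω :=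
  if v.2 = 0 then
    C (1 / ξ) * (C ((1 + ξ) / 2) * (X (.od v.1) * X .wm) - C ((1 - ξ) / 2) * (X (.ev v.1) * X .wp))
  else C (1 / ξ) * (X (.od v.1) * X .wm - X (.ev v.1) * X .wp)

/-- The plane `{x_{2i} = a x_{2i+1} for all i}`; `H_±` are the cases `a = (1 ± ξ) / 2`. -/
def planeH {Ω : Type*} [Field Ω] (n : ℕ) (a : Ω) : Set ((projCox (XIdx n)).Pt Ω) :=
  ⋂ i : Fin (n + 1), (projCox (XIdx n)).zeroLocus (X (i, 0) - C a * X (i, 1))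

/-- The strict transform in `𝒯` of the hypersurface `X^{2n}`: the Zariski closure of the inverse
image of the part of `X^{2n}` outside of the centre `H_+ ∪ H_-` of the blow-up. -/
def strictTransform {Ω : Type*} [Field Ω] (ξ : Ω) (n d : ℕ) : Set ((toricT n).Pt Ω) :=
  closure {p | ∃ q ∈ hypersurface Ω n d \ (planeH n ((1 + ξ) / 2) ∪ planeH n ((1 - ξ) / 2)),
    CoxSpace.Sends (A := toricT n) (B := projCox (XIdx n)) (blowDown ξ n) p q}

/-! ## Points of bounded height -/

/-- The `K`-points of `X^{2n}` of height at most `B`, for the multiplicative height relative to `K`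
attached to `𝒪(1)`: the product over all places `v` of `K` of `max_j |x_j|_v`, with the absolute
values normalised so that the product formula holds in `K`. -/
def hypersurfaceBounded (K : Type*) [Field K] [NumberField K] (n d : ℕ) (B : ℝ) :
    Set (ℙ K (XIdx n → K)) :=
  {P | P ∈ hypersurfacePts K n d ∧ P.mulHeight ≤ B}

/-- The `K`-points of `X̃^{2n}` whose image in `ℙ^{2n+1}` has height at most `B`. -/
def XtildeBounded (K : Type*) {Ω : Type*} [Field K] [NumberField K] [Field Ω] [Algebra K Ω]
    (ξ : Ω) (n d : ℕ) (B : ℝ) : Set ((toricT n).Pt Ω) :=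
  {p | p ∈ Xtilde ξ n d ∧ p ∈ (toricT n).rationalPts K ξ ∧
    ∃ (P : ℙ K (XIdx n → K)) (q : (projCox (XIdx n)).Pt Ω),
      (projCox (XIdx n)).Coord (fun v => algebraMap K Ω (P.rep v)) q ∧
      CoxSpace.Sends (A := toricT n) (B := projCox (XIdx n)) (blowDown ξ n) p q ∧
      P.mulHeight ≤ B}

/-- `B^α ≪ #S(B)` as `B → ∞`. -/
def CountLower {P : Type*} (S : ℝ → Set P) (α : ℝ) : Prop :=
  ∃ c > 0, ∃ B₀ > 0, ∀ B : ℝ, B₀ ≤ B → ENNReal.ofReal (c * B ^ α) ≤ ((S B).encard : ℝ≥0∞)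

/-- `#S(B) ≪ B^α` as `B → ∞`; in particular the sets `S(B)` are finite. -/
def CountUpper {P : Type*} (S : ℝ → Set P) (α : ℝ) : Prop :=
  ∃ c > 0, ∃ B₀ > 0, ∀ B : ℝ, B₀ ≤ B → ((S B).encard : ℝ≥0∞) ≤ ENNReal.ofReal (c * B ^ α)

end

noncomputable section

open MvPolynomial

namespace CoxSpace

/-! ### Points, maps and topology of Cox spaces in homogeneous coordinates -/

section Coordinates

variable {A B : CoxSpace} {Ω : Type*} [Field Ω]

/-! In the coordinates `y` one has `x_{2i}² - x_{2i} x_{2i+1} + x_{2i+1}² = y_{2i} y_{2i+1}` and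
`-2ξ (x_{2i} + x_{2i+1}) = (3 - ξ) y_{2i} - (3 + ξ) y_{2i+1}`. Hence `F̂ = (3 - ξ) P w_+ - (3 + ξ) Q
w_-` with `P = ∑ z_{2i}^{d+1} z_{2i+1}^d` and `Q = ∑ z_{2i}^d z_{2i+1}^{d+1}` (`coxF_eq`): the
equation is linear in `w_±`.

(i) Where `P`, `Q` do not both vanish, the equation determines `[w_+ : w_-] = [(3 + ξ) Q : (3 - ξ)
P]`, so `X̃` is birational to the product of the two `ℙⁿ` with coordinates `z_{2i}` and `z_{2i+1}`.
Conjugation exchanges the factors; a point `u` of `ℙ^{2n}` is read as the pair of conjugate vectors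
`u_{2i+1} ∓ ξ u_{2i+2}` whose last entries are both `u_0`. Along it `w_± = 3 B̄ ± ξ Ā`, which is
`liftT`, and the blow-down of the lift is `φ̄` up to a constant (`eval_blowDown_liftT`). Since `P`
and `Q` are coprime, `F̂` is irreducible (`irreducible_coxF`); by the Nullstellensatz
(`exists_zero_of_irreducible`) the open sets on which the maps have explicit inverses are dense, and
the same density identifies `V(F̂)` with the strict transform.

(ii) If `q ≡ 2 mod 3`, pairs `(a, b)` become elements `y = a - ωb` of `𝔽_{q²}` and the equation
becomes `Tr(ω ∑ y_i^m) = 0` with `m = 1 + d(q+1)`. Averaging over the scalings of `y` reduces the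
count to that of `∑ y_i^m = 0` (`card_hypersurfacePts_of_inert`). If `q ≡ 1 mod 3`, averaging over a
split torus reduces the surface count to the loci `P = 0` and `Q = 0`
(`card_hypersurfacePts_of_split`). In characteristic 3 the surface is a cone over `x^{2d+1} +
y^{2d+1} = 0`. Points of `X̃` correspond to those of `X` if `-3` is not a square; otherwise `X̃ → ℙ¹
× ℙ¹` is counted fibrewise.

(iii) Two distinct numbers of height at most `B` cannot be close at every infinite place, by the
product formula; a grid argument leaves `O(B²)` of them, and ratios of coordinates then give
`B^{2(2n+1)}` in `ℙ^{2n+1}`. The blow-down has bounded fibres over rational points in the cases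
claimed. For the lower bounds the `n`-plane `x_{2i} + x_{2i+1} = 0` inside `X`, disjoint from the
centre of the blow-up, suffices: it supplies `≫ B^n` points, and the exponents asserted do not
exceed `n`. -/

theorem Coord.stable {x : A.Var → Ω} {p : A.Pt Ω} (h : A.Coord x p) : A.Stable x := h.1

theorem exists_coord (p : A.Pt Ω) : ∃ x, A.Coord x p := by
  obtain ⟨⟨x, hx⟩, rfl⟩ := Quotient.exists_rep p
  exact ⟨x, hx, rfl⟩

theorem Stable.exists_point {x : A.Var → Ω} (h : A.Stable x) : ∃ p, A.Coord x p := ⟨_, h, rfl⟩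

theorem Coord.unique {x : A.Var → Ω} {p q : A.Pt Ω} (hp : A.Coord x p) (hq : A.Coord x q) :
    p = q := by
  obtain ⟨_, rfl⟩ := hp
  obtain ⟨_, rfl⟩ := hq
  rfl

theorem Coord.eq_iff {x y : A.Var → Ω} {p q : A.Pt Ω} (hp : A.Coord x p) (hq : A.Coord y q) :
    p = q ↔ ∃ t : Fin A.rank → Ωˣ, ∀ v, y v = (A.weight t v : Ω) * x v := by
  obtain ⟨hx, rfl⟩ := hp
  obtain ⟨hy, rfl⟩ := hq
  exact Quotient.eq (r := A.orbitSetoid Ω)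

theorem Stable.smul {x : A.Var → Ω} (h : A.Stable x) (t : Fin A.rank → Ωˣ) :
    A.Stable (fun v => (A.weight t v : Ω) * x v) := fun C hC => by
  obtain ⟨v, hv, hx⟩ := h C hC
  exact ⟨v, hv, mul_ne_zero (Units.ne_zero _) hx⟩

theorem Coord.smul {x : A.Var → Ω} {p : A.Pt Ω} (h : A.Coord x p) (t : Fin A.rank → Ωˣ) :
    A.Coord (fun v => (A.weight t v : Ω) * x v) p := by
  obtain ⟨q, hq⟩ := (h.stable.smul t).exists_point
  rwa [(h.eq_iff hq).2 ⟨t, fun _ => rfl⟩]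

theorem Sends.unique {f : B.Var → MvPolynomial A.Var Ω} {p : A.Pt Ω} {q q' : B.Pt Ω}
    (h : Sends f p q) (h' : Sends f p q') : q = q' := by
  obtain ⟨x, hx⟩ := exists_coord p
  exact (h x hx).unique (h' x hx)

/-- Rescaling the source coordinates rescales the values of `f`. -/
def Compatible (f : B.Var → MvPolynomial A.Var Ω) : Prop :=
  ∀ (t : Fin A.rank → Ωˣ) (x : A.Var → Ω), ∃ s : Fin B.rank → Ωˣ, ∀ v,
    eval (fun w => (A.weight t w : Ω) * x w) (f v) = (B.weight s v : Ω) * eval x (f v)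

/-- Compatibility makes the image independent of the representative, so one coordinate vector
suffices. -/
theorem Compatible.sends {f : B.Var → MvPolynomial A.Var Ω} (hf : Compatible f)
    {x : A.Var → Ω} {p : A.Pt Ω} {q : B.Pt Ω} (hp : A.Coord x p)
    (hq : B.Coord (fun v => eval x (f v)) q) : Sends f p q := by
  intro y hy
  obtain ⟨t, ht⟩ := (hp.eq_iff hy).1 rfl
  obtain ⟨s, hs⟩ := hf t x
  have : (fun v => eval y (f v)) = fun v => (B.weight s v : Ω) * eval x (f v) := by
    funext v
    rw [← hs v, ← funext ht]
  rw [this]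
  exact hq.smul s

theorem prod_weight_pow (t : Fin A.rank → Ωˣ) (m : A.Var →₀ ℕ) :
    (m.prod fun v k => A.weight t v ^ k) = ∏ j, t j ^ (Finsupp.weight A.deg m j) := by
  classical
  simp only [weight, Finsupp.prod, Finsupp.weight_apply, Finsupp.sum, Finset.sum_apply,
    Pi.smul_apply]
  simp_rw [← Finset.prod_pow]
  rw [Finset.prod_comm]
  refine Finset.prod_congr rfl fun j _ => ?_
  induction m.support using Finset.induction_on with
  | empty => simp
  | insert v s hv ih =>
    rw [Finset.prod_insert hv, Finset.sum_insert hv, ih, zpow_add, ← zpow_natCast, ← zpow_mul,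
      nsmul_eq_mul, mul_comm (m v : ℤ)]

theorem eval_smul {f : MvPolynomial A.Var Ω} {c : Fin A.rank → ℤ}
    (hf : IsWeightedHomogeneous A.deg f c) (t : Fin A.rank → Ωˣ) (x : A.Var → Ω) :
    eval (fun v => (A.weight t v : Ω) * x v) f = ((∏ j, t j ^ c j : Ωˣ) : Ω) * eval x f := by
  rw [eval_eq, eval_eq, Finset.mul_sum]
  refine Finset.sum_congr rfl fun m hm => ?_
  have h := prod_weight_pow (Ω := Ω) t m
  rw [hf (mem_support_iff.1 hm)] at h
  rw [← h]
  simp only [mul_pow, Finset.prod_mul_distrib, Finsupp.prod, Units.coe_prod, Units.val_pow_eq_pow_val]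
  ring

theorem mem_zeroLocus_iff {f : MvPolynomial A.Var Ω} {c : Fin A.rank → ℤ}
    (hf : IsWeightedHomogeneous A.deg f c) {x : A.Var → Ω} {p : A.Pt Ω} (hp : A.Coord x p) :
    p ∈ A.zeroLocus f ↔ eval x f = 0 := by
  refine ⟨fun h => h x hp, fun h y hy => ?_⟩
  obtain ⟨t, ht⟩ := (hp.eq_iff hy).1 rfl
  rw [funext ht, eval_smul hf, h, mul_zero]

theorem isOpen_compl_zeroLocus {f : MvPolynomial A.Var Ω} {c : Fin A.rank → ℤ}
    (hf : IsWeightedHomogeneous A.deg f c) : IsOpen (A.zeroLocus f)ᶜ :=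
  TopologicalSpace.isOpen_generateFrom_of_mem ⟨f, c, hf, rfl⟩

/-- The generating open sets already form a basis: the loci `f ≠ 0` and `g ≠ 0` meet in the locus `f
* g ≠ 0`, and a product of homogeneous polynomials is homogeneous. -/
theorem exists_basic_open {O : Set (A.Pt Ω)} (hO : IsOpen O) {p : A.Pt Ω} (hp : p ∈ O) :
    ∃ (f : MvPolynomial A.Var Ω) (c : Fin A.rank → ℤ), IsWeightedHomogeneous A.deg f c ∧
      p ∉ A.zeroLocus f ∧ (A.zeroLocus f)ᶜ ⊆ O := by
  induction hO with
  | basic U hU =>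
    obtain ⟨f, c, hf, rfl⟩ := hU
    exact ⟨f, c, hf, hp, subset_rfl⟩
  | univ =>
    refine ⟨1, 0, isWeightedHomogeneous_one _ _, fun h => ?_, Set.subset_univ _⟩
    obtain ⟨x, hx⟩ := exists_coord p
    simpa using h x hx
  | inter U V _ _ hU hV =>
    obtain ⟨f, c, hf, hpf, hfU⟩ := hU hp.1
    obtain ⟨g, e, hg, hpg, hgV⟩ := hV hp.2
    have key : ∀ q, q ∉ A.zeroLocus (f * g) ↔ q ∉ A.zeroLocus f ∧ q ∉ A.zeroLocus g := fun q => by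
      obtain ⟨x, hx⟩ := exists_coord q
      rw [mem_zeroLocus_iff (hf.mul hg) hx, mem_zeroLocus_iff hf hx, mem_zeroLocus_iff hg hx,
        map_mul, mul_eq_zero, not_or]
    exact ⟨f * g, c + e, hf.mul hg, (key p).2 ⟨hpf, hpg⟩,
      fun q hq => ⟨hfU ((key q).1 hq).1, hgV ((key q).1 hq).2⟩⟩
  | sUnion S _ ih =>
    obtain ⟨U, hU, hpU⟩ := hp
    obtain ⟨f, c, hf, hpf, hfU⟩ := ih U hU hpU
    exact ⟨f, c, hf, hpf, hfU.trans (Set.subset_sUnion_of_mem hU)⟩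

theorem mem_closure_of_basic {V : Set (A.Pt Ω)} {p : A.Pt Ω}
    (h : ∀ (f : MvPolynomial A.Var Ω) (c : Fin A.rank → ℤ), IsWeightedHomogeneous A.deg f c →
      p ∉ A.zeroLocus f → ∃ q ∈ V, q ∉ A.zeroLocus f) : p ∈ closure V := by
  rw [mem_closure_iff]
  intro O hO hp
  obtain ⟨f, c, hf, hpf, hfO⟩ := exists_basic_open hO hp
  obtain ⟨q, hq, hqf⟩ := h f c hf hpf
  exact ⟨q, hfO hqf, hq⟩

theorem isClosed_zeroLocus {f : MvPolynomial A.Var Ω} {c : Fin A.rank → ℤ}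
    (hf : IsWeightedHomogeneous A.deg f c) : IsClosed (A.zeroLocus f) :=
  ⟨isOpen_compl_zeroLocus hf⟩

/-- Turns density into a statement on polynomials: an `f` that is nonzero somewhere on `V` must be
nonzero at a point of `V` where `h` is nonzero too. In `H` the polynomial `f` need not be
homogeneous, so irreducibility can be applied without mentioning the grading. -/
theorem openDenseIn_of_coord {V : Set (A.Pt Ω)} {h : MvPolynomial A.Var Ω} {e : Fin A.rank → ℤ}
    (hh : IsWeightedHomogeneous A.deg h e)
    (H : ∀ (f : MvPolynomial A.Var Ω) (x : A.Var → Ω) (p : A.Pt Ω), A.Coord x p → p ∈ V →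
      eval x f ≠ 0 → ∃ y, ∃ q ∈ V, A.Coord y q ∧ eval y f ≠ 0 ∧ eval y h ≠ 0) :
    OpenDenseIn (V \ A.zeroLocus h) V := by
  refine ⟨⟨_, isOpen_compl_zeroLocus hh, rfl⟩, fun p hp => mem_closure_of_basic ?_⟩
  intro f c hf hpf
  obtain ⟨x, hx⟩ := exists_coord p
  rw [mem_zeroLocus_iff hf hx] at hpf
  obtain ⟨y, q, hq, hy, hyf, hyh⟩ := H f x p hx hp hpf
  exact ⟨q, ⟨hq, by rwa [mem_zeroLocus_iff hh hy]⟩, by rwa [mem_zeroLocus_iff hf hy]⟩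

end Coordinates

/-! ### The Galois action and a criterion for birational maps -/

section Galois

variable {A B : CoxSpace} {k Ω : Type*} [Field k] [Field Ω] [Algebra k Ω]

theorem Coord.gal {x : A.Var → Ω} {p : A.Pt Ω} (h : A.Coord x p) (ξ : Ω) (τ : Ω ≃ₐ[k] Ω) :
    A.Coord (fun v => τ (x (A.perm ξ τ v))) (A.gal ξ τ p) := by
  obtain ⟨hx, rfl⟩ := h
  exact ⟨_, rfl⟩

theorem Sends.gal {f : B.Var → MvPolynomial A.Var Ω} (hf : Compatible f) {ξ : Ω} {τ : Ω ≃ₐ[k] Ω}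
    (hτ : ∀ x v, eval (fun w => τ (x (A.perm ξ τ w))) (f v) = τ (eval x (f (B.perm ξ τ v))))
    {p : A.Pt Ω} {q : B.Pt Ω} (h : Sends f p q) : Sends f (A.gal ξ τ p) (B.gal ξ τ q) := by
  obtain ⟨x, hx⟩ := exists_coord p
  refine hf.sends (hx.gal ξ τ) ?_
  simp_rw [hτ]
  exact (h x hx).gal ξ τ

/-- The point to which a tuple sends `p` is unique, so `hfg` and `hgf` produce mutually inverse
bijections, and equivariance of the bijection follows from that of the tuple `f` alone. -/
theorem inducesBirational_of_inverse {ξ : Ω} {V U : Set (A.Pt Ω)} {W U' : Set (B.Pt Ω)}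
    {f : B.Var → MvPolynomial A.Var Ω} {g : A.Var → MvPolynomial B.Var Ω}
    (hfk : ∀ v m, (f v).coeff m ∈ IntermediateField.adjoin k {ξ})
    (hgk : ∀ v m, (g v).coeff m ∈ IntermediateField.adjoin k {ξ})
    (hU : OpenDenseIn U V) (hU' : OpenDenseIn U' W) (hf : Compatible f)
    (hτ : ∀ (τ : Ω ≃ₐ[k] Ω) x v,
      eval (fun w => τ (x (A.perm ξ τ w))) (f v) = τ (eval x (f (B.perm ξ τ v))))
    (hUτ : ∀ (τ : Ω ≃ₐ[k] Ω), ∀ p ∈ U, A.gal ξ τ p ∈ U)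
    (hfg : ∀ p ∈ U, ∃ q ∈ U', Sends f p q ∧ Sends g q p)
    (hgf : ∀ q ∈ U', ∃ p ∈ U, Sends f p q ∧ Sends g q p) :
    InducesBirational k ξ V W f := by
  choose F hFU hF using hfg
  choose G hGU hG using hgf
  refine ⟨hfk, g, U, U', ⟨fun p => ⟨F p p.2, hFU p p.2⟩, fun q => ⟨G q q.2, hGU q q.2⟩, fun p => ?_,
    fun q => ?_⟩, hgk, hU, hU', fun p => (hF p p.2).1, fun q => (hG q q.2).2, fun τ p =>
    ⟨hUτ τ p p.2, ?_⟩⟩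
  · exact Subtype.ext ((hG _ (hFU p p.2)).2.unique (hF p p.2).2)
  · exact Subtype.ext ((hF _ (hGU q q.2)).1.unique (hG q q.2).1)
  · exact (hF _ (hUτ τ p p.2)).1.unique ((hF p p.2).1.gal hf (hτ τ))

end Galois

end CoxSpace

/-! ### Projective space as a Cox space -/

section Projective

variable {ι : Type} {Ω : Type*} [Field Ω]

theorem stable_projCox {x : ι → Ω} : (projCox ι).Stable x ↔ ∃ i, x i ≠ 0 := by
  constructor
  · intro h
    obtain ⟨i, -, hi⟩ := h Set.univ rfl
    exact ⟨i, hi⟩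
  · rintro ⟨i, hi⟩ C rfl
    exact ⟨i, trivial, hi⟩

theorem weight_projCox (t : Fin 1 → Ωˣ) (i : ι) :
    CoxSpace.weight (projCox ι) (Ω := Ω) t i = t 0 := by
  change ∏ j : Fin 1, t j ^ (1 : ℤ) = t 0
  simp

theorem coord_eq_iff_projCox {x y : ι → Ω} {p q : (projCox ι).Pt Ω}
    (hp : (projCox ι).Coord x p) (hq : (projCox ι).Coord y q) :
    p = q ↔ ∃ t : Ω, t ≠ 0 ∧ ∀ i, y i = t * x i := by
  refine (hp.eq_iff hq).trans ⟨?_, ?_⟩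
  · rintro ⟨t, ht⟩
    exact ⟨t (0 : Fin 1), Units.ne_zero _, fun i =>
      (ht i).trans (congrArg (fun u : Ωˣ => (u : Ω) * x i) (weight_projCox t i))⟩
  · rintro ⟨t, h0, ht⟩
    exact ⟨fun _ => Units.mk0 t h0, fun i =>
      (ht i).trans (congrArg (fun u : Ωˣ => (u : Ω) * x i)
        (weight_projCox (fun _ => Units.mk0 t h0) i)).symm⟩

theorem isWeightedHomogeneous_projCox {f : MvPolynomial ι Ω} {m : ℕ} (hf : f.IsHomogeneous m) :
    IsWeightedHomogeneous (projCox ι).deg f (fun _ => (m : ℤ)) := by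
  have key : ∀ c : ι →₀ ℕ, Finsupp.weight (fun (_ : ι) (_ : Fin 1) => (1 : ℤ)) c =
      fun _ => ((Finsupp.weight (1 : ι → ℕ) c : ℕ) : ℤ) := fun c => by
    funext j
    simp [Finsupp.weight_apply, Finsupp.sum, Finset.sum_apply]
  intro c hc
  have h := hf hc
  rw [← h]
  exact key c

theorem compatible_projCox {ι' : Type} {f : ι' → MvPolynomial ι Ω} {m : ℕ}
    (hf : ∀ v, (f v).IsHomogeneous m) :
    CoxSpace.Compatible (A := projCox ι) (B := projCox ι') f := by
  intro t x
  refine ⟨fun _ => t (0 : Fin 1) ^ m, fun v => ?_⟩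
  refine (CoxSpace.eval_smul (A := projCox ι) (isWeightedHomogeneous_projCox (hf v)) t x).trans
    (congrArg (fun u : Ωˣ => (u : Ω) * eval x (f v)) ?_)
  refine Eq.trans ?_ (weight_projCox (fun _ => t (0 : Fin 1) ^ m) v).symm
  change ∏ j : Fin 1, t j ^ (m : ℤ) = _
  simp

theorem perm_projCox {k : Type*} [Field k] [Algebra k Ω] (ξ : Ω) (τ : Ω ≃ₐ[k] Ω) (i : ι) :
    (projCox ι).perm ξ τ i = i := by
  unfold CoxSpace.perm
  split_ifs <;> rfl

end Projective

/-! ### Detecting which variables occur in a divisor -/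

section Truncation

open Classical in
/-- The homomorphism multiplying the variables in `I` by a new variable. -/
def scaleHom {σ R : Type*} [CommRing R] (I : Set σ) :
    MvPolynomial σ R →ₐ[R] Polynomial (MvPolynomial σ R) :=
  aeval fun v => if v ∈ I then Polynomial.X * Polynomial.C (X v) else Polynomial.C (X v)

open Classical in
/-- The homomorphism sending the variables in `I` to zero. -/
def truncHom {σ R : Type*} [CommRing R] (I : Set σ) : MvPolynomial σ R →ₐ[R] MvPolynomial σ R :=
  aeval fun v => if v ∈ I then 0 else X v

variable {σ R : Type*} [CommRing R] {I J : Set σ}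

theorem scaleHom_X_mem {v : σ} (h : v ∈ I) :
    scaleHom (R := R) I (X v) = Polynomial.X * Polynomial.C (X v) := by simp [scaleHom, h]

theorem scaleHom_X_notMem {v : σ} (h : v ∉ I) :
    scaleHom (R := R) I (X v) = Polynomial.C (X v) := by simp [scaleHom, h]

theorem eval_one_scaleHom (f : MvPolynomial σ R) : (scaleHom I f).eval 1 = f := by
  induction f using MvPolynomial.induction_on with
  | C a => rw [scaleHom, aeval_C, Polynomial.algebraMap_apply, algebraMap_eq, Polynomial.eval_C]
  | add p q hp hq => rw [map_add, Polynomial.eval_add, hp, hq]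
  | mul_X p v hp =>
    rw [map_mul, Polynomial.eval_mul, hp]
    by_cases h : v ∈ I
    · simp [scaleHom_X_mem h]
    · simp [scaleHom_X_notMem h]

theorem eval_zero_scaleHom (f : MvPolynomial σ R) : (scaleHom I f).eval 0 = truncHom I f := by
  induction f using MvPolynomial.induction_on with
  | C a =>
    rw [scaleHom, truncHom, aeval_C, aeval_C, Polynomial.algebraMap_apply, algebraMap_eq,
      Polynomial.eval_C]
  | add p q hp hq => rw [map_add, Polynomial.eval_add, hp, hq, map_add]
  | mul_X p v hp =>
    rw [map_mul, Polynomial.eval_mul, hp, map_mul]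
    by_cases h : v ∈ I
    · simp [scaleHom_X_mem h, truncHom, h]
    · simp [scaleHom_X_notMem h, truncHom, h]

open Classical in
theorem eval_truncHom (x : σ → R) (f : MvPolynomial σ R) :
    eval x (truncHom I f) = eval (fun v => if v ∈ I then 0 else x v) f := by
  induction f using MvPolynomial.induction_on with
  | C a => simp [truncHom]
  | add p q hp hq => simp only [map_add, hp, hq]
  | mul_X p v hp =>
    simp only [map_mul, hp]
    by_cases h : v ∈ I <;> simp [truncHom, h]

theorem truncHom_truncHom (f : MvPolynomial σ R) :
    truncHom I (truncHom J f) = truncHom (I ∪ J) f := by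
  induction f using MvPolynomial.induction_on with
  | C a => simp [truncHom]
  | add p q hp hq => simp only [map_add, hp, hq]
  | mul_X p v hp =>
    simp only [map_mul, hp]
    by_cases hI : v ∈ I <;> by_cases hJ : v ∈ J <;> simp [truncHom, hI, hJ]

theorem truncHom_iUnion {ι : Type*} [Finite ι] {K : ι → Set σ} {f : MvPolynomial σ R}
    (h : ∀ i, truncHom (K i) f = f) : truncHom (⋃ i, K i) f = f := by
  classical
  cases nonempty_fintype ι
  have key : ∀ s : Finset ι, truncHom (⋃ i ∈ s, K i) f = f := fun s => by
    induction s using Finset.induction_on with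
    | empty =>
      have : truncHom (R := R) (∅ : Set σ) = AlgHom.id R _ := by ext; simp [truncHom]
      simp [this]
    | insert i s hi ih => rw [Finset.set_biUnion_insert, ← truncHom_truncHom, ih, h]
  simpa using key Finset.univ

variable [IsDomain R]

/-- `hs` says that `G` does not involve the variables in `I`. Degrees in the scaling variable add up
in a product, so a divisor of `G` does not involve them either. -/
theorem truncHom_eq_self_of_dvd {h G : MvPolynomial σ R} (hG : h ∣ G) (h0 : G ≠ 0)
    (hs : scaleHom I G = Polynomial.C G) : truncHom I h = h := by
  obtain ⟨m, rfl⟩ := hG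
  rw [map_mul] at hs
  have hd : (scaleHom I h).natDegree = 0 := by
    have := congrArg Polynomial.natDegree hs
    rw [Polynomial.natDegree_C, Polynomial.natDegree_mul] at this
    · lia
    all_goals
      intro h'
      simp only [h', zero_mul, mul_zero] at hs
      exact h0 (Polynomial.C_eq_zero.1 hs.symm)
  rw [← eval_zero_scaleHom, Polynomial.eq_C_of_natDegree_eq_zero hd]
  conv_rhs => rw [← eval_one_scaleHom (I := I) h, Polynomial.eq_C_of_natDegree_eq_zero hd]
  simp

/-- `T` is homogeneous of degree one in the variables of `I`. If `h * m = T`, exactly one factor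
carries this degree; it is not `h`, because `h` divides `P`, which survives setting these variables
to zero. -/
theorem truncHom_eq_self_of_dvd_linear {h P T : MvPolynomial σ R} (hP : h ∣ P) (hT : h ∣ T)
    (h0 : T ≠ 0) (hs : scaleHom I T = Polynomial.X * Polynomial.C T) (hP0 : truncHom I P ≠ 0) :
    truncHom I h = h := by
  obtain ⟨m, rfl⟩ := hT
  obtain ⟨l, rfl⟩ := hP
  have hh : truncHom I h ≠ 0 := fun h' => hP0 (by rw [map_mul, h', zero_mul])
  rw [map_mul] at hs
  have hm : (scaleHom I m).eval 0 = 0 := by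
    have := congrArg (Polynomial.eval 0) hs
    rw [Polynomial.eval_mul, eval_zero_scaleHom] at this
    simpa [hh] using this
  obtain ⟨k, hk⟩ := Polynomial.dvd_iff_isRoot.2 hm
  rw [map_zero, sub_zero] at hk
  -- The single factor of the scaling variable has been moved to the cofactor `m`; cancelling it
  -- leaves a constant product, hence degree zero for the scaling of `h`.
  have hs' : scaleHom I h * k = Polynomial.C (h * m) := by
    apply mul_left_cancel₀ (Polynomial.X_ne_zero (R := MvPolynomial σ R))
    rw [← hs, hk]
    ring
  have hd : (scaleHom I h).natDegree = 0 := by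
    have := congrArg Polynomial.natDegree hs'
    rw [Polynomial.natDegree_C, Polynomial.natDegree_mul] at this
    · lia
    all_goals
      intro h'
      simp only [h', zero_mul, mul_zero] at hs'
      exact h0 (Polynomial.C_eq_zero.1 hs'.symm)
  rw [← eval_zero_scaleHom, Polynomial.eq_C_of_natDegree_eq_zero hd]
  conv_rhs => rw [← eval_one_scaleHom (I := I) h, Polynomial.eq_C_of_natDegree_eq_zero hd]
  simp

theorem isUnit_of_truncHom_univ {Ω : Type*} [Field Ω] {h : MvPolynomial σ Ω} (h0 : h ≠ 0)
    (ht : truncHom Set.univ h = h) : IsUnit h := by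
  have hc : ∀ f : MvPolynomial σ Ω, truncHom Set.univ f = C (constantCoeff f) := fun f => by
    induction f using MvPolynomial.induction_on with
    | C a => simp [truncHom]
    | add p q hp hq => simp only [map_add, hp, hq]
    | mul_X p v hp => simp [truncHom]
  rw [← ht, hc] at h0 ⊢
  exact (isUnit_iff_ne_zero.2 fun h' => h0 (by rw [h', C_0])).map C

end Truncation

/-! ### Coprimality of `P` and `Q`, and of `Ā` and `B̄` -/

section Coprime

instance (n : ℕ) : Finite (CoxVar n) :=
  Finite.of_injective (β := (Fin (n + 1) ⊕ Fin (n + 1)) ⊕ Fin 2)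
    (fun | .ev i => .inl (.inl i) | .od i => .inl (.inr i) | .wp => .inr 0 | .wm => .inr 1) (by
      rintro (_ | _ | _ | _) (_ | _ | _ | _) h <;> simp_all)

/-- `∑ z_{2i}^{d+1} z_{2i+1}^d`. -/
def coxP (R : Type*) [CommRing R] (n d : ℕ) : MvPolynomial (CoxVar n) R :=
  ∑ i : Fin (n + 1), X (.ev i) ^ (d + 1) * X (.od i) ^ d

/-- `∑ z_{2i}^d z_{2i+1}^{d+1}`. -/
def coxQ (R : Type*) [CommRing R] (n d : ℕ) : MvPolynomial (CoxVar n) R :=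
  ∑ i : Fin (n + 1), X (.ev i) ^ d * X (.od i) ^ (d + 1)

/-- Linearity in `w_+` and `w_-` is the source of both irreducibility and rationality. -/
theorem coxF_eq {R : Type*} [CommRing R] (ξ : R) (n d : ℕ) :
    coxF ξ n d = C (3 - ξ) * coxP R n d * X .wp - C (3 + ξ) * coxQ R n d * X .wm := by
  simp only [coxF, coxD, coxS, coxP, coxQ, Finset.mul_sum, Finset.sum_mul, ← Finset.sum_sub_distrib]
  refine Finset.sum_congr rfl fun i _ => ?_
  rw [map_sub, map_add, show (C (3 : R) : MvPolynomial (CoxVar n) R) = 3 from map_ofNat C 3]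
  ring

variable {Ω : Type*} [Field Ω] {n d : ℕ}

/-- A common divisor is shown to involve no variable at all, one pair `z_{2i}, z_{2i+1}` at a time.
Since `n ≥ 1` there is another index `j`, so `P` does not vanish when the `i`-th pair is set to
zero. -/
theorem isRelPrime_coxP_coxQ (hn : 1 ≤ n) (hd : 1 ≤ d) :
    IsRelPrime (coxP Ω n d) (coxQ Ω n d) := by
  classical
  intro h hP hQ
  have hd0 : d ≠ 0 := by lia
  have : Nontrivial (Fin (n + 1)) := Fin.nontrivial_iff_two_le.2 (by lia)
  have key : ∀ i : Fin (n + 1),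
      truncHom ({CoxVar.ev i, CoxVar.od i, CoxVar.wp, CoxVar.wm} : Set (CoxVar n)) h = h := by
    intro i
    obtain ⟨j, hj⟩ := exists_ne i
    -- This combination cancels the `i`-th summands, so only its explicit coefficients involve the
    -- `i`-th pair and it is linear in it.
    have hT : X (.od i) * coxP Ω n d - X (.ev i) * coxQ Ω n d =
        ∑ j ∈ Finset.univ.erase i, X (.ev j) ^ d * X (.od j) ^ d *
          (X (.od i) * X (.ev j) - X (.ev i) * X (.od j)) := by
      rw [Finset.sum_erase _ (by ring), coxP, coxQ, Finset.mul_sum, Finset.mul_sum,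
        ← Finset.sum_sub_distrib]
      exact Finset.sum_congr rfl fun j _ => by ring
    refine truncHom_eq_self_of_dvd_linear hP
      (dvd_sub (hP.mul_left (X (.od i))) (hQ.mul_left (X (.ev i)))) ?_ ?_ ?_
    · intro h0
      rw [h0] at hT
      -- At this point only the `j`-th summand survives, with value `1`.
      have := congrArg (eval fun v => if v = .ev j ∨ v = .od j ∨ v = .od i then 1 else 0) hT
      rw [map_zero, map_sum, Finset.sum_eq_single j] at this
      · simp [hj.symm] at this
      · intro k _ hk
        simp [hk, hd0]
      · simp [hj]
    · rw [hT, map_sum, map_sum, Finset.mul_sum]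
      refine Finset.sum_congr rfl fun j hj => ?_
      have hji := Finset.ne_of_mem_erase hj
      simp only [map_mul, map_pow, map_sub]
      rw [scaleHom_X_notMem (v := CoxVar.ev j) (by simp [hji]),
        scaleHom_X_notMem (v := CoxVar.od j) (by simp [hji]),
        scaleHom_X_mem (v := CoxVar.ev i) (by simp), scaleHom_X_mem (v := CoxVar.od i) (by simp)]
      ring
    · intro h0
      have := congrArg (eval fun v => if v = .ev j ∨ v = .od j then 1 else 0) h0
      rw [map_zero, eval_truncHom, coxP, map_sum, Finset.sum_eq_single j] at this
      · simp [hj] at this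
      · intro k _ hk
        simp [hk]
      · simp
  refine isUnit_of_truncHom_univ ?_ ((congrArg (truncHom · h) ?_).trans (truncHom_iUnion key))
  · rintro rfl
    have := congrArg (eval fun v => if v = .ev 0 ∨ v = .od 0 then 1 else 0) (zero_dvd_iff.1 hP)
    rw [map_zero, coxP, map_sum, Finset.sum_eq_single 0] at this
    · simp at this
    · intro k _ hk
      simp [hk]
    · simp
  · symm
    rw [Set.eq_univ_iff_forall]
    rintro (i | i | _ | _) <;> simp

/-- Same method: for each `i` a combination of `Ā` and `B̄` is linear in `u_{2i+1}, u_{2i+2}`, which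
excludes these variables from a common divisor; `u_0` is excluded because `Ā - B̄` does not contain
it. -/
theorem isRelPrime_polyA_polyB (h2 : (2 : Ω) ≠ 0) (h3 : (3 : Ω) ≠ 0) (hn : 1 ≤ n) (hd : 1 ≤ d) :
    IsRelPrime (polyA Ω n d) (polyB Ω n d) := by
  classical
  intro h hA hB
  have hd0 : d ≠ 0 := by lia
  have key : ∀ i : Fin n,
      truncHom ({some (i, 0), some (i, 1)} : Set (UIdx n)) h = h := by
    intro i
    have hT : (X (some (i, 0)) - X (some (i, 1))) * polyA Ω n d -
        (X (some (i, 0)) + 3 * X (some (i, 1))) * polyB Ω n d =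
        - 4 * X (some (i, 1)) * X none ^ (2 * d + 1) + ∑ j ∈ Finset.univ.erase i,
          (X (some (j, 0)) ^ 2 + 3 * X (some (j, 1)) ^ 2) ^ d *
          ((X (some (i, 0)) - X (some (i, 1))) * (X (some (j, 0)) + 3 * X (some (j, 1))) -
          (X (some (i, 0)) + 3 * X (some (i, 1))) * (X (some (j, 0)) - X (some (j, 1)))) := by
      rw [Finset.sum_erase _ (by ring), polyA, polyB, mul_add, mul_add, Finset.mul_sum,
        Finset.mul_sum, add_sub_add_comm, ← Finset.sum_sub_distrib]
      exact congrArg₂ _ (by ring) (Finset.sum_congr rfl fun j _ => by ring)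
    refine truncHom_eq_self_of_dvd_linear hA
      (dvd_sub (hA.mul_left (X (some (i, 0)) - X (some (i, 1))))
        (hB.mul_left (X (some (i, 0)) + 3 * X (some (i, 1))))) ?_ ?_ ?_
    · intro h0
      rw [h0] at hT
      have := congrArg (eval fun v => if v = none ∨ v = some (i, 1) then 1 else 0) hT
      rw [map_zero, map_add, map_sum, Finset.sum_eq_zero] at this
      · simp only [map_mul, map_neg, map_ofNat, map_pow, eval_X] at this
        simp only [or_true, true_or, if_true, mul_one, one_pow, add_zero] at this
        exact mul_ne_zero h2 h2 (by linear_combination this)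
      · intro k hk
        simp [hd0, Finset.ne_of_mem_erase hk]
    · rw [hT, map_add, map_sum, map_add, map_sum, mul_add, Finset.mul_sum]
      congr 1
      · simp only [map_mul, map_pow, map_neg, map_ofNat]
        rw [scaleHom_X_notMem (v := none) (by simp), scaleHom_X_mem (v := some (i, 1)) (by simp)]
        ring
      refine Finset.sum_congr rfl fun j hj => ?_
      have hji := Finset.ne_of_mem_erase hj
      simp only [map_mul, map_pow, map_sub, map_add, map_ofNat]
      rw [scaleHom_X_notMem (v := some (j, 0)) (by simp [hji]),
        scaleHom_X_notMem (v := some (j, 1)) (by simp [hji]),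
        scaleHom_X_mem (v := some (i, 0)) (by simp), scaleHom_X_mem (v := some (i, 1)) (by simp)]
      ring
    · intro h0
      have := congrArg (eval fun v => if v = none then 1 else 0) h0
      rw [map_zero, eval_truncHom, polyA, map_add, map_sum, Finset.sum_eq_zero] at this
      · simp at this
      · intro k _
        simp [hd0]
  have key' : truncHom ({none} : Set (UIdx n)) h = h := by
    have hT : polyA Ω n d - polyB Ω n d = ∑ j : Fin n,
        (X (some (j, 0)) ^ 2 + 3 * X (some (j, 1)) ^ 2) ^ d * (4 * X (some (j, 1))) := by
      rw [polyA, polyB, add_sub_add_left_eq_sub, ← Finset.sum_sub_distrib]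
      exact Finset.sum_congr rfl fun j _ => by ring
    refine truncHom_eq_self_of_dvd (dvd_sub hA hB) ?_ ?_
    · intro h0
      rw [h0] at hT
      have := congrArg (eval fun v => if v = some (⟨0, hn⟩, 1) then 1 else 0) hT
      rw [map_zero, map_sum, Finset.sum_eq_single ⟨0, hn⟩] at this
      · simp only [map_mul, map_ofNat, map_pow, eval_X, map_add] at this
        simp only [if_true, mul_one, one_pow] at this
        rw [if_neg (by simp), zero_pow two_ne_zero, zero_add] at this
        exact mul_ne_zero (pow_ne_zero d h3) (mul_ne_zero h2 h2) (by linear_combination -this)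
      · intro k _ hk
        simp [hk]
      · simp
    · rw [hT, map_sum, map_sum]
      refine Finset.sum_congr rfl fun j hj => ?_
      simp only [map_mul, map_pow, map_add, map_ofNat]
      rw [scaleHom_X_notMem (v := some (j, 0)) (by simp),
        scaleHom_X_notMem (v := some (j, 1)) (by simp)]
  refine isUnit_of_truncHom_univ ?_ ?_
  · rintro rfl
    have := congrArg (eval fun v => if v = none then 1 else 0) (zero_dvd_iff.1 hA)
    rw [map_zero, polyA, map_add, map_sum, Finset.sum_eq_zero] at this
    · simp at this
    · intro k _
      simp [hd0]
  · have := (congrArg (truncHom {none}) (truncHom_iUnion key)).trans key'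
    rw [truncHom_truncHom] at this
    refine (congrArg (truncHom · h) ?_).trans this
    symm
    rw [Set.eq_univ_iff_forall]
    rintro (_ | ⟨i, j⟩)
    · simp
    · fin_cases j <;> simp

end Coprime

/-! ### Irreducibility of `F̂` -/

section Irreducible

variable {Ω : Type*} [Field Ω] {n d : ℕ}

/-- Irreducibility of the affine hypersurface `F = 0`: if `f * h` vanished on it, a power of `f * h`
would be divisible by the prime `F` by the Nullstellensatz, hence `f` or `h` would be, against the
hypotheses. -/
theorem exists_zero_of_irreducible {σ : Type*} [Finite σ] [IsAlgClosed Ω] {F f h : MvPolynomial σ Ω}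
    (hF : Irreducible F) (hf : ∃ x, eval x F = 0 ∧ eval x f ≠ 0)
    (hh : ∃ x, eval x F = 0 ∧ eval x h ≠ 0) :
    ∃ x, eval x F = 0 ∧ eval x f ≠ 0 ∧ eval x h ≠ 0 := by
  by_contra! H
  have hmem : f * h ∈ vanishingIdeal Ω (zeroLocus Ω (Ideal.span {F})) := by
    rw [mem_vanishingIdeal_iff]
    intro x hx
    have hx0 : eval x F = 0 := hx F (Ideal.mem_span_singleton_self F)
    change eval x (f * h) = 0
    rw [map_mul]
    by_cases hfx : eval x f = 0
    · rw [hfx, zero_mul]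
    · rw [H x hx0 hfx, mul_zero]
  rw [vanishingIdeal_zeroLocus_eq_radical] at hmem
  obtain ⟨N, hN⟩ := hmem
  rw [Ideal.mem_span_singleton] at hN
  have key : ∀ g : MvPolynomial σ Ω, (∃ x, eval x F = 0 ∧ eval x g ≠ 0) → ¬ F ∣ g := by
    rintro g ⟨x, hx, hg⟩ ⟨m, rfl⟩
    exact hg (by rw [map_mul, hx, zero_mul])
  rcases hF.prime.dvd_or_dvd (hF.prime.dvd_of_dvd_pow hN) with h' | h'
  · exact key f hf h'
  · exact key h hh h'

theorem notMem_vars_coxP (v : CoxVar n) (h : v = .wp ∨ v = .wm) : v ∉ (coxP Ω n d).vars := by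
  classical
  intro hv
  obtain ⟨i, -, hi⟩ := Finset.mem_biUnion.1 (vars_sum_subset _ _ hv)
  rcases Finset.mem_union.1 (vars_mul _ _ hi) with h' | h'
  all_goals
    have := vars_pow _ _ h'
    rw [vars_X, Finset.mem_singleton] at this
    rcases h with h | h <;> simp [h] at this

theorem notMem_vars_coxQ (v : CoxVar n) (h : v = .wp ∨ v = .wm) : v ∉ (coxQ Ω n d).vars := by
  classical
  intro hv
  obtain ⟨i, -, hi⟩ := Finset.mem_biUnion.1 (vars_sum_subset _ _ hv)
  rcases Finset.mem_union.1 (vars_mul _ _ hi) with h' | h'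
  all_goals
    have := vars_pow _ _ h'
    rw [vars_X, Finset.mem_singleton] at this
    rcases h with h | h <;> simp [h] at this

open Classical in
theorem eval_single_coxP : eval (fun v : CoxVar n => if v = .ev 0 ∨ v = .od 0 then 1 else 0)
    (coxP Ω n d) = 1 := by
  rw [coxP, map_sum, Finset.sum_eq_single 0]
  · simp
  · intro k _ hk
    simp [hk]
  · simp

theorem coxP_ne_zero : coxP Ω n d ≠ 0 := fun h => by
  have := eval_single_coxP (Ω := Ω) (n := n) (d := d)
  rw [h, map_zero] at this
  exact zero_ne_one this

/-- A polynomial of degree one in `w_+` with coprime coefficients is irreducible. Here these are `P`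
and `Q w_-` up to units, and `w_-` does not divide `P`. -/
theorem irreducible_coxF {ξ : Ω} (hp : 3 + ξ ≠ 0) (hm : 3 - ξ ≠ 0) (hn : 1 ≤ n) (hd : 1 ≤ d) :
    Irreducible (coxF ξ n d) := by
  classical
  have hcp : IsUnit (C (3 + ξ) : MvPolynomial (CoxVar n) Ω) := (isUnit_iff_ne_zero.2 hp).map C
  have hcm : IsUnit (C (3 - ξ) : MvPolynomial (CoxVar n) Ω) := (isUnit_iff_ne_zero.2 hm).map C
  rw [coxF_eq, sub_eq_add_neg]
  refine irreducible_mul_X_add _ _ _ (mul_ne_zero hcm.ne_zero coxP_ne_zero) ?_ ?_ ?_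
  · intro h
    rcases Finset.mem_union.1 (vars_mul _ _ h) with h' | h'
    · simp at h'
    · exact notMem_vars_coxP _ (.inl rfl) h'
  · intro h
    rw [vars_neg] at h
    rcases Finset.mem_union.1 (vars_mul _ _ h) with h' | h'
    · rcases Finset.mem_union.1 (vars_mul _ _ h') with h' | h'
      · rw [vars_C] at h'
        simp at h'
      · exact notMem_vars_coxQ _ (.inl rfl) h'
    · simp at h'
  · rw [IsRelPrime.neg_right_iff, isRelPrime_mul_unit_left_left hcm, mul_assoc,
      isRelPrime_mul_unit_left_right hcp]
    refine (isRelPrime_coxP_coxQ hn hd).mul_right (IsRelPrime.symm ?_)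
    refine (MvPolynomial.X_prime (R := Ω) (i := CoxVar.wm (n := n))).irreducible.isRelPrime_iff_not_dvd.2 ?_
    rintro ⟨m, hm⟩
    have := eval_single_coxP (Ω := Ω) (n := n) (d := d)
    rw [hm] at this
    simp at this

end Irreducible

/-! ### The coordinates of `φ̄`: degree and absence of a common factor -/

section Parametrisation

variable {Ω : Type*} [Field Ω] {n d : ℕ}

/-- The coordinates `u_{2i+1}` for `i < n`, and `u_0` for `i = n`. -/
def uFst (Ω : Type*) [Field Ω] (n : ℕ) (i : Fin (n + 1)) : MvPolynomial (UIdx n) Ω :=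
  Fin.lastCases (motive := fun _ => MvPolynomial (UIdx n) Ω) (X none)
    (fun i => X (some (i, 0))) i

/-- The coordinates `u_{2i+2}` for `i < n`, and `0` for `i = n`. -/
def uSnd (Ω : Type*) [Field Ω] (n : ℕ) (i : Fin (n + 1)) : MvPolynomial (UIdx n) Ω :=
  Fin.lastCases (motive := fun _ => MvPolynomial (UIdx n) Ω) 0 (fun i => X (some (i, 1))) i

@[simp] theorem uFst_last : uFst Ω n (Fin.last n) = X none := by simp [uFst]
@[simp] theorem uFst_castSucc (i : Fin n) : uFst Ω n i.castSucc = X (some (i, 0)) := by simp [uFst]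
@[simp] theorem uSnd_last : uSnd Ω n (Fin.last n) = 0 := by simp [uSnd]
@[simp] theorem uSnd_castSucc (i : Fin n) : uSnd Ω n i.castSucc = X (some (i, 1)) := by simp [uSnd]

theorem isHomogeneous_uFst (i : Fin (n + 1)) : (uFst Ω n i).IsHomogeneous 1 := by
  refine Fin.lastCases ?_ (fun i => ?_) i
  · simpa using isHomogeneous_X _ _
  · simpa using isHomogeneous_X _ _

theorem isHomogeneous_uSnd (i : Fin (n + 1)) : (uSnd Ω n i).IsHomogeneous 1 := by
  refine Fin.lastCases ?_ (fun i => ?_) i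
  · simpa using isHomogeneous_zero _ _ _
  · simpa using isHomogeneous_X _ _

/-- The isolated term `u_0^{2d+1}` is the summand of the pair `(u_0, 0)`, so all `n + 1` indices can
be treated alike. -/
theorem polyA_eq : polyA Ω n d = ∑ i : Fin (n + 1), (uFst Ω n i + 3 * uSnd Ω n i) *
    (uFst Ω n i ^ 2 + 3 * uSnd Ω n i ^ 2) ^ d := by
  rw [polyA, Fin.sum_univ_castSucc, add_comm]
  simp only [uFst_last, uFst_castSucc, uSnd_last, uSnd_castSucc]
  rw [pow_succ (X none), pow_mul]
  ring

theorem polyB_eq : polyB Ω n d = ∑ i : Fin (n + 1), (uFst Ω n i - uSnd Ω n i) *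
    (uFst Ω n i ^ 2 + 3 * uSnd Ω n i ^ 2) ^ d := by
  rw [polyB, Fin.sum_univ_castSucc, add_comm]
  simp only [uFst_last, uFst_castSucc, uSnd_last, uSnd_castSucc]
  rw [pow_succ (X none), pow_mul]
  ring

theorem phiBar_zero (i : Fin (n + 1)) : phiBar Ω n d (i, 0) =
    C (1 / 2) * ((uFst Ω n i - 3 * uSnd Ω n i) * polyA Ω n d
      - 3 * (uFst Ω n i + uSnd Ω n i) * polyB Ω n d) := by
  refine Fin.lastCases ?_ (fun i => ?_) i
  · simp only [phiBar, uFst_last, uSnd_last, Fin.lastCases_last, if_true]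
    ring
  · simp [phiBar]

theorem phiBar_one (i : Fin (n + 1)) : phiBar Ω n d (i, 1) =
    uFst Ω n i * polyA Ω n d - 3 * uSnd Ω n i * polyB Ω n d := by
  refine Fin.lastCases ?_ (fun i => ?_) i
  · simp [phiBar]
  · simp [phiBar]

theorem MvPolynomial.IsHomogeneous.three_mul {σ : Type*} {f : MvPolynomial σ Ω} {m : ℕ} (h : f.IsHomogeneous m) :
    (3 * f).IsHomogeneous m := by
  have := (isHomogeneous_C σ (3 : Ω)).mul h
  rwa [map_ofNat, zero_add] at this

theorem isHomogeneous_polyA : (polyA Ω n d).IsHomogeneous (2 * d + 1) := by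
  rw [polyA_eq, show 2 * d + 1 = 1 + 2 * d by ring]
  refine IsHomogeneous.sum _ _ _ fun i _ => ?_
  exact ((isHomogeneous_uFst i).add (isHomogeneous_uSnd i).three_mul).mul
    ((((isHomogeneous_uFst i).pow 2).add ((isHomogeneous_uSnd i).pow 2).three_mul).pow d)

theorem isHomogeneous_polyB : (polyB Ω n d).IsHomogeneous (2 * d + 1) := by
  rw [polyB_eq, show 2 * d + 1 = 1 + 2 * d by ring]
  refine IsHomogeneous.sum _ _ _ fun i _ => ?_
  exact ((isHomogeneous_uFst i).sub (isHomogeneous_uSnd i)).mul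
    ((((isHomogeneous_uFst i).pow 2).add ((isHomogeneous_uSnd i).pow 2).three_mul).pow d)

theorem isHomogeneous_phiBar (v : XIdx n) : (phiBar Ω n d v).IsHomogeneous (2 * d + 2) := by
  obtain ⟨i, j⟩ := v
  have hA := isHomogeneous_polyA (Ω := Ω) (n := n) (d := d)
  have hB := isHomogeneous_polyB (Ω := Ω) (n := n) (d := d)
  have h1 := isHomogeneous_uFst (Ω := Ω) i
  have h2 := isHomogeneous_uSnd (Ω := Ω) i
  have e : 2 * d + 2 = 0 + (1 + (2 * d + 1)) := by ring
  fin_cases j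
  · change (phiBar Ω n d (i, 0)).IsHomogeneous _
    rw [phiBar_zero, e]
    exact (isHomogeneous_C _ _).mul (((h1.sub h2.three_mul).mul hA).sub
      ((h1.add h2).three_mul.mul hB))
  · change (phiBar Ω n d (i, 1)).IsHomogeneous _
    rw [phiBar_one, e, zero_add]
    exact (h1.mul hA).sub (h2.three_mul.mul hB)

/-- Write `N_i = a_i² + 3 b_i²` for the `i`-th pair. Solving the two `i`-th coordinates for `Ā` and
`B̄` shows that a common factor divides `N_i Ā` and `N_i B̄`. As `Ā, B̄` are coprime, an irreducible
factor divides every `N_i`. The last one is `u_0²`, so this factor is `u_0` up to a unit, which does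
not divide `N_0 = u_1² + 3 u_2²`. -/
theorem isUnit_of_dvd_phiBar (h2 : (2 : Ω) ≠ 0) (h3 : (3 : Ω) ≠ 0) (hn : 1 ≤ n) (hd : 1 ≤ d)
    {g : MvPolynomial (UIdx n) Ω} (hg : ∀ v, g ∣ phiBar Ω n d v) : IsUnit g := by
  classical
  have hc2 : IsUnit (2 : MvPolynomial (UIdx n) Ω) := by
    rw [← map_ofNat C]; exact (isUnit_iff_ne_zero.2 h2).map C
  have hc3 : IsUnit (3 : MvPolynomial (UIdx n) Ω) := by
    rw [← map_ofNat C]; exact (isUnit_iff_ne_zero.2 h3).map C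
  have hhalf : (C (1 / 2) : MvPolynomial (UIdx n) Ω) * 2 = 1 := by
    rw [← map_ofNat C 2, ← C_mul, one_div, inv_mul_cancel₀ h2, C_1]
  have hA : ∀ i, g ∣ (uFst Ω n i ^ 2 + 3 * uSnd Ω n i ^ 2) * polyA Ω n d := fun i => by
    have := (((hg (i, 1)).mul_left (uFst Ω n i + uSnd Ω n i)).sub
      (((hg (i, 0)).mul_left (2 * uSnd Ω n i))))
    rw [phiBar_zero, phiBar_one] at this
    convert this using 1
    linear_combination (uSnd Ω n i) * ((uFst Ω n i - 3 * uSnd Ω n i) * polyA Ω n d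
      - 3 * (uFst Ω n i + uSnd Ω n i) * polyB Ω n d) * hhalf
  have hB : ∀ i, g ∣ (uFst Ω n i ^ 2 + 3 * uSnd Ω n i ^ 2) * polyB Ω n d := fun i => by
    have := (((hg (i, 1)).mul_left (uFst Ω n i - 3 * uSnd Ω n i)).sub
      (((hg (i, 0)).mul_left (2 * uFst Ω n i))))
    rw [phiBar_zero, phiBar_one] at this
    refine hc3.dvd_mul_left.1 ?_
    convert this using 1
    linear_combination (uFst Ω n i) * ((uFst Ω n i - 3 * uSnd Ω n i) * polyA Ω n d
      - 3 * (uFst Ω n i + uSnd Ω n i) * polyB Ω n d) * hhalf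
  have hrel := isRelPrime_polyA_polyB h2 h3 hn hd (Ω := Ω)
  by_contra hu
  have h0 : polyA Ω n d ≠ 0 ∨ polyB Ω n d ≠ 0 := by
    by_contra! h
    rw [h.1, h.2] at hrel
    exact not_isUnit_zero (hrel dvd_rfl dvd_rfl)
  have hN : uFst Ω n (Fin.last n) ^ 2 + 3 * uSnd Ω n (Fin.last n) ^ 2 = X none ^ 2 := by simp
  have hg0 : g ≠ 0 := by
    rintro rfl
    have hA' := hA (Fin.last n)
    have hB' := hB (Fin.last n)
    rw [hN, zero_dvd_iff, mul_eq_zero] at hA' hB'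
    rcases h0 with h0 | h0
    · exact (hA'.resolve_right h0) |> pow_ne_zero 2 (X_ne_zero none)
    · exact (hB'.resolve_right h0) |> pow_ne_zero 2 (X_ne_zero none)
  obtain ⟨p, hp, hpg⟩ := WfDvdMonoid.exists_irreducible_factor hu hg0
  have hdvd : ∀ i, p ∣ uFst Ω n i ^ 2 + 3 * uSnd Ω n i ^ 2 := fun i => by
    by_contra hpi
    exact hp.not_isUnit (hrel ((hp.prime.dvd_or_dvd (hpg.trans (hA i))).resolve_left hpi)
      ((hp.prime.dvd_or_dvd (hpg.trans (hB i))).resolve_left hpi))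
  have h1 := hdvd (Fin.last n)
  rw [hN] at h1
  have hX := (hp.associated_of_dvd MvPolynomial.X_prime.irreducible (hp.prime.dvd_of_dvd_pow h1)).symm.dvd
  obtain ⟨m, hm⟩ := hX.trans (hdvd (Fin.castSucc ⟨0, hn⟩))
  have := congrArg (eval fun v => if v = some (⟨0, hn⟩, 0) then 1 else 0) hm
  simp only [uFst_castSucc, uSnd_castSucc] at this
  simp at this

end Parametrisation

/-! ### The toric variety, the blow-down and its section -/

section Toric

variable {Ω : Type*} [Field Ω] {n d : ℕ}

theorem stable_toricT {x : CoxVar n → Ω} : (toricT n).Stable x ↔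
    (∃ i, x (.ev i) ≠ 0) ∧ (∃ i, x (.od i) ≠ 0) ∧ (x .wp ≠ 0 ∨ x .wm ≠ 0) := by
  constructor
  · intro h
    obtain ⟨_, ⟨i, rfl⟩, hi⟩ := h (Set.range CoxVar.ev) (.inl rfl)
    obtain ⟨_, ⟨j, rfl⟩, hj⟩ := h (Set.range CoxVar.od) (.inr (.inl rfl))
    obtain ⟨_, rfl | rfl, hw⟩ := h {CoxVar.wp, CoxVar.wm} (.inr (.inr rfl))
    · exact ⟨⟨i, hi⟩, ⟨j, hj⟩, .inl hw⟩
    · exact ⟨⟨i, hi⟩, ⟨j, hj⟩, .inr hw⟩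
  · rintro ⟨⟨i, hi⟩, ⟨j, hj⟩, hw⟩ C (rfl | rfl | rfl)
    · exact ⟨_, ⟨i, rfl⟩, hi⟩
    · exact ⟨_, ⟨j, rfl⟩, hj⟩
    · rcases hw with hw | hw
      · exact ⟨_, .inl rfl, hw⟩
      · exact ⟨_, .inr rfl, hw⟩

theorem weight_toricT (t : Fin 3 → Ωˣ) (v : CoxVar n) :
    CoxSpace.weight (toricT n) (Ω := Ω) t v =
      match v with
      | .ev _ => t 0 * (t 1)⁻¹
      | .od _ => t 0 * (t 2)⁻¹
      | .wp => t 1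
      | .wm => t 2 := by
  change ∏ j : Fin 3, t j ^ CoxVar.deg v j = _
  rw [Fin.prod_univ_three]
  cases v <;> simp [CoxVar.deg]

/-- A torus element `(t_0, t_1, t_2)` scales the four blocks by `r = t_0/t_1`, `s = t_0/t_2`, `a =
t_1`, `b = t_2`; the only relation among these is `r a = t_0 = s b`. -/
theorem coord_eq_iff_toricT {x y : CoxVar n → Ω} {p q : (toricT n).Pt Ω}
    (hp : (toricT n).Coord x p) (hq : (toricT n).Coord y q) :
    p = q ↔ ∃ r s a b : Ω, a ≠ 0 ∧ b ≠ 0 ∧ r ≠ 0 ∧ s ≠ 0 ∧ r * a = s * b ∧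
      (∀ i, y (.ev i) = r * x (.ev i)) ∧ (∀ i, y (.od i) = s * x (.od i)) ∧
      y .wp = a * x .wp ∧ y .wm = b * x .wm := by
  have hw := weight_toricT (Ω := Ω) (n := n)
  refine (hp.eq_iff hq).trans ⟨?_, ?_⟩
  · rintro ⟨t, ht⟩
    replace ht := fun v =>
      (ht v).trans (congrArg (fun u : Ωˣ => (u : Ω) * x v) (hw t v))
    let t' : Fin 3 → Ωˣ := t
    refine ⟨(t' 0 * (t' 1)⁻¹ : Ωˣ), (t' 0 * (t' 2)⁻¹ : Ωˣ), t' 1, t' 2, Units.ne_zero _,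
      Units.ne_zero _, Units.ne_zero _, Units.ne_zero _, ?_, fun i => ht (.ev i),
      fun i => ht (.od i), ht .wp, ht .wm⟩
    rw [← Units.val_mul, ← Units.val_mul, inv_mul_cancel_right, inv_mul_cancel_right]
  · rintro ⟨r, s, a, b, ha, hb, hr, hs, hab, h1, h2, h3, h4⟩
    let t : Fin 3 → Ωˣ := ![Units.mk0 r hr * Units.mk0 a ha, Units.mk0 a ha, Units.mk0 b hb]
    have hab' : Units.mk0 r hr * Units.mk0 a ha = Units.mk0 s hs * Units.mk0 b hb :=
      Units.ext hab
    refine ⟨t, fun v => Eq.trans ?_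
      (congrArg (fun u : Ωˣ => (u : Ω) * x v) (hw t v)).symm⟩
    cases v with
    | ev i => simp [t, h1]
    | od i => simp [t, h2, hab']
    | wp => simp [t, h3]
    | wm => simp [t, h4]

theorem isWeightedHomogeneous_ev (i : Fin (n + 1)) :
    IsWeightedHomogeneous (CoxVar.deg (n := n)) (X (.ev i) : MvPolynomial (CoxVar n) Ω)
      ![1, -1, 0] := isWeightedHomogeneous_X _ _ _

theorem isWeightedHomogeneous_od (i : Fin (n + 1)) :
    IsWeightedHomogeneous (CoxVar.deg (n := n)) (X (.od i) : MvPolynomial (CoxVar n) Ω)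
      ![1, 0, -1] := isWeightedHomogeneous_X _ _ _

theorem isWeightedHomogeneous_wp :
    IsWeightedHomogeneous (CoxVar.deg (n := n)) (X .wp : MvPolynomial (CoxVar n) Ω)
      ![0, 1, 0] := isWeightedHomogeneous_X _ _ _

theorem isWeightedHomogeneous_wm :
    IsWeightedHomogeneous (CoxVar.deg (n := n)) (X .wm : MvPolynomial (CoxVar n) Ω)
      ![0, 0, 1] := isWeightedHomogeneous_X _ _ _

theorem MvPolynomial.IsWeightedHomogeneous.of_eq {σ M : Type*} [AddCommMonoid M] {w : σ → M}
    {f : MvPolynomial σ Ω} {m m' : M} (h : IsWeightedHomogeneous w f m) (hm : m = m') :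
    IsWeightedHomogeneous w f m' := hm ▸ h

theorem isWeightedHomogeneous_coxP : IsWeightedHomogeneous (CoxVar.deg (n := n))
    (coxP Ω n d) ![2 * (d : ℤ) + 1, -(d : ℤ) - 1, -(d : ℤ)] := by
  refine IsWeightedHomogeneous.sum _ _ _ fun i _ => ?_
  refine MvPolynomial.IsWeightedHomogeneous.of_eq (((isWeightedHomogeneous_ev i).pow (d + 1)).mul ((isWeightedHomogeneous_od i).pow d)) ?_
  funext j
  fin_cases j <;> simp <;> ring

theorem isWeightedHomogeneous_coxQ : IsWeightedHomogeneous (CoxVar.deg (n := n))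
    (coxQ Ω n d) ![2 * (d : ℤ) + 1, -(d : ℤ), -(d : ℤ) - 1] := by
  refine IsWeightedHomogeneous.sum _ _ _ fun i _ => ?_
  refine MvPolynomial.IsWeightedHomogeneous.of_eq (((isWeightedHomogeneous_ev i).pow d).mul ((isWeightedHomogeneous_od i).pow (d + 1))) ?_
  funext j
  fin_cases j <;> simp <;> ring

theorem isWeightedHomogeneous_coxF (ξ : Ω) : IsWeightedHomogeneous (CoxVar.deg (n := n))
    (coxF ξ n d) ![2 * (d : ℤ) + 1, -(d : ℤ), -(d : ℤ)] := by
  rw [coxF_eq]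
  refine IsWeightedHomogeneous.sub ?_ ?_
  · refine MvPolynomial.IsWeightedHomogeneous.of_eq ((isWeightedHomogeneous_coxP.C_mul (3 - ξ)).mul isWeightedHomogeneous_wp) ?_
    funext j
    fin_cases j <;> simp
  · refine MvPolynomial.IsWeightedHomogeneous.of_eq ((isWeightedHomogeneous_coxQ.C_mul (3 + ξ)).mul isWeightedHomogeneous_wm) ?_
    funext j
    fin_cases j <;> simp

theorem isWeightedHomogeneous_blowDown (ξ : Ω) (v : XIdx n) :
    IsWeightedHomogeneous (CoxVar.deg (n := n)) (blowDown ξ n v) ![1, 0, 0] := by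
  have h1 : IsWeightedHomogeneous (CoxVar.deg (n := n))
      (X (.od v.1) * X .wm : MvPolynomial (CoxVar n) Ω) ![1, 0, 0] := by
    refine MvPolynomial.IsWeightedHomogeneous.of_eq ((isWeightedHomogeneous_od v.1).mul isWeightedHomogeneous_wm) ?_
    funext j
    fin_cases j <;> simp
  have h2 : IsWeightedHomogeneous (CoxVar.deg (n := n))
      (X (.ev v.1) * X .wp : MvPolynomial (CoxVar n) Ω) ![1, 0, 0] := by
    refine MvPolynomial.IsWeightedHomogeneous.of_eq ((isWeightedHomogeneous_ev v.1).mul isWeightedHomogeneous_wp) ?_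
    funext j
    fin_cases j <;> simp
  unfold blowDown
  split_ifs
  · exact ((h1.C_mul _).sub (h2.C_mul _)).C_mul _
  · exact (h1.sub h2).C_mul _

theorem compatible_of_isWeightedHomogeneous {A : CoxSpace} {ι : Type}
    {f : ι → MvPolynomial A.Var Ω} {c : Fin A.rank → ℤ}
    (hf : ∀ v, IsWeightedHomogeneous A.deg (f v) c) :
    CoxSpace.Compatible (A := A) (B := projCox ι) f := by
  intro t x
  refine ⟨fun _ => ∏ j, t j ^ c j, fun v => ?_⟩
  exact (CoxSpace.eval_smul (hf v) t x).trans
    (congrArg (fun u : Ωˣ => (u : Ω) * eval x (f v))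
      (weight_projCox (fun _ => ∏ j, t j ^ c j) v).symm)

theorem compatible_projCox_toricT {ι : Type} {f : CoxVar n → MvPolynomial ι Ω} {m l : ℕ}
    (he : ∀ i, (f (.ev i)).IsHomogeneous m) (ho : ∀ i, (f (.od i)).IsHomogeneous m)
    (hp : (f .wp).IsHomogeneous l) (hm : (f .wm).IsHomogeneous l) :
    CoxSpace.Compatible (A := projCox ι) (B := toricT n) f := by
  intro t x
  let t' : Fin 1 → Ωˣ := t
  let s : Fin 3 → Ωˣ := ![t' 0 ^ (m + l), t' 0 ^ l, t' 0 ^ l]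
  have key : ∀ (g : MvPolynomial ι Ω) (e : ℕ), g.IsHomogeneous e →
      eval (fun w => (CoxSpace.weight (projCox ι) t w : Ω) * x w) g = (t' 0 ^ e : Ωˣ) * eval x g := by
    intro g e hg
    refine (CoxSpace.eval_smul (A := projCox ι) (isWeightedHomogeneous_projCox hg) t x).trans
      (congrArg (fun u : Ωˣ => (u : Ω) * eval x g) ?_)
    change ∏ j : Fin 1, t' j ^ (e : ℤ) = _
    simp
  refine ⟨s, fun v => Eq.trans ?_
    (congrArg (fun u : Ωˣ => (u : Ω) * eval x (f v)) (weight_toricT s v)).symm⟩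
  cases v with
  | ev i => exact (key _ _ (he i)).trans (by simp [s, pow_add])
  | od i => exact (key _ _ (ho i)).trans (by simp [s, pow_add])
  | wp => exact (key _ _ hp).trans (by simp [s])
  | wm => exact (key _ _ hm).trans (by simp [s])

theorem mem_hypersurface_iff {x : XIdx n → Ω} {p : (projCox (XIdx n)).Pt Ω}
    (hp : (projCox (XIdx n)).Coord x p) :
    p ∈ hypersurface Ω n d ↔ eval x (hypersurfaceEq Ω n d) = 0 := by
  refine CoxSpace.mem_zeroLocus_iff (A := projCox (XIdx n))
    (isWeightedHomogeneous_projCox (m := 1 + 2 * d) ?_) hp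
  refine IsHomogeneous.sum _ _ _ fun i _ => ?_
  exact ((isHomogeneous_X _ _).add (isHomogeneous_X _ _)).mul
    (((((isHomogeneous_X _ _).pow 2).sub ((isHomogeneous_X _ _).mul (isHomogeneous_X _ _))).add
      ((isHomogeneous_X _ _).pow 2)).pow d)

theorem mem_Xtilde_iff {ξ : Ω} {x : CoxVar n → Ω} {p : (toricT n).Pt Ω}
    (hp : (toricT n).Coord x p) : p ∈ Xtilde ξ n d ↔ eval x (coxF ξ n d) = 0 :=
  CoxSpace.mem_zeroLocus_iff (A := toricT n) (isWeightedHomogeneous_coxF ξ) hp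

/-! The linear forms `y_{2i}`, `y_{2i+1}` and the section of the blow-down outside the centre. -/

/-- The section of the blow-down with `w_+ = w_- = 1`. -/
def toCox (ξ : Ω) (n : ℕ) : CoxVar n → MvPolynomial (XIdx n) Ω
  | .ev i => X (i, 0) - C ((1 + ξ) / 2) * X (i, 1)
  | .od i => X (i, 0) - C ((1 - ξ) / 2) * X (i, 1)
  | .wp => 1
  | .wm => 1

theorem eval_toCox_ev (ξ : Ω) (x : XIdx n → Ω) (i : Fin (n + 1)) :
    eval x (toCox ξ n (.ev i)) = x (i, 0) - (1 + ξ) / 2 * x (i, 1) := by simp [toCox]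

theorem eval_toCox_od (ξ : Ω) (x : XIdx n → Ω) (i : Fin (n + 1)) :
    eval x (toCox ξ n (.od i)) = x (i, 0) - (1 - ξ) / 2 * x (i, 1) := by simp [toCox]

@[simp] theorem eval_toCox_wp (ξ : Ω) (x : XIdx n → Ω) : eval x (toCox ξ n .wp) = 1 := by
  simp [toCox]

@[simp] theorem eval_toCox_wm (ξ : Ω) (x : XIdx n → Ω) : eval x (toCox ξ n .wm) = 1 := by
  simp [toCox]

theorem compatible_toCox (ξ : Ω) :
    CoxSpace.Compatible (A := projCox (XIdx n)) (B := toricT n) (toCox ξ n) :=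
  compatible_projCox_toricT (m := 1) (l := 0)
    (fun _ => (isHomogeneous_X _ _).sub (by simpa using (isHomogeneous_C _ _).mul (isHomogeneous_X _ _)))
    (fun _ => (isHomogeneous_X _ _).sub (by simpa using (isHomogeneous_C _ _).mul (isHomogeneous_X _ _)))
    (isHomogeneous_one _ _) (isHomogeneous_one _ _)

theorem compatible_blowDown (ξ : Ω) :
    CoxSpace.Compatible (A := toricT n) (B := projCox (XIdx n)) (blowDown ξ n) :=
  compatible_of_isWeightedHomogeneous (A := toricT n) (isWeightedHomogeneous_blowDown ξ)

theorem eval_blowDown_zero (ξ : Ω) (z : CoxVar n → Ω) (i : Fin (n + 1)) :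
    eval z (blowDown ξ n (i, 0)) = 1 / ξ * ((1 + ξ) / 2 * (z (.od i) * z .wm) -
      (1 - ξ) / 2 * (z (.ev i) * z .wp)) := by simp [blowDown]

theorem eval_blowDown_one (ξ : Ω) (z : CoxVar n → Ω) (i : Fin (n + 1)) :
    eval z (blowDown ξ n (i, 1)) = 1 / ξ * (z (.od i) * z .wm - z (.ev i) * z .wp) := by
  simp [blowDown]

theorem eval_coxF (ξ : Ω) (z : CoxVar n → Ω) : eval z (coxF ξ n d) =
    ∑ i, (z (.ev i) * z (.od i)) ^ d *
      ((3 - ξ) * (z .wp * z (.ev i)) - (3 + ξ) * (z .wm * z (.od i))) := by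
  simp only [coxF, coxD, coxS, map_sub, map_mul, map_sum, map_pow, map_add, eval_X, map_ofNat,
    eval_C, Finset.mul_sum, ← Finset.sum_sub_distrib]
  exact Finset.sum_congr rfl fun i _ => by ring

theorem eval_coxF' (ξ : Ω) (z : CoxVar n → Ω) : eval z (coxF ξ n d) =
    (3 - ξ) * eval z (coxP Ω n d) * z .wp - (3 + ξ) * eval z (coxQ Ω n d) * z .wm := by
  simp [coxF_eq]

theorem eval_hypersurfaceEq (x : XIdx n → Ω) : eval x (hypersurfaceEq Ω n d) =
    ∑ i, (x (i, 0) + x (i, 1)) * (x (i, 0) ^ 2 - x (i, 0) * x (i, 1) + x (i, 1) ^ 2) ^ d := by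
  simp [hypersurfaceEq]

variable {ξ : Ω}

theorem eval_toCox_ev_blowDown (h2 : (2 : Ω) ≠ 0) (h0 : ξ ≠ 0) (z : CoxVar n → Ω)
    (i : Fin (n + 1)) : eval (fun v => eval z (blowDown ξ n v)) (toCox ξ n (.ev i)) =
      z (.ev i) * z .wp := by
  rw [eval_toCox_ev, eval_blowDown_zero, eval_blowDown_one]
  field_simp
  ring

theorem eval_toCox_od_blowDown (h2 : (2 : Ω) ≠ 0) (h0 : ξ ≠ 0) (z : CoxVar n → Ω)
    (i : Fin (n + 1)) : eval (fun v => eval z (blowDown ξ n v)) (toCox ξ n (.od i)) =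
      z (.od i) * z .wm := by
  rw [eval_toCox_od, eval_blowDown_zero, eval_blowDown_one]
  field_simp
  ring

theorem eval_blowDown_toCox (h2 : (2 : Ω) ≠ 0) (h0 : ξ ≠ 0) (x : XIdx n → Ω) (v : XIdx n) :
    eval (fun w => eval x (toCox ξ n w)) (blowDown ξ n v) = x v := by
  obtain ⟨i, j⟩ := v
  fin_cases j
  · change eval _ (blowDown ξ n (i, 0)) = x (i, 0)
    rw [eval_blowDown_zero, eval_toCox_ev, eval_toCox_od, eval_toCox_wp, eval_toCox_wm]
    field_simp
    ring
  · change eval _ (blowDown ξ n (i, 1)) = x (i, 1)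
    rw [eval_blowDown_one, eval_toCox_ev, eval_toCox_od, eval_toCox_wp, eval_toCox_wm]
    field_simp
    ring

/-- At `w_+ = w_- = 1` the product `z_{2i} z_{2i+1}` is the quadratic factor, and the linear factor
of `F̂` is `-2ξ` times `x_{2i} + x_{2i+1}`. -/
theorem eval_coxF_toCox (h2 : (2 : Ω) ≠ 0) (hξ : ξ ^ 2 = -3) (x : XIdx n → Ω) :
    eval (fun w => eval x (toCox ξ n w)) (coxF ξ n d) =
      -2 * ξ * eval x (hypersurfaceEq Ω n d) := by
  rw [eval_coxF, eval_hypersurfaceEq, Finset.mul_sum]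
  refine Finset.sum_congr rfl fun i _ => ?_
  rw [eval_toCox_ev, eval_toCox_od, eval_toCox_wp, eval_toCox_wm]
  have h : (x (i, 0) - (1 + ξ) / 2 * x (i, 1)) * (x (i, 0) - (1 - ξ) / 2 * x (i, 1)) =
      x (i, 0) ^ 2 - x (i, 0) * x (i, 1) + x (i, 1) ^ 2 := by
    field_simp
    linear_combination -(x (i, 1)) ^ 2 * hξ
  rw [h]
  have h' : (3 - ξ) * (1 * (x (i, 0) - (1 + ξ) / 2 * x (i, 1))) -
      (3 + ξ) * (1 * (x (i, 0) - (1 - ξ) / 2 * x (i, 1))) =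
        -2 * ξ * (x (i, 0) + x (i, 1)) := by
    field_simp
    ring
  rw [h']
  ring

theorem bind₁_blowDown_hypersurfaceEq (h2 : (2 : Ω) ≠ 0) (h0 : ξ ≠ 0) (hξ : ξ ^ 2 = -3) :
    bind₁ (blowDown ξ n) (hypersurfaceEq Ω n d) =
      C (-(1 / (2 * ξ))) * (X .wp ^ d * X .wm ^ d * coxF ξ n d) := by
  have hc : ∀ c : Ω, c * (-(2 * ξ)) = 1 → ∀ f g : MvPolynomial (CoxVar n) Ω,
      C (-(2 * ξ)) * f = g → f = C c * g := by
    rintro c hc f g rfl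
    rw [← mul_assoc, ← C_mul, hc, C_1, one_mul]
  refine hc _ (by field_simp) _ _ ?_
  simp only [hypersurfaceEq, coxF, coxD, coxS, map_sum, map_mul, map_pow, map_add, map_sub,
    bind₁_X_right, Finset.mul_sum, ← Finset.sum_sub_distrib]
  refine Finset.sum_congr rfl fun i _ => ?_
  set E : MvPolynomial (CoxVar n) Ω := X (.ev i) * X .wp
  set O : MvPolynomial (CoxVar n) Ω := X (.od i) * X .wm
  have e0 : blowDown ξ n (i, 0) = C (1 / ξ) * (C ((1 + ξ) / 2) * O - C ((1 - ξ) / 2) * E) := by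
    simp [blowDown, E, O]
  have e1 : blowDown ξ n (i, 1) = C (1 / ξ) * (O - E) := by simp [blowDown, E, O]
  have hinv : (C (1 / ξ) : MvPolynomial (CoxVar n) Ω) * C ξ = 1 := by
    rw [← C_mul, one_div, inv_mul_cancel₀ h0, C_1]
  have hxx : (C ξ : MvPolynomial (CoxVar n) Ω) ^ 2 = -3 := by
    rw [← C_pow, hξ, C_neg, map_ofNat]
  have hp : (C ((1 + ξ) / 2) : MvPolynomial (CoxVar n) Ω) * 2 = 1 + C ξ := by
    rw [← map_ofNat C 2, ← C_mul, div_mul_cancel₀ _ h2, C_add, C_1]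
  have hm : (C ((1 - ξ) / 2) : MvPolynomial (CoxVar n) Ω) * 2 = 1 - C ξ := by
    rw [← map_ofNat C 2, ← C_mul, div_mul_cancel₀ _ h2, C_sub, C_1]
  have h22 : (2 : MvPolynomial (CoxVar n) Ω) ≠ 0 := by
    rw [← map_ofNat C 2]
    exact C_ne_zero.2 h2
  have hsum : C (-(2 * ξ)) * (blowDown ξ n (i, 0) + blowDown ξ n (i, 1)) =
      3 * (E - O) - C ξ * (E + O) := by
    rw [e0, e1, C_neg, C_mul, map_ofNat]
    linear_combination (-(C ((1 + ξ) / 2) * 2 * O - C ((1 - ξ) / 2) * 2 * E + 2 * (O - E))) * hinv -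
      O * hp + E * hm
  have hnorm : blowDown ξ n (i, 0) ^ 2 - blowDown ξ n (i, 0) * blowDown ξ n (i, 1) +
      blowDown ξ n (i, 1) ^ 2 = E * O := by
    have hx3 : (C ξ : MvPolynomial (CoxVar n) Ω) ≠ 0 := C_ne_zero.2 h0
    -- Multiplying by `(2ξ)²` clears the denominators of the blow-down inside the polynomial ring.
    apply mul_left_cancel₀ (mul_ne_zero (pow_ne_zero 2 hx3) (pow_ne_zero 2 h22))
    have f0 : C ξ * 2 * blowDown ξ n (i, 0) = (1 + C ξ) * O - (1 - C ξ) * E := by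
      rw [e0]
      linear_combination (C ((1 + ξ) / 2) * 2 * O - C ((1 - ξ) / 2) * 2 * E) * hinv + O * hp - E * hm
    have f1 : C ξ * 2 * blowDown ξ n (i, 1) = 2 * (O - E) := by
      rw [e1]
      linear_combination 2 * (O - E) * hinv
    calc _ = (C ξ * 2 * blowDown ξ n (i, 0)) ^ 2 - (C ξ * 2 * blowDown ξ n (i, 0)) *
          (C ξ * 2 * blowDown ξ n (i, 1)) + (C ξ * 2 * blowDown ξ n (i, 1)) ^ 2 := by ring
      _ = _ := by
          rw [f0, f1]
          linear_combination (E - O) ^ 2 * hxx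
  rw [hnorm, ← mul_assoc, hsum]
  simp only [E, O, mul_pow]
  ring

end Toric

/-! ### The lift of `φ̄` and the dense open subsets -/

section Birational

variable {Ω : Type*} [Field Ω] {n d : ℕ} {ξ : Ω}

theorem sqrt_neg_three_ne_zero (h3 : (3 : Ω) ≠ 0) (hξ : ξ ^ 2 = -3) : ξ ≠ 0 := by
  rintro rfl
  exact h3 (by linear_combination hξ)

/-- The norm `(3 + ξ)(3 - ξ)` is `12`. -/
theorem three_add_ne_zero (h2 : (2 : Ω) ≠ 0) (h3 : (3 : Ω) ≠ 0) (hξ : ξ ^ 2 = -3) : 3 + ξ ≠ 0 :=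
  fun h => mul_ne_zero (mul_ne_zero h2 h2) h3 (by linear_combination (3 - ξ) * h + hξ)

theorem three_sub_ne_zero (h2 : (2 : Ω) ≠ 0) (h3 : (3 : Ω) ≠ 0) (hξ : ξ ^ 2 = -3) : 3 - ξ ≠ 0 :=
  fun h => mul_ne_zero (mul_ne_zero h2 h2) h3 (by linear_combination (3 + ξ) * h + hξ)

/-- The lift of `φ̄` to the Cox coordinates of the blow-up. -/
def liftT (ξ : Ω) (n d : ℕ) : CoxVar n → MvPolynomial (UIdx n) Ω
  | .ev i => uFst Ω n i - C ξ * uSnd Ω n i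
  | .od i => uFst Ω n i + C ξ * uSnd Ω n i
  | .wp => 3 * polyB Ω n d + C ξ * polyA Ω n d
  | .wm => 3 * polyB Ω n d - C ξ * polyA Ω n d

/-- The inverse of the lift of `φ̄`. -/
def unliftT (ξ : Ω) (n : ℕ) : UIdx n → MvPolynomial (CoxVar n) Ω
  | none => C (2 * ξ) * (X (.ev (Fin.last n)) * X (.od (Fin.last n)))
  | some (i, j) =>
    if j = 0 then C ξ * (X (.ev i.castSucc) * X (.od (Fin.last n)) +
      X (.od i.castSucc) * X (.ev (Fin.last n)))
    else X (.od i.castSucc) * X (.ev (Fin.last n)) - X (.ev i.castSucc) * X (.od (Fin.last n))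

theorem compatible_liftT : CoxSpace.Compatible (A := projCox (UIdx n)) (B := toricT n)
    (liftT ξ n d) :=
  compatible_projCox_toricT (m := 1) (l := 2 * d + 1)
    (fun i => (isHomogeneous_uFst i).sub ((isHomogeneous_uSnd i).C_mul ξ))
    (fun i => (isHomogeneous_uFst i).add ((isHomogeneous_uSnd i).C_mul ξ))
    (isHomogeneous_polyB.three_mul.add (isHomogeneous_polyA.C_mul ξ))
    (isHomogeneous_polyB.three_mul.sub (isHomogeneous_polyA.C_mul ξ))

theorem compatible_unliftT : CoxSpace.Compatible (A := toricT n) (B := projCox (UIdx n))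
    (unliftT ξ n) := by
  have key : ∀ i j : Fin (n + 1), IsWeightedHomogeneous (CoxVar.deg (n := n))
      (X (.ev i) * X (.od j) : MvPolynomial (CoxVar n) Ω) ![2, -1, -1] := fun i j => by
    refine MvPolynomial.IsWeightedHomogeneous.of_eq
      ((isWeightedHomogeneous_ev i).mul (isWeightedHomogeneous_od j)) ?_
    funext l
    fin_cases l <;> simp
  refine compatible_of_isWeightedHomogeneous (A := toricT n) (c := ![2, -1, -1]) ?_
  rintro (_ | ⟨i, j⟩)
  · exact (key _ _).C_mul _
  · unfold unliftT
    dsimp only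
    split_ifs
    · exact ((key _ _).add (by rw [mul_comm]; exact key _ _)).C_mul _
    · exact (by rw [mul_comm]; exact key _ _ : IsWeightedHomogeneous _ _ _).sub (key _ _)

theorem eval_liftT_mul (hξ : ξ ^ 2 = -3) (u : UIdx n → Ω) (i : Fin (n + 1)) :
    eval u (liftT ξ n d (.ev i)) * eval u (liftT ξ n d (.od i)) =
      eval u (uFst Ω n i) ^ 2 + 3 * eval u (uSnd Ω n i) ^ 2 := by
  simp only [liftT, map_sub, map_add, map_mul, eval_C]
  linear_combination -(eval u (uSnd Ω n i)) ^ 2 * hξ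

/-- This explains the choice of `w_±` in the lift: along it `(3 - ξ) P = w_-` and `(3 + ξ) Q = w_+`,
so `F̂` becomes `w_- w_+ - w_+ w_- = 0`. -/
theorem eval_coxP_liftT (hξ : ξ ^ 2 = -3) (u : UIdx n → Ω) :
    (3 - ξ) * eval (fun v => eval u (liftT ξ n d v)) (coxP Ω n d) =
      eval u (liftT ξ n d .wm) := by
  simp only [coxP, map_sum, map_mul, map_pow, eval_X, pow_succ']
  simp_rw [mul_assoc, ← mul_pow, eval_liftT_mul hξ]
  simp only [liftT, polyA_eq, polyB_eq, map_sum, map_mul, map_add, map_sub, map_ofNat, map_pow,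
    eval_C, Finset.mul_sum, ← Finset.sum_sub_distrib]
  refine Finset.sum_congr rfl fun i _ => ?_
  linear_combination eval u (uSnd Ω n i) *
    (eval u (uFst Ω n i) ^ 2 + 3 * eval u (uSnd Ω n i) ^ 2) ^ d * hξ

theorem eval_coxQ_liftT (hξ : ξ ^ 2 = -3) (u : UIdx n → Ω) :
    (3 + ξ) * eval (fun v => eval u (liftT ξ n d v)) (coxQ Ω n d) =
      eval u (liftT ξ n d .wp) := by
  simp only [coxQ, map_sum, map_mul, map_pow, eval_X, pow_succ]
  simp_rw [← mul_assoc, ← mul_pow, eval_liftT_mul hξ]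
  simp only [liftT, polyA_eq, polyB_eq, map_sum, map_mul, map_add, map_sub, map_ofNat, map_pow,
    eval_C, Finset.mul_sum, ← Finset.sum_add_distrib]
  refine Finset.sum_congr rfl fun i _ => ?_
  linear_combination eval u (uSnd Ω n i) *
    (eval u (uFst Ω n i) ^ 2 + 3 * eval u (uSnd Ω n i) ^ 2) ^ d * hξ

theorem eval_coxF_liftT (hξ : ξ ^ 2 = -3) (u : UIdx n → Ω) :
    eval (fun v => eval u (liftT ξ n d v)) (coxF ξ n d) = 0 := by
  rw [eval_coxF', eval_coxP_liftT hξ, eval_coxQ_liftT hξ]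
  ring

/-- The form whose nonvanishing defines the open subset of `ℙ^{2n}`. -/
def goodU (ξ : Ω) (n d : ℕ) : MvPolynomial (UIdx n) Ω :=
  X none * (liftT ξ n d .wp * liftT ξ n d .wm)

/-- The form whose nonvanishing defines the open subset of the blow-up. -/
def goodT (Ω : Type*) [Field Ω] (n d : ℕ) : MvPolynomial (CoxVar n) Ω :=
  X (.ev (Fin.last n)) * X (.od (Fin.last n)) * (coxP Ω n d * coxQ Ω n d)

/-- The form whose nonvanishing defines the open subset of the hypersurface. -/
def goodX (ξ : Ω) (n d : ℕ) : MvPolynomial (XIdx n) Ω := bind₁ (toCox ξ n) (goodT Ω n d)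

theorem eval_bind₁ {σ τ : Type*} (x : τ → Ω) (f : σ → MvPolynomial τ Ω) (g : MvPolynomial σ Ω) :
    eval x (bind₁ f g) = eval (fun v => eval x (f v)) g := by
  simp only [eval, eval₂Hom_bind₁]

theorem isHomogeneous_goodU : (goodU ξ n d).IsHomogeneous (1 + ((2 * d + 1) + (2 * d + 1))) :=
  (isHomogeneous_X _ _).mul ((isHomogeneous_polyB.three_mul.add (isHomogeneous_polyA.C_mul ξ)).mul
    (isHomogeneous_polyB.three_mul.sub (isHomogeneous_polyA.C_mul ξ)))

theorem isWeightedHomogeneous_goodT : ∃ c : Fin 3 → ℤ,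
    IsWeightedHomogeneous (CoxVar.deg (n := n)) (goodT Ω n d) c :=
  ⟨_, ((isWeightedHomogeneous_ev _).mul (isWeightedHomogeneous_od _)).mul
    (isWeightedHomogeneous_coxP.mul isWeightedHomogeneous_coxQ)⟩

theorem isHomogeneous_toCox_ev (i : Fin (n + 1)) : (toCox ξ n (.ev i)).IsHomogeneous 1 :=
  (isHomogeneous_X _ _).sub ((isHomogeneous_X _ _).C_mul _)

theorem isHomogeneous_toCox_od (i : Fin (n + 1)) : (toCox ξ n (.od i)).IsHomogeneous 1 :=
  (isHomogeneous_X _ _).sub ((isHomogeneous_X _ _).C_mul _)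

theorem isHomogeneous_goodX : ∃ m, (goodX ξ n d).IsHomogeneous m := by
  refine ⟨(1 + 1) + ((1 * (d + 1) + 1 * d) + (1 * d + 1 * (d + 1))), ?_⟩
  simp only [goodX, goodT, coxP, coxQ, map_mul, map_sum, map_pow, bind₁_X_right]
  have he := isHomogeneous_toCox_ev (ξ := ξ) (n := n)
  have ho := isHomogeneous_toCox_od (ξ := ξ) (n := n)
  exact ((he _).mul (ho _)).mul
    ((IsHomogeneous.sum _ _ _ fun i _ => ((he i).pow _).mul ((ho i).pow _)).mul
      (IsHomogeneous.sum _ _ _ fun i _ => ((he i).pow _).mul ((ho i).pow _)))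

open Classical in
theorem exists_eval_goodU_ne_zero (h2 : (2 : Ω) ≠ 0) (h3 : (3 : Ω) ≠ 0) (hξ : ξ ^ 2 = -3)
    (hd : 1 ≤ d) : ∃ u, eval u (goodU ξ n d) ≠ 0 := by
  have hd0 : d ≠ 0 := by lia
  -- At `u_0 = 1` with all other coordinates zero, `Ā = B̄ = 1` and `w_± = 3 ± ξ`.
  refine ⟨fun v => if v = none then 1 else 0, ?_⟩
  have hA : eval (fun v : UIdx n => if v = none then (1 : Ω) else 0) (polyA Ω n d) = 1 := by
    simp [polyA, hd0]
  have hB : eval (fun v : UIdx n => if v = none then (1 : Ω) else 0) (polyB Ω n d) = 1 := by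
    simp [polyB, hd0]
  simp only [goodU, liftT, map_mul, map_add, map_sub, hA, hB, eval_X, eval_C, map_ofNat, mul_one,
    if_true, one_mul]
  exact mul_ne_zero (three_add_ne_zero h2 h3 hξ) (three_sub_ne_zero h2 h3 hξ)

theorem eval_goodT_liftT (hξ : ξ ^ 2 = -3) {u : UIdx n → Ω} (hu : eval u (goodU ξ n d) ≠ 0) :
    eval (fun v => eval u (liftT ξ n d v)) (goodT Ω n d) ≠ 0 := by
  simp only [goodU, map_mul, eval_X, mul_ne_zero_iff] at hu
  simp only [goodT, map_mul, eval_X, mul_ne_zero_iff]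
  refine ⟨⟨?_, ?_⟩, ?_, ?_⟩
  · simpa [liftT] using hu.1
  · simpa [liftT] using hu.1
  · exact right_ne_zero_of_mul ((eval_coxP_liftT hξ u).trans_ne hu.2.2)
  · exact right_ne_zero_of_mul ((eval_coxQ_liftT hξ u).trans_ne hu.2.1)

/-- Where `P` and `Q` are nonzero, `F̂ = 0` makes `w_+` and `w_-` vanish together, and the
irrelevant ideal forbids that. -/
theorem wp_wm_ne_zero_of_goodT (hp : 3 + ξ ≠ 0) (hm : 3 - ξ ≠ 0) {z : CoxVar n → Ω}
    (hz : (toricT n).Stable z) (hF : eval z (coxF ξ n d) = 0) (hg : eval z (goodT Ω n d) ≠ 0) :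
    z .wp ≠ 0 ∧ z .wm ≠ 0 := by
  simp only [goodT, map_mul, eval_X, mul_ne_zero_iff] at hg
  rw [eval_coxF', sub_eq_zero] at hF
  have : z .wp ≠ 0 ↔ z .wm ≠ 0 := by
    rw [← mul_ne_zero_iff_left (mul_ne_zero hm hg.2.1), hF, mul_ne_zero_iff_left
      (mul_ne_zero hp hg.2.2)]
  rcases (stable_toricT.1 hz).2.2 with h | h
  · exact ⟨h, this.1 h⟩
  · exact ⟨this.2 h, h⟩

theorem stable_of_goodT {z : CoxVar n → Ω} (hg : eval z (goodT Ω n d) ≠ 0)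
    (hw : z .wp ≠ 0 ∨ z .wm ≠ 0) : (toricT n).Stable z := by
  simp only [goodT, map_mul, eval_X, mul_ne_zero_iff] at hg
  exact stable_toricT.2 ⟨⟨_, hg.1.1⟩, ⟨_, hg.1.2⟩, hw⟩

/-! Density of the three open sets. -/

/-- Irreducibility of `F̂` needs only one zero of `F̂` off the bad locus; the lift of a good point
`u` supplies it. -/
theorem exists_zero_coxF_goodT [IsAlgClosed Ω] (h2 : (2 : Ω) ≠ 0) (h3 : (3 : Ω) ≠ 0)
    (hξ : ξ ^ 2 = -3) (hn : 1 ≤ n) (hd : 1 ≤ d) {f : MvPolynomial (CoxVar n) Ω}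
    {x : CoxVar n → Ω} (hx : eval x (coxF ξ n d) = 0) (hf : eval x f ≠ 0) :
    ∃ z, eval z (coxF ξ n d) = 0 ∧ eval z f ≠ 0 ∧ eval z (goodT Ω n d) ≠ 0 ∧ z .wp ≠ 0 := by
  obtain ⟨u, hu⟩ := exists_eval_goodU_ne_zero (n := n) h2 h3 hξ hd
  obtain ⟨z, hz, hzf, hzg⟩ := exists_zero_of_irreducible (h := goodT Ω n d * X .wp)
    (irreducible_coxF (three_add_ne_zero h2 h3 hξ) (three_sub_ne_zero h2 h3 hξ) hn hd)
    ⟨x, hx, hf⟩ ⟨_, eval_coxF_liftT hξ u, by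
      rw [map_mul]
      refine mul_ne_zero (eval_goodT_liftT hξ hu) ?_
      simp only [goodU, map_mul, mul_ne_zero_iff] at hu
      simpa using hu.2.1⟩
  rw [map_mul, mul_ne_zero_iff, eval_X] at hzg
  exact ⟨z, hz, hzf, hzg.1, hzg.2⟩

theorem mem_zeroLocus_goodU_iff {u : UIdx n → Ω} {p : (projCox (UIdx n)).Pt Ω}
    (hu : (projCox (UIdx n)).Coord u p) :
    p ∈ (projCox (UIdx n)).zeroLocus (goodU ξ n d) ↔ eval u (goodU ξ n d) = 0 :=
  CoxSpace.mem_zeroLocus_iff (A := projCox (UIdx n))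
    (isWeightedHomogeneous_projCox isHomogeneous_goodU) hu

theorem mem_zeroLocus_goodT_iff {z : CoxVar n → Ω} {p : (toricT n).Pt Ω}
    (hz : (toricT n).Coord z p) :
    p ∈ (toricT n).zeroLocus (goodT Ω n d) ↔ eval z (goodT Ω n d) = 0 :=
  isWeightedHomogeneous_goodT.elim fun _ hc => CoxSpace.mem_zeroLocus_iff (A := toricT n) hc hz

theorem mem_zeroLocus_goodX_iff {x : XIdx n → Ω} {p : (projCox (XIdx n)).Pt Ω}
    (hx : (projCox (XIdx n)).Coord x p) :
    p ∈ (projCox (XIdx n)).zeroLocus (goodX ξ n d) ↔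
      eval (fun v => eval x (toCox ξ n v)) (goodT Ω n d) = 0 := by
  rw [← eval_bind₁]
  exact isHomogeneous_goodX.elim fun _ hm => CoxSpace.mem_zeroLocus_iff (A := projCox (XIdx n))
    (isWeightedHomogeneous_projCox hm) hx

theorem openDenseIn_projCox {ι : Type} {V : Set ((projCox ι).Pt Ω)} {h : MvPolynomial ι Ω} {m : ℕ}
    (hh : h.IsHomogeneous m)
    (H : ∀ (f : MvPolynomial ι Ω) (x : ι → Ω) (p : (projCox ι).Pt Ω), (projCox ι).Coord x p →
      p ∈ V → eval x f ≠ 0 → ∃ y : ι → Ω, ∃ q ∈ V, (projCox ι).Coord y q ∧ eval y f ≠ 0 ∧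
        eval y h ≠ 0) : CoxSpace.OpenDenseIn (V \ (projCox ι).zeroLocus h) V :=
  CoxSpace.openDenseIn_of_coord (A := projCox ι) (isWeightedHomogeneous_projCox hh) H

theorem openDenseIn_goodU [IsAlgClosed Ω] (h2 : (2 : Ω) ≠ 0) (h3 : (3 : Ω) ≠ 0)
    (hξ : ξ ^ 2 = -3) (hd : 1 ≤ d) : CoxSpace.OpenDenseIn
      (Set.univ \ (projCox (UIdx n)).zeroLocus (goodU ξ n d)) Set.univ := by
  refine openDenseIn_projCox isHomogeneous_goodU fun f x p hx _ hf => ?_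
  have hfg : f * goodU ξ n d ≠ 0 := by
    refine mul_ne_zero (fun h => hf (by rw [h, map_zero])) fun h => ?_
    obtain ⟨u, hu⟩ := exists_eval_goodU_ne_zero (n := n) h2 h3 hξ hd
    exact hu (by rw [h, map_zero])
  obtain ⟨y, hy⟩ : ∃ y, eval y (f * goodU ξ n d) ≠ 0 := by
    by_contra! h
    exact hfg (MvPolynomial.funext fun y => by rw [h y, map_zero])
  rw [map_mul, mul_ne_zero_iff] at hy
  have hy0 : y none ≠ 0 := by
    have := hy.2
    simp only [goodU, map_mul, mul_ne_zero_iff] at this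
    simpa using this.1
  obtain ⟨q, hq⟩ := CoxSpace.Stable.exists_point (stable_projCox.2 ⟨none, hy0⟩)
  exact ⟨y, q, trivial, hq, hy.1, hy.2⟩

theorem openDenseIn_goodT [IsAlgClosed Ω] (h2 : (2 : Ω) ≠ 0) (h3 : (3 : Ω) ≠ 0)
    (hξ : ξ ^ 2 = -3) (hn : 1 ≤ n) (hd : 1 ≤ d) : CoxSpace.OpenDenseIn
      (Xtilde ξ n d \ (toricT n).zeroLocus (goodT Ω n d)) (Xtilde ξ n d) := by
  obtain ⟨c, hc⟩ := isWeightedHomogeneous_goodT (Ω := Ω) (n := n) (d := d)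
  refine CoxSpace.openDenseIn_of_coord (A := toricT n) hc fun f x p hx hp hf => ?_
  obtain ⟨z, hz, hzf, hzg, hzw⟩ :=
    exists_zero_coxF_goodT h2 h3 hξ hn hd ((mem_Xtilde_iff hx).1 hp) hf
  obtain ⟨q, hq⟩ := CoxSpace.Stable.exists_point (stable_of_goodT hzg (.inl hzw))
  exact ⟨z, q, (mem_Xtilde_iff hq).2 hz, hq, hzf, hzg⟩

theorem coord_toCox_blowDown (h2 : (2 : Ω) ≠ 0) (h0 : ξ ≠ 0) {z : CoxVar n → Ω}
    {p : (toricT n).Pt Ω} (hz : (toricT n).Coord z p) (hp : z .wp ≠ 0) (hm : z .wm ≠ 0) :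
    (toricT n).Coord (fun v : CoxVar n => eval (fun w => eval z (blowDown ξ n w)) (toCox ξ n v)) p := by
  obtain ⟨⟨i, hi⟩, ⟨j, hj⟩, -⟩ := stable_toricT.1 hz.stable
  have hst : (toricT n).Stable
      (fun v : CoxVar n => eval (fun w => eval z (blowDown ξ n w)) (toCox ξ n v)) :=
    stable_toricT.2 ⟨⟨i, by rw [eval_toCox_ev_blowDown h2 h0]; exact mul_ne_zero hi hp⟩,
      ⟨j, by rw [eval_toCox_od_blowDown h2 h0]; exact mul_ne_zero hj hm⟩,
      .inl (by rw [eval_toCox_wp]; exact one_ne_zero)⟩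
  obtain ⟨q, hq⟩ := hst.exists_point
  rwa [(coord_eq_iff_toricT hz hq).2 ⟨z .wp, z .wm, (z .wp)⁻¹, (z .wm)⁻¹, inv_ne_zero hp,
    inv_ne_zero hm, hp, hm, by rw [mul_inv_cancel₀ hp, mul_inv_cancel₀ hm],
    fun i => by rw [eval_toCox_ev_blowDown h2 h0, mul_comm],
    fun i => by rw [eval_toCox_od_blowDown h2 h0, mul_comm],
    by rw [eval_toCox_wp, inv_mul_cancel₀ hp], by rw [eval_toCox_wm, inv_mul_cancel₀ hm]⟩]

theorem eval_hypersurfaceEq_blowDown (h2 : (2 : Ω) ≠ 0) (h0 : ξ ≠ 0) (hξ : ξ ^ 2 = -3)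
    (z : CoxVar n → Ω) : eval (fun w => eval z (blowDown ξ n w)) (hypersurfaceEq Ω n d) =
      -(1 / (2 * ξ)) * (z .wp ^ d * z .wm ^ d * eval z (coxF ξ n d)) := by
  rw [← eval_bind₁, bind₁_blowDown_hypersurfaceEq h2 h0 hξ]
  simp

theorem stable_blowDown (h2 : (2 : Ω) ≠ 0) (h0 : ξ ≠ 0) {z : CoxVar n → Ω}
    (hz : (toricT n).Stable z) :
    (projCox (XIdx n)).Stable (fun v : XIdx n => eval z (blowDown ξ n v)) := by
  refine stable_projCox.2 ?_
  by_contra! h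
  have h' : (fun v => eval z (blowDown ξ n v)) = 0 := funext h
  have he : ∀ i, z (.ev i) * z .wp = 0 := fun i => by
    rw [← eval_toCox_ev_blowDown h2 h0, h', eval_toCox_ev]
    simp
  have ho : ∀ i, z (.od i) * z .wm = 0 := fun i => by
    rw [← eval_toCox_od_blowDown h2 h0, h', eval_toCox_od]
    simp
  obtain ⟨⟨i, hi⟩, ⟨j, hj⟩, hw | hw⟩ := stable_toricT.1 hz
  · exact mul_ne_zero hi hw (he i)
  · exact mul_ne_zero hj hw (ho j)

/-- Density on `X` is inherited from the blow-up: `f` is pulled back along the blow-down, a good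
zero of `F̂` is found there, and its image is taken. No irreducibility of the equation of `X` is
needed. -/
theorem openDenseIn_goodX [IsAlgClosed Ω] (h2 : (2 : Ω) ≠ 0) (h3 : (3 : Ω) ≠ 0)
    (hξ : ξ ^ 2 = -3) (hn : 1 ≤ n) (hd : 1 ≤ d) : CoxSpace.OpenDenseIn
      (hypersurface Ω n d \ (projCox (XIdx n)).zeroLocus (goodX ξ n d)) (hypersurface Ω n d) := by
  have h0 := sqrt_neg_three_ne_zero h3 hξ
  obtain ⟨m, hm⟩ := isHomogeneous_goodX (ξ := ξ) (n := n) (d := d)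
  refine openDenseIn_projCox hm fun f x p hx hp hf => ?_
  obtain ⟨z, hz, hzf, hzg, hzw⟩ := exists_zero_coxF_goodT (f := bind₁ (blowDown ξ n) f)
    (x := fun w => eval x (toCox ξ n w)) h2 h3 hξ hn hd
    (by rw [eval_coxF_toCox h2 hξ, (mem_hypersurface_iff hx).1 hp, mul_zero])
    (by rw [eval_bind₁, funext (eval_blowDown_toCox h2 h0 x)]; exact hf)
  have hst := stable_of_goodT hzg (.inl hzw)
  obtain ⟨q', hq'⟩ := hst.exists_point
  obtain ⟨hwp, hwm⟩ := wp_wm_ne_zero_of_goodT (three_add_ne_zero h2 h3 hξ)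
    (three_sub_ne_zero h2 h3 hξ) hst hz hzg
  obtain ⟨q, hq⟩ := (stable_blowDown h2 h0 hst).exists_point
  refine ⟨_, q, (mem_hypersurface_iff hq).2 ?_, hq, by rwa [eval_bind₁] at hzf, ?_⟩
  · rw [eval_hypersurfaceEq_blowDown h2 h0 hξ, hz, mul_zero, mul_zero]
  · rw [goodX, eval_bind₁]
    exact fun h => hzg ((mem_zeroLocus_goodT_iff hq').1
      ((mem_zeroLocus_goodT_iff (coord_toCox_blowDown h2 h0 hq' hwp hwm)).2 h))

end Birational

theorem CoxSpace.Sends.comp {A B C : CoxSpace} {Ω : Type*} [Field Ω]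
    {f : B.Var → MvPolynomial A.Var Ω} {g : C.Var → MvPolynomial B.Var Ω} {p : A.Pt Ω}
    {q : B.Pt Ω} {r : C.Pt Ω} (hf : Sends f p q) (hg : Sends g q r) :
    Sends (fun v => bind₁ f (g v)) p r := by
  intro x hx
  simp_rw [eval_bind₁]
  exact hg _ (hf x hx)

/-! ### Mutually inverse maps between the open subsets -/

section OpenSets

variable {Ω : Type*} [Field Ω] {n d : ℕ} {ξ : Ω}

theorem exists_coord_projCox {ι : Type} (p : (projCox ι).Pt Ω) :
    ∃ x : ι → Ω, (projCox ι).Coord x p := CoxSpace.exists_coord p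

theorem exists_coord_toricT (p : (toricT n).Pt Ω) :
    ∃ x : CoxVar n → Ω, (toricT n).Coord x p := CoxSpace.exists_coord p

theorem coord_smul_projCox {ι : Type} {x : ι → Ω} {p : (projCox ι).Pt Ω}
    (h : (projCox ι).Coord x p) {t : Ω} (ht : t ≠ 0) :
    (projCox ι).Coord (fun i : ι => t * x i) p := by
  obtain ⟨i, hi⟩ := stable_projCox.1 h.stable
  have hst : (projCox ι).Stable (fun i : ι => t * x i) :=
    stable_projCox.2 ⟨i, mul_ne_zero ht hi⟩
  obtain ⟨q, hq⟩ := hst.exists_point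
  rwa [(coord_eq_iff_projCox h hq).2 ⟨t, ht, fun _ => rfl⟩]

theorem eval_unliftT_none (z : CoxVar n → Ω) : eval z (unliftT ξ n none) =
    2 * ξ * (z (.ev (Fin.last n)) * z (.od (Fin.last n))) := by simp [unliftT]

theorem eval_uFst_unliftT (z : CoxVar n → Ω) (i : Fin (n + 1)) :
    eval (fun v => eval z (unliftT ξ n v)) (uFst Ω n i) =
      ξ * (z (.ev i) * z (.od (Fin.last n)) + z (.od i) * z (.ev (Fin.last n))) := by
  refine Fin.lastCases ?_ (fun i => ?_) i
  · simp [unliftT]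
    ring
  · simp [unliftT]

theorem eval_uSnd_unliftT (z : CoxVar n → Ω) (i : Fin (n + 1)) :
    eval (fun v => eval z (unliftT ξ n v)) (uSnd Ω n i) =
      z (.od i) * z (.ev (Fin.last n)) - z (.ev i) * z (.od (Fin.last n)) := by
  refine Fin.lastCases ?_ (fun i => ?_) i
  · simp
    ring
  · simp [unliftT]

/-- The inverse normalises `z_{2n} = z_{2n+1}` without denominators: up to `2ξ`, the even block is
multiplied by `z_{2n+1}` and the odd block by `z_{2n}`. -/
theorem eval_liftT_unliftT_ev (z : CoxVar n → Ω) (i : Fin (n + 1)) :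
    eval (fun v => eval z (unliftT ξ n v)) (liftT ξ n d (.ev i)) =
      2 * ξ * z (.od (Fin.last n)) * z (.ev i) := by
  simp only [liftT, map_sub, map_mul, eval_C, eval_uFst_unliftT, eval_uSnd_unliftT]
  ring

theorem eval_liftT_unliftT_od (z : CoxVar n → Ω) (i : Fin (n + 1)) :
    eval (fun v => eval z (unliftT ξ n v)) (liftT ξ n d (.od i)) =
      2 * ξ * z (.ev (Fin.last n)) * z (.od i) := by
  simp only [liftT, map_add, map_mul, eval_C, eval_uFst_unliftT, eval_uSnd_unliftT]
  ring

theorem eval_liftT_unliftT_wm (hξ : ξ ^ 2 = -3) (z : CoxVar n → Ω) :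
    eval (fun v => eval z (unliftT ξ n v)) (liftT ξ n d .wm) =
      (2 * ξ) ^ (2 * d + 1) * z (.od (Fin.last n)) ^ (d + 1) * z (.ev (Fin.last n)) ^ d *
        ((3 - ξ) * eval z (coxP Ω n d)) := by
  rw [← eval_coxP_liftT hξ]
  simp only [coxP, map_sum, map_mul, map_pow, eval_X, eval_liftT_unliftT_ev,
    eval_liftT_unliftT_od, Finset.mul_sum]
  exact Finset.sum_congr rfl fun i _ => by ring

theorem eval_liftT_unliftT_wp (hξ : ξ ^ 2 = -3) (z : CoxVar n → Ω) :
    eval (fun v => eval z (unliftT ξ n v)) (liftT ξ n d .wp) =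
      (2 * ξ) ^ (2 * d + 1) * z (.od (Fin.last n)) ^ d * z (.ev (Fin.last n)) ^ (d + 1) *
        ((3 + ξ) * eval z (coxQ Ω n d)) := by
  rw [← eval_coxQ_liftT hξ]
  simp only [coxQ, map_sum, map_mul, map_pow, eval_X, eval_liftT_unliftT_ev,
    eval_liftT_unliftT_od, Finset.mul_sum]
  exact Finset.sum_congr rfl fun i _ => by ring

theorem eval_unliftT_liftT (u : UIdx n → Ω) (v : UIdx n) :
    eval (fun w => eval u (liftT ξ n d w)) (unliftT ξ n v) = 2 * ξ * u none * u v := by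
  rcases v with _ | ⟨i, j⟩
  · simp [unliftT, liftT]
    ring
  · fin_cases j
    · simp [unliftT, liftT]
      ring
    · simp [unliftT, liftT]
      ring

theorem exists_sends_liftT (h2 : (2 : Ω) ≠ 0) (h3 : (3 : Ω) ≠ 0) (hξ : ξ ^ 2 = -3)
    (p : (projCox (UIdx n)).Pt Ω)
    (hp : p ∈ Set.univ \ (projCox (UIdx n)).zeroLocus (goodU ξ n d)) :
    ∃ q ∈ Xtilde ξ n d \ (toricT n).zeroLocus (goodT Ω n d),
      CoxSpace.Sends (A := projCox (UIdx n)) (B := toricT n) (liftT ξ n d) p q ∧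
      CoxSpace.Sends (A := toricT n) (B := projCox (UIdx n)) (unliftT ξ n) q p := by
  obtain ⟨u, hu⟩ := exists_coord_projCox p
  have hu' : eval u (goodU ξ n d) ≠ 0 := fun h => hp.2 ((mem_zeroLocus_goodU_iff hu).2 h)
  have hgT := eval_goodT_liftT hξ hu'
  simp only [goodU, map_mul, mul_ne_zero_iff, eval_X] at hu'
  have hst : (toricT n).Stable (fun v : CoxVar n => eval u (liftT ξ n d v)) :=
    stable_of_goodT hgT (.inl hu'.2.1)
  obtain ⟨q, hq⟩ := hst.exists_point
  refine ⟨q, ⟨(mem_Xtilde_iff hq).2 (eval_coxF_liftT hξ u),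
    fun h => hgT ((mem_zeroLocus_goodT_iff hq).1 h)⟩,
    compatible_liftT.sends hu hq, compatible_unliftT.sends hq ?_⟩
  have hc : 2 * ξ * u none ≠ 0 :=
    mul_ne_zero (mul_ne_zero h2 (sqrt_neg_three_ne_zero h3 hξ)) hu'.1
  have := coord_smul_projCox hu hc
  rwa [← _root_.funext (eval_unliftT_liftT (d := d) u)] at this

theorem exists_sends_unliftT (h2 : (2 : Ω) ≠ 0) (h3 : (3 : Ω) ≠ 0) (hξ : ξ ^ 2 = -3)
    (q : (toricT n).Pt Ω) (hq : q ∈ Xtilde ξ n d \ (toricT n).zeroLocus (goodT Ω n d)) :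
    ∃ p ∈ Set.univ \ (projCox (UIdx n)).zeroLocus (goodU ξ n d),
      CoxSpace.Sends (A := projCox (UIdx n)) (B := toricT n) (liftT ξ n d) p q ∧
      CoxSpace.Sends (A := toricT n) (B := projCox (UIdx n)) (unliftT ξ n) q p := by
  obtain ⟨z, hz⟩ := exists_coord_toricT q
  have hF := (mem_Xtilde_iff hz).1 hq.1
  have hg : eval z (goodT Ω n d) ≠ 0 := fun h => hq.2 ((mem_zeroLocus_goodT_iff hz).2 h)
  have hp3 := three_add_ne_zero h2 h3 hξ
  have hm3 := three_sub_ne_zero h2 h3 hξ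
  have h0 := sqrt_neg_three_ne_zero h3 hξ
  obtain ⟨hwp, hwm⟩ := wp_wm_ne_zero_of_goodT hp3 hm3 hz.stable hF hg
  simp only [goodT, map_mul, mul_ne_zero_iff, eval_X] at hg
  obtain ⟨⟨he, ho⟩, hP, hQ⟩ := hg
  have h20 : 2 * ξ ≠ 0 := mul_ne_zero h2 h0
  have hnone : eval z (unliftT ξ n none) ≠ 0 := by
    rw [eval_unliftT_none]
    exact mul_ne_zero h20 (mul_ne_zero he ho)
  have hst : (projCox (UIdx n)).Stable (fun v : UIdx n => eval z (unliftT ξ n v)) :=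
    stable_projCox.2 ⟨none, hnone⟩
  obtain ⟨p, hp⟩ := hst.exists_point
  have hlp : eval (fun v => eval z (unliftT ξ n v)) (liftT ξ n d .wp) ≠ 0 := by
    rw [eval_liftT_unliftT_wp hξ]
    exact mul_ne_zero (mul_ne_zero (mul_ne_zero (pow_ne_zero _ h20) (pow_ne_zero _ ho))
      (pow_ne_zero _ he)) (mul_ne_zero hp3 hQ)
  have hlm : eval (fun v => eval z (unliftT ξ n v)) (liftT ξ n d .wm) ≠ 0 := by
    rw [eval_liftT_unliftT_wm hξ]
    exact mul_ne_zero (mul_ne_zero (mul_ne_zero (pow_ne_zero _ h20) (pow_ne_zero _ ho))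
      (pow_ne_zero _ he)) (mul_ne_zero hm3 hP)
  refine ⟨p, ⟨trivial, fun h => ?_⟩, compatible_liftT.sends hp ?_, compatible_unliftT.sends hz hp⟩
  · refine mul_ne_zero hnone (mul_ne_zero hlp hlm) ?_
    simpa [goodU] using (mem_zeroLocus_goodU_iff hp).1 h
  · have hst' : (toricT n).Stable
        (fun v : CoxVar n => eval (fun w => eval z (unliftT ξ n w)) (liftT ξ n d v)) :=
      stable_toricT.2 ⟨⟨Fin.last n, by
          rw [eval_liftT_unliftT_ev]; exact mul_ne_zero (mul_ne_zero h20 ho) he⟩,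
        ⟨Fin.last n, by rw [eval_liftT_unliftT_od]; exact mul_ne_zero (mul_ne_zero h20 he) ho⟩,
        .inl hlp⟩
    obtain ⟨q', hq'⟩ := hst'.exists_point
    -- The blocks of `z` are rescaled by known factors and `w_±` by the ratios of new to old values;
    -- the compatibility `r a = s b` of these scalars is exactly `F̂(z) = 0`.
    have : q = q' := (coord_eq_iff_toricT hz hq').2
      ⟨2 * ξ * z (.od (Fin.last n)), 2 * ξ * z (.ev (Fin.last n)), _ / z .wp, _ / z .wm,
        div_ne_zero hlp hwp, div_ne_zero hlm hwm, mul_ne_zero h20 ho, mul_ne_zero h20 he, ?_,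
        fun i => eval_liftT_unliftT_ev z i, fun i => eval_liftT_unliftT_od z i,
        (div_mul_cancel₀ _ hwp).symm, (div_mul_cancel₀ _ hwm).symm⟩
    · rwa [this]
    · rw [eval_liftT_unliftT_wp hξ, eval_liftT_unliftT_wm hξ]
      rw [eval_coxF'] at hF
      rw [mul_div_assoc', mul_div_assoc', div_eq_div_iff hwp hwm]
      linear_combination -(2 * ξ) ^ (2 * d + 2) * z (.od (Fin.last n)) ^ (d + 1) *
        z (.ev (Fin.last n)) ^ (d + 1) * hF

theorem exists_sends_blowDown (h2 : (2 : Ω) ≠ 0) (h3 : (3 : Ω) ≠ 0) (hξ : ξ ^ 2 = -3)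
    (q : (toricT n).Pt Ω) (hq : q ∈ Xtilde ξ n d \ (toricT n).zeroLocus (goodT Ω n d)) :
    ∃ p ∈ hypersurface Ω n d \ (projCox (XIdx n)).zeroLocus (goodX ξ n d),
      CoxSpace.Sends (A := toricT n) (B := projCox (XIdx n)) (blowDown ξ n) q p ∧
      CoxSpace.Sends (A := projCox (XIdx n)) (B := toricT n) (toCox ξ n) p q := by
  obtain ⟨z, hz⟩ := exists_coord_toricT q
  have hF := (mem_Xtilde_iff hz).1 hq.1
  have hg : eval z (goodT Ω n d) ≠ 0 := fun h => hq.2 ((mem_zeroLocus_goodT_iff hz).2 h)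
  have h0 := sqrt_neg_three_ne_zero h3 hξ
  obtain ⟨hwp, hwm⟩ := wp_wm_ne_zero_of_goodT (three_add_ne_zero h2 h3 hξ)
    (three_sub_ne_zero h2 h3 hξ) hz.stable hF hg
  obtain ⟨p, hp⟩ := (stable_blowDown h2 h0 hz.stable).exists_point
  have hq' := coord_toCox_blowDown h2 h0 hz hwp hwm
  refine ⟨p, ⟨(mem_hypersurface_iff hp).2 ?_, fun h => hg ((mem_zeroLocus_goodT_iff hz).1
    ((mem_zeroLocus_goodT_iff hq').2 ((mem_zeroLocus_goodX_iff hp).1 h)))⟩,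
    (compatible_blowDown ξ).sends hz hp, (compatible_toCox ξ).sends hp hq'⟩
  rw [eval_hypersurfaceEq_blowDown h2 h0 hξ, hF, mul_zero, mul_zero]

theorem coord_blowDown_toCox (h2 : (2 : Ω) ≠ 0) (h0 : ξ ≠ 0) {x : XIdx n → Ω}
    {p : (projCox (XIdx n)).Pt Ω} (hx : (projCox (XIdx n)).Coord x p) :
    (projCox (XIdx n)).Coord
      (fun v : XIdx n => eval (fun w => eval x (toCox ξ n w)) (blowDown ξ n v)) p := by
  rwa [_root_.funext (eval_blowDown_toCox h2 h0 x)]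

theorem exists_sends_toCox (h2 : (2 : Ω) ≠ 0) (h3 : (3 : Ω) ≠ 0) (hξ : ξ ^ 2 = -3)
    (p : (projCox (XIdx n)).Pt Ω)
    (hp : p ∈ hypersurface Ω n d \ (projCox (XIdx n)).zeroLocus (goodX ξ n d)) :
    ∃ q ∈ Xtilde ξ n d \ (toricT n).zeroLocus (goodT Ω n d),
      CoxSpace.Sends (A := toricT n) (B := projCox (XIdx n)) (blowDown ξ n) q p ∧
      CoxSpace.Sends (A := projCox (XIdx n)) (B := toricT n) (toCox ξ n) p q := by
  obtain ⟨x, hx⟩ := exists_coord_projCox p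
  have hX := (mem_hypersurface_iff hx).1 hp.1
  have hg : eval (fun v : CoxVar n => eval x (toCox ξ n v)) (goodT Ω n d) ≠ 0 :=
    fun h => hp.2 ((mem_zeroLocus_goodX_iff hx).2 h)
  have hst := stable_of_goodT hg (.inl (by rw [eval_toCox_wp]; exact one_ne_zero))
  obtain ⟨q, hq⟩ := hst.exists_point
  refine ⟨q, ⟨(mem_Xtilde_iff hq).2 ?_, fun h => hg ((mem_zeroLocus_goodT_iff hq).1 h)⟩,
    (compatible_blowDown ξ).sends hq (coord_blowDown_toCox h2 (sqrt_neg_three_ne_zero h3 hξ) hx),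
    (compatible_toCox ξ).sends hx hq⟩
  rw [eval_coxF_toCox h2 hξ, hX, mul_zero]

theorem eval_blowDown_liftT (h2 : (2 : Ω) ≠ 0) (h0 : ξ ≠ 0) (hξ : ξ ^ 2 = -3)
    (u : UIdx n → Ω) (v : XIdx n) :
    eval u (phiBar Ω n d v) =
      -(1 / 2) * eval (fun w => eval u (liftT ξ n d w)) (blowDown ξ n v) := by
  obtain ⟨i, j⟩ := v
  fin_cases j
  · change eval u (phiBar Ω n d (i, 0)) = _ * eval _ (blowDown ξ n (i, 0))
    rw [phiBar_zero, eval_blowDown_zero]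
    simp only [liftT, map_sub, map_add, map_mul, eval_C, map_ofNat]
    field_simp
    linear_combination (-2 * eval u (uSnd Ω n i) * eval u (polyA Ω n d)) * ξ * hξ
  · change eval u (phiBar Ω n d (i, 1)) = _ * eval _ (blowDown ξ n (i, 1))
    rw [phiBar_one, eval_blowDown_one]
    simp only [liftT, map_sub, map_add, map_mul, eval_C, map_ofNat]
    field_simp
    ring

theorem sends_phiBar (h2 : (2 : Ω) ≠ 0) (h3 : (3 : Ω) ≠ 0) (hξ : ξ ^ 2 = -3)
    {p : (projCox (UIdx n)).Pt Ω} {q : (toricT n).Pt Ω} {r : (projCox (XIdx n)).Pt Ω}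
    (hpq : CoxSpace.Sends (A := projCox (UIdx n)) (B := toricT n) (liftT ξ n d) p q)
    (hqr : CoxSpace.Sends (A := toricT n) (B := projCox (XIdx n)) (blowDown ξ n) q r) :
    CoxSpace.Sends (A := projCox (UIdx n)) (B := projCox (XIdx n)) (phiBar Ω n d) p r := by
  intro u hu
  let u' : UIdx n → Ω := u
  have h := hqr _ (hpq u hu)
  have hc : -(1 / 2 : Ω) ≠ 0 := neg_ne_zero.2 (one_div_ne_zero h2)
  change (projCox (XIdx n)).Coord (fun v : XIdx n => eval u' (phiBar Ω n d v)) r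
  rw [_root_.funext (eval_blowDown_liftT h2 (sqrt_neg_three_ne_zero h3 hξ) hξ u')]
  exact coord_smul_projCox h hc

end OpenSets

/-! ### Galois equivariance and fields of definition -/

section Descent

variable {k Ω : Type*} [Field k] [Field Ω] [Algebra k Ω] {n d : ℕ} {ξ : Ω}

theorem apply_sqrt_neg_three (hξ : ξ ^ 2 = -3) (τ : Ω ≃ₐ[k] Ω) : τ ξ = ξ ∨ τ ξ = -ξ := by
  apply sq_eq_sq_iff_eq_or_eq_neg.1
  rw [← map_pow, hξ, map_neg, map_ofNat]

theorem perm_toricT_of_eq {τ : Ω ≃ₐ[k] Ω} (h : τ ξ = ξ) (v : CoxVar n) :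
    (toricT n).perm ξ τ v = v := by
  unfold CoxSpace.perm
  rw [if_pos h]
  rfl

theorem perm_toricT_of_ne {τ : Ω ≃ₐ[k] Ω} (h : τ ξ ≠ ξ) (v : CoxVar n) :
    (toricT n).perm ξ τ v = v.swap := by
  unfold CoxSpace.perm
  rw [if_neg h]
  rfl

theorem neg_ne_self_of_sq (h2 : (2 : Ω) ≠ 0) (h0 : ξ ≠ 0) : -ξ ≠ ξ := fun h =>
  mul_ne_zero h2 h0 (by linear_combination -h)

theorem algEquiv_two (τ : Ω ≃ₐ[k] Ω) : τ 2 = 2 := map_ofNat τ 2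

theorem algEquiv_three (τ : Ω ≃ₐ[k] Ω) : τ 3 = 3 := map_ofNat τ 3

theorem eval_algEquiv_blowDown (h2 : (2 : Ω) ≠ 0) (h0 : ξ ≠ 0) (hξ : ξ ^ 2 = -3) (τ : Ω ≃ₐ[k] Ω)
    (z : CoxVar n → Ω) (v : XIdx n) :
    eval (fun w : CoxVar n => τ (z ((toricT n).perm ξ τ w))) (blowDown ξ n v) =
      τ (eval z (blowDown ξ n v)) := by
  obtain ⟨i, j⟩ := v
  rcases apply_sqrt_neg_three hξ τ with h | h
  · simp only [perm_toricT_of_eq h]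
    fin_cases j
    · simp [eval_blowDown_zero, algEquiv_two, h]
    · simp [eval_blowDown_one, h]
  · simp only [perm_toricT_of_ne (h.trans_ne (neg_ne_self_of_sq h2 h0))]
    fin_cases j
    · simp [eval_blowDown_zero, algEquiv_two, h, CoxVar.swap]
      field_simp
      ring
    · simp [eval_blowDown_one, h, CoxVar.swap]
      field_simp
      ring

theorem eval_algEquiv_polyA (τ : Ω ≃ₐ[k] Ω) (u : UIdx n → Ω) :
    eval (fun w => τ (u w)) (polyA Ω n d) = τ (eval u (polyA Ω n d)) := by
  simp [polyA, algEquiv_three]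

theorem eval_algEquiv_polyB (τ : Ω ≃ₐ[k] Ω) (u : UIdx n → Ω) :
    eval (fun w => τ (u w)) (polyB Ω n d) = τ (eval u (polyB Ω n d)) := by
  simp [polyB, algEquiv_three]

theorem eval_algEquiv_uFst (τ : Ω ≃ₐ[k] Ω) (u : UIdx n → Ω) (i : Fin (n + 1)) :
    eval (fun w => τ (u w)) (uFst Ω n i) = τ (eval u (uFst Ω n i)) := by
  refine Fin.lastCases ?_ (fun i => ?_) i <;> simp

theorem eval_algEquiv_uSnd (τ : Ω ≃ₐ[k] Ω) (u : UIdx n → Ω) (i : Fin (n + 1)) :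
    eval (fun w => τ (u w)) (uSnd Ω n i) = τ (eval u (uSnd Ω n i)) := by
  refine Fin.lastCases ?_ (fun i => ?_) i <;> simp

theorem eval_algEquiv_phiBar (τ : Ω ≃ₐ[k] Ω) (u : UIdx n → Ω) (v : XIdx n) :
    eval (fun w => τ (u w)) (phiBar Ω n d v) = τ (eval u (phiBar Ω n d v)) := by
  obtain ⟨i, j⟩ := v
  fin_cases j
  · change eval _ (phiBar Ω n d (i, 0)) = τ (eval u (phiBar Ω n d (i, 0)))
    simp [phiBar_zero, eval_algEquiv_polyA, eval_algEquiv_polyB, eval_algEquiv_uFst,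
      eval_algEquiv_uSnd, algEquiv_two, algEquiv_three]
  · change eval _ (phiBar Ω n d (i, 1)) = τ (eval u (phiBar Ω n d (i, 1)))
    simp [phiBar_one, eval_algEquiv_polyA, eval_algEquiv_polyB, eval_algEquiv_uFst,
      eval_algEquiv_uSnd, algEquiv_three]

theorem eval_algEquiv_liftT (h2 : (2 : Ω) ≠ 0) (h0 : ξ ≠ 0) (hξ : ξ ^ 2 = -3) (τ : Ω ≃ₐ[k] Ω)
    (u : UIdx n → Ω) (v : CoxVar n) :
    eval (fun w => τ (u w)) (liftT ξ n d v) =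
      τ (eval u (liftT ξ n d ((toricT n).perm ξ τ v))) := by
  rcases apply_sqrt_neg_three hξ τ with h | h
  · rw [perm_toricT_of_eq h]
    cases v <;> simp [liftT, eval_algEquiv_polyA, eval_algEquiv_polyB, eval_algEquiv_uFst,
      eval_algEquiv_uSnd, algEquiv_three, h]
  · rw [perm_toricT_of_ne (h.trans_ne (neg_ne_self_of_sq h2 h0))]
    cases v <;> simp [liftT, eval_algEquiv_polyA, eval_algEquiv_polyB, eval_algEquiv_uFst,
      eval_algEquiv_uSnd, algEquiv_three, h, CoxVar.swap, sub_eq_add_neg]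

theorem eval_algEquiv_coxF (h2 : (2 : Ω) ≠ 0) (h0 : ξ ≠ 0) (hξ : ξ ^ 2 = -3) (τ : Ω ≃ₐ[k] Ω)
    {z : CoxVar n → Ω} (hz : eval z (coxF ξ n d) = 0) :
    eval (fun w : CoxVar n => τ (z ((toricT n).perm ξ τ w))) (coxF ξ n d) = 0 := by
  have hz' := congrArg τ hz
  rw [eval_coxF, map_sum, map_zero] at hz'
  rw [eval_coxF]
  rcases apply_sqrt_neg_three hξ τ with h | h
  · simp only [perm_toricT_of_eq h]
    simpa [h, algEquiv_three] using hz'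
  · simp only [perm_toricT_of_ne (h.trans_ne (neg_ne_self_of_sq h2 h0)), CoxVar.swap]
    -- Replacing `ξ` by `-ξ` together with the exchange of the two blocks turns `F̂` into `-F̂`,
    -- which has the same zeros.
    rw [← neg_eq_zero, ← Finset.sum_neg_distrib, ← hz']
    refine Finset.sum_congr rfl fun i _ => ?_
    simp only [map_mul, map_pow, map_sub, map_add, map_ofNat, h]
    ring

theorem eval_algEquiv_goodT (h2 : (2 : Ω) ≠ 0) (h0 : ξ ≠ 0) (hξ : ξ ^ 2 = -3) (τ : Ω ≃ₐ[k] Ω)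
    (z : CoxVar n → Ω) :
    eval (fun w : CoxVar n => τ (z ((toricT n).perm ξ τ w))) (goodT Ω n d) =
      τ (eval z (goodT Ω n d)) := by
  rcases apply_sqrt_neg_three hξ τ with h | h
  · simp only [perm_toricT_of_eq h]
    simp [goodT, coxP, coxQ]
  · simp only [perm_toricT_of_ne (h.trans_ne (neg_ne_self_of_sq h2 h0)), CoxVar.swap]
    simp only [goodT, coxP, coxQ, map_mul, map_sum, map_pow, eval_X]
    rw [mul_comm (τ (z (.od (Fin.last n))))]
    congr 1
    rw [mul_comm]
    congr 1 <;> exact Finset.sum_congr rfl fun i _ => mul_comm _ _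

theorem coord_gal_projCox {ι : Type} {x : ι → Ω} {p : (projCox ι).Pt Ω}
    (h : (projCox ι).Coord x p) (ξ : Ω) (τ : Ω ≃ₐ[k] Ω) :
    (projCox ι).Coord (fun i : ι => τ (x i)) ((projCox ι).gal ξ τ p) := by
  have := h.gal ξ τ
  have e : (fun i : ι => τ (x i)) = fun i : ι => τ (x ((projCox ι).perm ξ τ i)) :=
    _root_.funext fun i => congrArg (fun j => τ (x j)) (perm_projCox ξ τ i).symm
  rw [e]
  exact this

theorem coord_gal_toricT {x : CoxVar n → Ω} {p : (toricT n).Pt Ω}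
    (h : (toricT n).Coord x p) (ξ : Ω) (τ : Ω ≃ₐ[k] Ω) :
    (toricT n).Coord (fun v : CoxVar n => τ (x ((toricT n).perm ξ τ v)))
      ((toricT n).gal ξ τ p) := h.gal ξ τ

theorem gal_mem_Xtilde_diff (h2 : (2 : Ω) ≠ 0) (h0 : ξ ≠ 0) (hξ : ξ ^ 2 = -3) (τ : Ω ≃ₐ[k] Ω)
    (q : (toricT n).Pt Ω) (hq : q ∈ Xtilde ξ n d \ (toricT n).zeroLocus (goodT Ω n d)) :
    (toricT n).gal ξ τ q ∈ Xtilde ξ n d \ (toricT n).zeroLocus (goodT Ω n d) := by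
  obtain ⟨z, hz⟩ := exists_coord_toricT q
  have hz' := coord_gal_toricT hz ξ τ
  refine ⟨(mem_Xtilde_iff hz').2 (eval_algEquiv_coxF h2 h0 hξ τ ((mem_Xtilde_iff hz).1 hq.1)),
    fun h => hq.2 ((mem_zeroLocus_goodT_iff hz).2 ?_)⟩
  have := (mem_zeroLocus_goodT_iff hz').1 h
  rwa [eval_algEquiv_goodT h2 h0 hξ, map_eq_zero] at this

theorem gal_mem_goodU (h2 : (2 : Ω) ≠ 0) (h0 : ξ ≠ 0) (hξ : ξ ^ 2 = -3) (τ : Ω ≃ₐ[k] Ω)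
    (p : (projCox (UIdx n)).Pt Ω)
    (hp : p ∈ Set.univ \ (projCox (UIdx n)).zeroLocus (goodU ξ n d)) :
    (projCox (UIdx n)).gal ξ τ p ∈
      Set.univ \ (projCox (UIdx n)).zeroLocus (goodU ξ n d) := by
  obtain ⟨u, hu⟩ := exists_coord_projCox p
  refine ⟨trivial, fun h => hp.2 ((mem_zeroLocus_goodU_iff hu).2 ?_)⟩
  have := (mem_zeroLocus_goodU_iff (coord_gal_projCox hu ξ τ)).1 h
  simp only [goodU, map_mul, eval_X, eval_algEquiv_liftT h2 h0 hξ] at this ⊢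
  rcases apply_sqrt_neg_three hξ τ with h | h
  · simpa [perm_toricT_of_eq h] using this
  · simpa [perm_toricT_of_ne (h.trans_ne (neg_ne_self_of_sq h2 h0)), CoxVar.swap, or_comm]
      using this

/-! Fields of definition. -/

/-- The polynomials with coefficients in a subfield. -/
def coeffSubring (σ : Type*) (L : IntermediateField k Ω) : Subring (MvPolynomial σ Ω) :=
  (MvPolynomial.map (σ := σ) (algebraMap L Ω)).range

theorem coeff_mem_of_mem_coeffSubring {σ : Type*} {L : IntermediateField k Ω}
    {f : MvPolynomial σ Ω} (hf : f ∈ coeffSubring σ L) (m : σ →₀ ℕ) : f.coeff m ∈ L := by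
  obtain ⟨g, rfl⟩ := hf
  rw [coeff_map]
  exact (g.coeff m).2

theorem X_mem_coeffSubring {σ : Type*} (L : IntermediateField k Ω) (v : σ) :
    X v ∈ coeffSubring σ L := ⟨X v, map_X _ _⟩

theorem C_mem_coeffSubring {σ : Type*} {L : IntermediateField k Ω} {c : Ω} (hc : c ∈ L) :
    C c ∈ coeffSubring σ L := ⟨C ⟨c, hc⟩, map_C _ _⟩

theorem mem_adjoin_xi : ξ ∈ IntermediateField.adjoin k {ξ} :=
  IntermediateField.mem_adjoin_simple_self k ξ

theorem three_mem_coeffSubring {σ : Type*} (L : IntermediateField k Ω) :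
    (3 : MvPolynomial σ Ω) ∈ coeffSubring σ L := ofNat_mem _ 3

theorem uFst_mem_coeffSubring (L : IntermediateField k Ω) (i : Fin (n + 1)) :
    uFst Ω n i ∈ coeffSubring _ L := by
  refine Fin.lastCases ?_ (fun i => ?_) i
  · simpa using X_mem_coeffSubring L _
  · simpa using X_mem_coeffSubring L _

theorem uSnd_mem_coeffSubring (L : IntermediateField k Ω) (i : Fin (n + 1)) :
    uSnd Ω n i ∈ coeffSubring _ L := by
  refine Fin.lastCases ?_ (fun i => ?_) i
  · simp
  · simpa using X_mem_coeffSubring L _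

theorem polyA_mem_coeffSubring (L : IntermediateField k Ω) :
    polyA Ω n d ∈ coeffSubring _ L := by
  rw [polyA_eq]
  have h1 := uFst_mem_coeffSubring (n := n) L
  have h2 := uSnd_mem_coeffSubring (n := n) L
  have h3 := three_mem_coeffSubring (σ := UIdx n) L
  exact sum_mem fun i _ => mul_mem (add_mem (h1 i) (mul_mem h3 (h2 i)))
    (pow_mem (add_mem (pow_mem (h1 i) 2) (mul_mem h3 (pow_mem (h2 i) 2))) d)

theorem polyB_mem_coeffSubring (L : IntermediateField k Ω) :
    polyB Ω n d ∈ coeffSubring _ L := by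
  rw [polyB_eq]
  have h1 := uFst_mem_coeffSubring (n := n) L
  have h2 := uSnd_mem_coeffSubring (n := n) L
  have h3 := three_mem_coeffSubring (σ := UIdx n) L
  exact sum_mem fun i _ => mul_mem (sub_mem (h1 i) (h2 i))
    (pow_mem (add_mem (pow_mem (h1 i) 2) (mul_mem h3 (pow_mem (h2 i) 2))) d)

theorem phiBar_mem_coeffSubring (L : IntermediateField k Ω) (v : XIdx n) :
    phiBar Ω n d v ∈ coeffSubring _ L := by
  have h1 := uFst_mem_coeffSubring (n := n) L
  have h2 := uSnd_mem_coeffSubring (n := n) L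
  have h3 := three_mem_coeffSubring (σ := UIdx n) L
  have hA := polyA_mem_coeffSubring (n := n) (d := d) L
  have hB := polyB_mem_coeffSubring (n := n) (d := d) L
  obtain ⟨i, j⟩ := v
  fin_cases j
  · change phiBar Ω n d (i, 0) ∈ _
    rw [phiBar_zero]
    exact mul_mem (C_mem_coeffSubring (div_mem (one_mem _) (ofNat_mem _ 2)))
      (sub_mem (mul_mem (sub_mem (h1 i) (mul_mem h3 (h2 i))) hA)
        (mul_mem (mul_mem h3 (add_mem (h1 i) (h2 i))) hB))
  · change phiBar Ω n d (i, 1) ∈ _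
    rw [phiBar_one]
    exact sub_mem (mul_mem (h1 i) hA) (mul_mem (mul_mem h3 (h2 i)) hB)

theorem liftT_mem_coeffSubring {L : IntermediateField k Ω} (h : ξ ∈ L) (v : CoxVar n) :
    liftT ξ n d v ∈ coeffSubring _ L := by
  have h1 := uFst_mem_coeffSubring (n := n) L
  have h2 := uSnd_mem_coeffSubring (n := n) L
  have h3 := three_mem_coeffSubring (σ := UIdx n) L
  have hA := polyA_mem_coeffSubring (n := n) (d := d) L
  have hB := polyB_mem_coeffSubring (n := n) (d := d) L
  have hC := C_mem_coeffSubring (σ := UIdx n) h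
  cases v with
  | ev i => exact sub_mem (h1 i) (mul_mem hC (h2 i))
  | od i => exact add_mem (h1 i) (mul_mem hC (h2 i))
  | wp => exact add_mem (mul_mem h3 hB) (mul_mem hC hA)
  | wm => exact sub_mem (mul_mem h3 hB) (mul_mem hC hA)

theorem unliftT_mem_coeffSubring {L : IntermediateField k Ω} (h : ξ ∈ L) (v : UIdx n) :
    unliftT ξ n v ∈ coeffSubring _ L := by
  have hX := X_mem_coeffSubring (σ := CoxVar n) L
  rcases v with _ | ⟨i, j⟩
  · exact mul_mem (C_mem_coeffSubring (mul_mem (ofNat_mem _ 2) h)) (mul_mem (hX _) (hX _))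
  · unfold unliftT
    dsimp only
    split_ifs
    · exact mul_mem (C_mem_coeffSubring h)
        (add_mem (mul_mem (hX _) (hX _)) (mul_mem (hX _) (hX _)))
    · exact sub_mem (mul_mem (hX _) (hX _)) (mul_mem (hX _) (hX _))

theorem toCox_mem_coeffSubring {L : IntermediateField k Ω} (h : ξ ∈ L) (v : CoxVar n) :
    toCox ξ n v ∈ coeffSubring _ L := by
  have hX := X_mem_coeffSubring (σ := XIdx n) L
  cases v with
  | ev i => exact sub_mem (hX _) (mul_mem (C_mem_coeffSubring
      (div_mem (add_mem (one_mem _) h) (ofNat_mem _ 2))) (hX _))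
  | od i => exact sub_mem (hX _) (mul_mem (C_mem_coeffSubring
      (div_mem (sub_mem (one_mem _) h) (ofNat_mem _ 2))) (hX _))
  | wp => exact one_mem _
  | wm => exact one_mem _

theorem blowDown_mem_coeffSubring {L : IntermediateField k Ω} (h : ξ ∈ L) (v : XIdx n) :
    blowDown ξ n v ∈ coeffSubring _ L := by
  have hX := X_mem_coeffSubring (σ := CoxVar n) L
  have hc := C_mem_coeffSubring (σ := CoxVar n) (div_mem (one_mem L) h)
  unfold blowDown
  split_ifs
  · exact mul_mem hc (sub_mem
      (mul_mem (C_mem_coeffSubring (div_mem (add_mem (one_mem _) h) (ofNat_mem _ 2)))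
        (mul_mem (hX _) (hX _)))
      (mul_mem (C_mem_coeffSubring (div_mem (sub_mem (one_mem _) h) (ofNat_mem _ 2)))
        (mul_mem (hX _) (hX _))))
  · exact mul_mem hc (sub_mem (mul_mem (hX _) (hX _)) (mul_mem (hX _) (hX _)))

theorem bind₁_mem_coeffSubring {σ ι : Type*} {L : IntermediateField k Ω}
    {f : σ → MvPolynomial ι Ω} {g : MvPolynomial σ Ω} (hf : ∀ v, f v ∈ coeffSubring ι L)
    (hg : g ∈ coeffSubring σ L) : bind₁ f g ∈ coeffSubring ι L := by
  obtain ⟨g, rfl⟩ := hg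
  choose f' hf' using hf
  refine ⟨bind₁ f' g, ?_⟩
  rw [map_bind₁]
  simp_rw [hf']

end Descent

/-! ### The three birational maps and the strict transform -/

section Geometry

section

variable {Ω : Type*} [Field Ω] {n : ℕ}

theorem mem_planeH_iff {a : Ω} {x : XIdx n → Ω} {p : (projCox (XIdx n)).Pt Ω}
    (hx : (projCox (XIdx n)).Coord x p) :
    p ∈ planeH n a ↔ ∀ i, x (i, 0) - a * x (i, 1) = 0 := by
  rw [planeH, Set.mem_iInter]
  refine forall_congr' fun i => ?_
  refine (CoxSpace.mem_zeroLocus_iff (A := projCox (XIdx n)) (isWeightedHomogeneous_projCox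
    ((isHomogeneous_X _ _).sub ((isHomogeneous_X _ _).C_mul a))) hx).trans ?_
  change eval x (X (i, 0) - C a * X (i, 1)) = 0 ↔ _
  simp

end

variable {k Ω : Type*} [Field k] [Field Ω] [Algebra k Ω] [IsAlgClosed Ω] {n d : ℕ} {ξ : Ω}

theorem inducesBirational_liftT (h2 : (2 : Ω) ≠ 0) (h3 : (3 : Ω) ≠ 0) (hξ : ξ ^ 2 = -3)
    (hn : 1 ≤ n) (hd : 1 ≤ d) :
    CoxSpace.InducesBirational k ξ (A := projCox (UIdx n)) (B := toricT n) Set.univ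
      (Xtilde ξ n d) (liftT ξ n d) := by
  have h0 := sqrt_neg_three_ne_zero h3 hξ
  refine CoxSpace.inducesBirational_of_inverse (A := projCox (UIdx n)) (B := toricT n)
    (g := unliftT ξ n)
    (fun v m => coeff_mem_of_mem_coeffSubring (liftT_mem_coeffSubring mem_adjoin_xi v) m)
    (fun v m => coeff_mem_of_mem_coeffSubring (unliftT_mem_coeffSubring mem_adjoin_xi v) m)
    (openDenseIn_goodU h2 h3 hξ hd) (openDenseIn_goodT h2 h3 hξ hn hd) compatible_liftT
    (fun τ u v => ?_) (gal_mem_goodU h2 h0 hξ) (exists_sends_liftT h2 h3 hξ)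
    (exists_sends_unliftT h2 h3 hξ)
  exact (congrArg (fun x : UIdx n → Ω => eval x (liftT ξ n d v))
    (_root_.funext fun i => congrArg (fun j => τ (u j)) (perm_projCox ξ τ i))).trans
      (eval_algEquiv_liftT h2 h0 hξ τ u v)

theorem inducesBirational_blowDown (h2 : (2 : Ω) ≠ 0) (h3 : (3 : Ω) ≠ 0) (hξ : ξ ^ 2 = -3)
    (hn : 1 ≤ n) (hd : 1 ≤ d) :
    CoxSpace.InducesBirational k ξ (A := toricT n) (B := projCox (XIdx n)) (Xtilde ξ n d)
      (hypersurface Ω n d) (blowDown ξ n) := by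
  have h0 := sqrt_neg_three_ne_zero h3 hξ
  refine CoxSpace.inducesBirational_of_inverse (A := toricT n) (B := projCox (XIdx n))
    (g := toCox ξ n)
    (fun v m => coeff_mem_of_mem_coeffSubring (blowDown_mem_coeffSubring mem_adjoin_xi v) m)
    (fun v m => coeff_mem_of_mem_coeffSubring (toCox_mem_coeffSubring mem_adjoin_xi v) m)
    (openDenseIn_goodT h2 h3 hξ hn hd) (openDenseIn_goodX h2 h3 hξ hn hd) (compatible_blowDown ξ)
    (fun τ z v => ?_) (gal_mem_Xtilde_diff h2 h0 hξ) (exists_sends_blowDown h2 h3 hξ)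
    (exists_sends_toCox h2 h3 hξ)
  exact (eval_algEquiv_blowDown h2 h0 hξ τ z v).trans
    (congrArg (fun j => τ (eval z (blowDown ξ n j))) (perm_projCox ξ τ v).symm)

theorem inducesBirational_phiBar (h2 : (2 : Ω) ≠ 0) (h3 : (3 : Ω) ≠ 0) (hξ : ξ ^ 2 = -3)
    (hn : 1 ≤ n) (hd : 1 ≤ d) :
    CoxSpace.InducesBirational k ξ (A := projCox (UIdx n)) (B := projCox (XIdx n)) Set.univ
      (hypersurface Ω n d) (phiBar Ω n d) := by
  have h0 := sqrt_neg_three_ne_zero h3 hξ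
  refine CoxSpace.inducesBirational_of_inverse (A := projCox (UIdx n)) (B := projCox (XIdx n))
    (g := fun v => bind₁ (toCox ξ n) (unliftT ξ n v))
    (fun v m => coeff_mem_of_mem_coeffSubring (phiBar_mem_coeffSubring _ v) m)
    (fun v m => coeff_mem_of_mem_coeffSubring (bind₁_mem_coeffSubring
      (toCox_mem_coeffSubring mem_adjoin_xi) (unliftT_mem_coeffSubring mem_adjoin_xi v)) m)
    (openDenseIn_goodU h2 h3 hξ hd) (openDenseIn_goodX h2 h3 hξ hn hd)
    (compatible_projCox isHomogeneous_phiBar)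
    (fun τ u v => ?_) (gal_mem_goodU h2 h0 hξ) (fun p hp => ?_) (fun r hr => ?_)
  · exact ((congrArg (fun x : UIdx n → Ω => eval x (phiBar Ω n d v))
      (_root_.funext fun i => congrArg (fun j => τ (u j)) (perm_projCox ξ τ i))).trans
        (eval_algEquiv_phiBar τ u v)).trans
          (congrArg (fun j => τ (eval u (phiBar Ω n d j))) (perm_projCox ξ τ v).symm)
  · obtain ⟨q, hq, hpq, hqp⟩ := exists_sends_liftT h2 h3 hξ p hp
    obtain ⟨r, hr, hqr, hrq⟩ := exists_sends_blowDown h2 h3 hξ q hq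
    exact ⟨r, hr, sends_phiBar h2 h3 hξ hpq hqr, hrq.comp hqp⟩
  · obtain ⟨q, hq, hqr, hrq⟩ := exists_sends_toCox h2 h3 hξ r hr
    obtain ⟨p, hp, hpq, hqp⟩ := exists_sends_unliftT h2 h3 hξ q hq
    exact ⟨p, hp, sends_phiBar h2 h3 hξ hpq hqr, hrq.comp hqp⟩

/-- The dense open part of `V(F̂)` lies over points of `X` outside the centre. Conversely, over such
points `w_+` and `w_-` are nonzero, so the pulled-back equation, a constant times `w_+^d w_-^d F̂`,
forces `F̂ = 0`; and `V(F̂)` is closed. -/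
theorem Xtilde_eq_strictTransform (h2 : (2 : Ω) ≠ 0) (h3 : (3 : Ω) ≠ 0) (hξ : ξ ^ 2 = -3)
    (hn : 1 ≤ n) (hd : 1 ≤ d) : Xtilde ξ n d = strictTransform ξ n d := by
  have h0 := sqrt_neg_three_ne_zero h3 hξ
  apply subset_antisymm
  · refine (openDenseIn_goodT h2 h3 hξ hn hd).2.trans (closure_mono fun q hq => ?_)
    obtain ⟨p, hp, hqp, hpq⟩ := exists_sends_blowDown h2 h3 hξ q hq
    refine ⟨p, ⟨hp.1, fun h => ?_⟩, hqp⟩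
    obtain ⟨x, hx⟩ := exists_coord_projCox p
    refine hp.2 ((mem_zeroLocus_goodX_iff hx).2 ?_)
    simp only [goodT, map_mul, eval_X, eval_toCox_ev, eval_toCox_od]
    rcases h with h | h
    · rw [(mem_planeH_iff hx).1 h, zero_mul, zero_mul]
    · rw [(mem_planeH_iff hx).1 h, mul_zero, zero_mul]
  · refine closure_minimal ?_
      (CoxSpace.isClosed_zeroLocus (A := toricT n) (isWeightedHomogeneous_coxF ξ))
    rintro q ⟨p, ⟨hp, hH⟩, hqp⟩
    obtain ⟨z, hz⟩ := exists_coord_toricT q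
    have hx : (projCox (XIdx n)).Coord (fun v : XIdx n => eval z (blowDown ξ n v)) p := hqp z hz
    have hw : z .wp ≠ 0 ∧ z .wm ≠ 0 := by
      constructor
      · refine fun hw => hH (.inl ((mem_planeH_iff hx).2 fun i => ?_))
        rw [← eval_toCox_ev ξ (fun v => eval z (blowDown ξ n v)), eval_toCox_ev_blowDown h2 h0, hw,
          mul_zero]
      · refine fun hw => hH (.inr ((mem_planeH_iff hx).2 fun i => ?_))
        rw [← eval_toCox_od ξ (fun v => eval z (blowDown ξ n v)), eval_toCox_od_blowDown h2 h0, hw,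
          mul_zero]
    have hX := (mem_hypersurface_iff hx).1 hp
    rw [eval_hypersurfaceEq_blowDown h2 h0 hξ] at hX
    refine (mem_Xtilde_iff hz).2 ((mul_eq_zero.1 ((mul_eq_zero.1 hX).resolve_left
      (neg_ne_zero.2 (one_div_ne_zero (mul_ne_zero h2 h0))))).resolve_left
        (mul_ne_zero (pow_ne_zero _ hw.1) (pow_ne_zero _ hw.2)))

end Geometry

/-! ### Non-divisibility by `w_±`, and the Fermat cubic -/

section Divisibility

variable {Ω : Type*} [Field Ω] {n d : ℕ} {ξ : Ω}

theorem not_wp_dvd_coxF (hp : 3 + ξ ≠ 0) : ¬ X CoxVar.wp ∣ coxF ξ n d := by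
  classical
  rintro ⟨m, hm⟩
  -- At this point `w_+ = 0` while `F̂` takes the value `-(3 + ξ)`.
  have := congrArg (eval fun v => if v = .ev 0 ∨ v = .od 0 ∨ v = .wm then 1 else 0) hm
  rw [eval_coxF, Finset.sum_eq_single 0] at this
  · simp at this
    exact hp (by linear_combination -this)
  · intro i _ hi
    simp [hi]
  · simp

theorem not_wm_dvd_coxF (hm : 3 - ξ ≠ 0) : ¬ X CoxVar.wm ∣ coxF ξ n d := by
  classical
  rintro ⟨m, hm⟩
  have := congrArg (eval fun v => if v = .ev 0 ∨ v = .od 0 ∨ v = .wp then 1 else 0) hm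
  rw [eval_coxF, Finset.sum_eq_single 0] at this
  · simp at this
    exact ‹3 - ξ ≠ 0› this
  · intro i _ hi
    simp [hi]
  · simp

theorem hypersurfaceEq_one {R : Type*} [CommRing R] :
    hypersurfaceEq R n 1 = ∑ v : XIdx n, X v ^ 3 := by
  rw [hypersurfaceEq, Fintype.sum_prod_type]
  refine Finset.sum_congr rfl fun i _ => ?_
  rw [Fin.sum_univ_two]
  ring

end Divisibility

/-! ### Rational points of the blow-up and of the hypersurface -/

section RationalPoints

variable {k Ω : Type*} [Field k] [Field Ω] [Algebra k Ω] {n d : ℕ} {ξ : Ω}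

theorem exists_algEquiv_eq_neg [IsGalois k Ω] (hk : ¬ IsSquare (-3 : k)) (hξ : ξ ^ 2 = -3) :
    ∃ τ : Ω ≃ₐ[k] Ω, τ ξ = -ξ := by
  by_contra! h
  obtain ⟨c, hc⟩ := (InfiniteGalois.mem_range_algebraMap_iff_fixed (k := k) ξ).2
    fun τ => (apply_sqrt_neg_three hξ τ).resolve_right (h τ)
  refine hk ⟨c, (algebraMap k Ω).injective ?_⟩
  rw [← pow_two, map_pow, hc, hξ, map_neg, map_ofNat]

/-- The point `q` of the blow-up lies above the `k`-point `P`. -/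
def LiesAbove (ξ : Ω) (q : (toricT n).Pt Ω) (P : ℙ k (XIdx n → k)) : Prop :=
  ∃ r : (projCox (XIdx n)).Pt Ω,
    (projCox (XIdx n)).Coord (fun v : XIdx n => algebraMap k Ω (P.rep v)) r ∧
    CoxSpace.Sends (A := toricT n) (B := projCox (XIdx n)) (blowDown ξ n) q r

theorem coord_algebraMap_rep {ι : Type} (P : ℙ k (ι → k)) :
    ∃ r, (projCox ι).Coord (fun v : ι => algebraMap k Ω (P.rep v)) r := by
  obtain ⟨v, hv⟩ := Function.ne_iff.1 P.rep_nonzero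
  exact (stable_projCox.2 ⟨v, (map_ne_zero _).2 hv⟩).exists_point

/-- Once one coordinate is normalised to `1`, the scalar relating a vector to its conjugate is `1`,
so every coordinate is fixed by the Galois group. -/
theorem exists_rep_of_gal_eq {ι : Type} [IsGalois k Ω] {r : (projCox ι).Pt Ω}
    (hr : ∀ τ : Ω ≃ₐ[k] Ω, (projCox ι).gal ξ τ r = r) :
    ∃ P : ℙ k (ι → k), (projCox ι).Coord (fun v : ι => algebraMap k Ω (P.rep v)) r := by
  obtain ⟨x, hx⟩ := exists_coord_projCox r
  obtain ⟨i, hi⟩ := stable_projCox.1 hx.stable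
  have hx' := coord_smul_projCox hx (inv_ne_zero hi)
  have hfix : ∀ j, ∃ c, algebraMap k Ω c = (x i)⁻¹ * x j := by
    intro j
    refine (InfiniteGalois.mem_range_algebraMap_iff_fixed (k := k) _).2 fun τ => ?_
    obtain ⟨t, -, ht⟩ := (coord_eq_iff_projCox hx' (coord_gal_projCox hx' ξ τ)).1 (hr τ).symm
    have hi1 := ht i
    rw [inv_mul_cancel₀ hi, map_one, mul_one] at hi1
    rw [ht j, ← hi1, one_mul]
  choose c hc using hfix
  have hc0 : c ≠ 0 := fun h => one_ne_zero (α := Ω) (by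
    rw [← inv_mul_cancel₀ hi, ← hc i, h, Pi.zero_apply, map_zero])
  obtain ⟨a, ha⟩ := Projectivization.exists_smul_eq_mk_rep k c hc0
  refine ⟨Projectivization.mk k c hc0, ?_⟩
  have e : (fun v : ι => algebraMap k Ω ((Projectivization.mk k c hc0).rep v)) =
      fun v : ι => algebraMap k Ω a * ((x i)⁻¹ * x v) := by
    funext v
    rw [← ha, Pi.smul_apply, Units.smul_def, smul_eq_mul, map_mul, hc]
  rw [e]
  exact coord_smul_projCox hx' ((map_ne_zero _).2 a.ne_zero)

theorem rep_eq_of_coord {ι : Type} {P P' : ℙ k (ι → k)} {r : (projCox ι).Pt Ω}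
    (h : (projCox ι).Coord (fun v : ι => algebraMap k Ω (P.rep v)) r)
    (h' : (projCox ι).Coord (fun v : ι => algebraMap k Ω (P'.rep v)) r) : P = P' := by
  obtain ⟨t, ht, hP⟩ := (coord_eq_iff_projCox h h').1 rfl
  obtain ⟨v, hv⟩ := Function.ne_iff.1 P.rep_nonzero
  have hv' : algebraMap k Ω (P.rep v) ≠ 0 := (map_ne_zero _).2 hv
  have htk : t = algebraMap k Ω (P'.rep v / P.rep v) := by
    rw [map_div₀, hP v, mul_div_cancel_right₀ _ hv']
  rw [← P.mk_rep, ← P'.mk_rep, eq_comm, Projectivization.mk_eq_mk_iff']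
  refine ⟨P'.rep v / P.rep v, funext fun w => (algebraMap k Ω).injective ?_⟩
  rw [Pi.smul_apply, smul_eq_mul, map_mul, ← htk, ← hP w]

theorem LiesAbove.unique {q : (toricT n).Pt Ω} {P P' : ℙ k (XIdx n → k)}
    (h : LiesAbove ξ q P) (h' : LiesAbove ξ q P') : P = P' := by
  obtain ⟨r, hr, hqr⟩ := h
  obtain ⟨r', hr', hqr'⟩ := h'
  obtain rfl := hqr.unique hqr'
  exact rep_eq_of_coord hr hr'

theorem eval_algebraMap_hypersurfaceEq (x : XIdx n → k) :
    eval (fun v => algebraMap k Ω (x v)) (hypersurfaceEq Ω n d) =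
      algebraMap k Ω (eval x (hypersurfaceEq k n d)) := by
  simp [eval_hypersurfaceEq]

theorem eval_smul_hypersurfaceEq (c : Ω) (x : XIdx n → Ω) :
    eval (fun v => c * x v) (hypersurfaceEq Ω n d) =
      c ^ (2 * d + 1) * eval x (hypersurfaceEq Ω n d) := by
  rw [eval_hypersurfaceEq, eval_hypersurfaceEq, Finset.mul_sum]
  refine Finset.sum_congr rfl fun i _ => ?_
  rw [show (c * x (i, 0)) ^ 2 - c * x (i, 0) * (c * x (i, 1)) + (c * x (i, 1)) ^ 2 =
    c ^ 2 * (x (i, 0) ^ 2 - x (i, 0) * x (i, 1) + x (i, 1) ^ 2) by ring, mul_pow, ← pow_mul]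
  ring

theorem mem_hypersurfacePts_iff_of_coord {P : ℙ k (XIdx n → k)} {r : (projCox (XIdx n)).Pt Ω}
    (h : (projCox (XIdx n)).Coord (fun v : XIdx n => algebraMap k Ω (P.rep v)) r) :
    P ∈ hypersurfacePts k n d ↔ r ∈ hypersurface Ω n d := by
  rw [mem_hypersurface_iff h, eval_algebraMap_hypersurfaceEq, map_eq_zero]
  rfl

theorem LiesAbove.mem_hypersurfacePts (h2 : (2 : Ω) ≠ 0) (h0 : ξ ≠ 0) (hξ : ξ ^ 2 = -3)
    {q : (toricT n).Pt Ω} {P : ℙ k (XIdx n → k)} (h : LiesAbove ξ q P) (hq : q ∈ Xtilde ξ n d) :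
    P ∈ hypersurfacePts k n d := by
  obtain ⟨r, hr, hqr⟩ := h
  obtain ⟨z, hz⟩ := exists_coord_toricT q
  have hx : (projCox (XIdx n)).Coord (fun v : XIdx n => eval z (blowDown ξ n v)) r := hqr z hz
  rw [mem_hypersurfacePts_iff_of_coord hr, mem_hypersurface_iff hx,
    eval_hypersurfaceEq_blowDown h2 h0 hξ, (mem_Xtilde_iff hz).1 hq, mul_zero, mul_zero]

theorem exists_liesAbove_of_mem_rationalPts [IsGalois k Ω] (h2 : (2 : Ω) ≠ 0) (h0 : ξ ≠ 0)
    (hξ : ξ ^ 2 = -3) {q : (toricT n).Pt Ω} (hq : q ∈ (toricT n).rationalPts k ξ) :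
    ∃ P : ℙ k (XIdx n → k), LiesAbove ξ q P := by
  obtain ⟨z, hz⟩ := exists_coord_toricT q
  obtain ⟨r, hr⟩ := (stable_blowDown h2 h0 hz.stable).exists_point
  have hqr : CoxSpace.Sends (A := toricT n) (B := projCox (XIdx n)) (blowDown ξ n) q r :=
    (compatible_blowDown ξ).sends hz hr
  obtain ⟨P, hP⟩ := exists_rep_of_gal_eq (k := k) (ξ := ξ) (r := r) fun τ => by
    have := hqr.gal (compatible_blowDown ξ) (τ := τ) fun z v =>
      (eval_algEquiv_blowDown h2 h0 hξ τ z v).trans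
        (congrArg (fun j => τ (eval z (blowDown ξ n j))) (perm_projCox ξ τ v).symm)
    rw [hq τ] at this
    exact this.unique hqr
  exact ⟨P, r, hP, hqr⟩

/-- The section with `w_+ = w_- = 1` applies outside the centre (`he`, `ho`). An automorphism moving
`ξ` exchanges the forms `y_{2i}` and `y_{2i+1}` at a rational vector, and the twist exchanges them
back, so even the coordinate vector is fixed. -/
theorem exists_mem_rationalPts_liesAbove (h2 : (2 : Ω) ≠ 0) (h0 : ξ ≠ 0) (hξ : ξ ^ 2 = -3)
    (P : ℙ k (XIdx n → k))
    (he : ∃ i, algebraMap k Ω (P.rep (i, 0)) - (1 + ξ) / 2 * algebraMap k Ω (P.rep (i, 1)) ≠ 0)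
    (ho : ∃ i, algebraMap k Ω (P.rep (i, 0)) - (1 - ξ) / 2 * algebraMap k Ω (P.rep (i, 1)) ≠ 0) :
    ∃ q ∈ (toricT n).rationalPts k ξ, LiesAbove ξ q P ∧
      (P ∈ hypersurfacePts k n d → q ∈ Xtilde ξ n d) := by
  obtain ⟨r, hr⟩ := coord_algebraMap_rep (Ω := Ω) P
  set x : XIdx n → Ω := fun v => algebraMap k Ω (P.rep v) with hxdef
  have hst : (toricT n).Stable (fun v : CoxVar n => eval x (toCox ξ n v)) := by
    refine stable_toricT.2 ⟨?_, ?_, .inl ?_⟩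
    · obtain ⟨i, hi⟩ := he
      exact ⟨i, by rwa [eval_toCox_ev]⟩
    · obtain ⟨i, hi⟩ := ho
      exact ⟨i, by rwa [eval_toCox_od]⟩
    · rw [eval_toCox_wp]
      exact one_ne_zero
  obtain ⟨q, hq⟩ := hst.exists_point
  have hτx : ∀ (τ : Ω ≃ₐ[k] Ω) v, τ (x v) = x v := fun τ v => τ.commutes _
  refine ⟨q, fun τ => ?_, ⟨r, hr, (compatible_blowDown ξ).sends hq
    (coord_blowDown_toCox h2 h0 hr)⟩, fun hP => (mem_Xtilde_iff hq).2 ?_⟩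
  · have hg := coord_gal_toricT hq ξ τ
    have e : (fun v : CoxVar n => τ (eval x (toCox ξ n ((toricT n).perm ξ τ v)))) =
        fun v : CoxVar n => eval x (toCox ξ n v) := by
      funext v
      rcases apply_sqrt_neg_three hξ τ with h | h
      · rw [perm_toricT_of_eq h]
        cases v <;> simp [toCox, hτx, h, algEquiv_two]
      · rw [perm_toricT_of_ne (h.trans_ne (neg_ne_self_of_sq h2 h0))]
        cases v <;> simp [toCox, CoxVar.swap, hτx, h, algEquiv_two, sub_eq_add_neg]
    rw [e] at hg
    exact hg.unique hq
  · rw [eval_coxF_toCox h2 hξ, (mem_hypersurface_iff hr).1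
      ((mem_hypersurfacePts_iff_of_coord hr).1 hP), mul_zero]

theorem LiesAbove.eq_of_ne_zero (h2 : (2 : Ω) ≠ 0) (h0 : ξ ≠ 0) {q q' : (toricT n).Pt Ω}
    {P : ℙ k (XIdx n → k)} (h : LiesAbove ξ q P) (h' : LiesAbove ξ q' P) {z z' : CoxVar n → Ω}
    (hz : (toricT n).Coord z q) (hz' : (toricT n).Coord z' q') (hp : z .wp ≠ 0) (hm : z .wm ≠ 0)
    (hp' : z' .wp ≠ 0) (hm' : z' .wm ≠ 0) : q = q' := by
  obtain ⟨r, hr, hqr⟩ := h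
  obtain ⟨r', hr', hqr'⟩ := h'
  obtain rfl := hr.unique hr'
  have h1 : CoxSpace.Sends (A := projCox (XIdx n)) (B := toricT n) (toCox ξ n) r q :=
    (compatible_toCox ξ).sends (hqr z hz) (coord_toCox_blowDown h2 h0 hz hp hm)
  have h1' : CoxSpace.Sends (A := projCox (XIdx n)) (B := toricT n) (toCox ξ n) r q' :=
    (compatible_toCox ξ).sends (hqr' z' hz') (coord_toCox_blowDown h2 h0 hz' hp' hm')
  exact h1.unique h1'

/-- An automorphism with `ξ ↦ -ξ` exchanges the two exceptional divisors, which are disjoint, so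
neither contains a rational point. -/
theorem wp_wm_ne_zero_of_mem_rationalPts [IsGalois k Ω] (h2 : (2 : Ω) ≠ 0) (h0 : ξ ≠ 0)
    (hξ : ξ ^ 2 = -3) (hk : ¬ IsSquare (-3 : k)) {q : (toricT n).Pt Ω}
    (hq : q ∈ (toricT n).rationalPts k ξ) {z : CoxVar n → Ω} (hz : (toricT n).Coord z q) :
    z .wp ≠ 0 ∧ z .wm ≠ 0 := by
  obtain ⟨τ, hτ⟩ := exists_algEquiv_eq_neg hk hξ
  have hg := coord_gal_toricT hz ξ τ
  simp only [perm_toricT_of_ne (hτ.trans_ne (neg_ne_self_of_sq h2 h0))] at hg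
  obtain ⟨_, _, a, b, ha, hb, -, -, -, -, -, h3, h4⟩ :=
    (coord_eq_iff_toricT hz hg).1 (hq τ).symm
  simp only [CoxVar.swap] at h3 h4
  have h5 : z .wm = 0 ↔ z .wp = 0 := by
    rw [← map_eq_zero τ, h3, mul_eq_zero, or_iff_right ha]
  rcases (stable_toricT.1 hz.stable).2.2 with h | h
  · exact ⟨h, fun h' => h (h5.1 h')⟩
  · exact ⟨fun h' => h (h5.2 h'), h⟩

/-- A rational point on the plane would make `(1 + c)/2` a ratio of elements of `k`, hence put the
square root `c` of `-3` in `k`. -/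
theorem sub_ne_zero_of_not_isSquare {c : Ω} (hc : c ^ 2 = -3) (h2 : (2 : Ω) ≠ 0)
    (hk : ¬ IsSquare (-3 : k)) (P : ℙ k (XIdx n → k)) :
    ∃ i, algebraMap k Ω (P.rep (i, 0)) - (1 + c) / 2 * algebraMap k Ω (P.rep (i, 1)) ≠ 0 := by
  by_contra! h
  obtain ⟨⟨i, j⟩, hi⟩ := Function.ne_iff.1 P.rep_nonzero
  have hP1 : P.rep (i, 1) ≠ 0 := by
    intro h1
    fin_cases j
    · have := h i
      rw [h1, map_zero, mul_zero, sub_zero, map_eq_zero] at this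
      exact hi this
    · exact hi h1
  have hP1' : algebraMap k Ω (P.rep (i, 1)) ≠ 0 := (map_ne_zero _).2 hP1
  refine hk ⟨2 * (P.rep (i, 0) / P.rep (i, 1)) - 1, (algebraMap k Ω).injective ?_⟩
  have hc' : c = algebraMap k Ω (2 * (P.rep (i, 0) / P.rep (i, 1)) - 1) := by
    have := h i
    rw [map_sub, map_mul, map_div₀, map_ofNat, map_one]
    field_simp at this ⊢
    linear_combination -this
  rw [map_mul, ← hc', ← pow_two, hc, map_neg, map_ofNat]

theorem exists_mem_rationalPts_liesAbove_of_not_isSquare (h2 : (2 : Ω) ≠ 0) (h0 : ξ ≠ 0)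
    (hξ : ξ ^ 2 = -3) (hk : ¬ IsSquare (-3 : k)) (P : ℙ k (XIdx n → k)) :
    ∃ q ∈ (toricT n).rationalPts k ξ, LiesAbove ξ q P ∧
      (P ∈ hypersurfacePts k n d → q ∈ Xtilde ξ n d) :=
  exists_mem_rationalPts_liesAbove h2 h0 hξ P (sub_ne_zero_of_not_isSquare hξ h2 hk P) (by
    simpa [sub_eq_add_neg] using
      sub_ne_zero_of_not_isSquare (c := -ξ) (by rw [neg_sq, hξ]) h2 hk P)

/-- Rational points avoid both the centre and the exceptional divisors, so the blow-down is a
bijection on them. -/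
theorem card_Xtilde_eq_card_hypersurfacePts [IsGalois k Ω] (h2 : (2 : Ω) ≠ 0) (h0 : ξ ≠ 0)
    (hξ : ξ ^ 2 = -3) (hk : ¬ IsSquare (-3 : k)) :
    Nat.card ↥(Xtilde ξ n d ∩ (toricT n).rationalPts k ξ) =
      Nat.card ↥(hypersurfacePts k n d) := by
  choose F hF using fun q : ↥(Xtilde ξ n d ∩ (toricT n).rationalPts k ξ) =>
    exists_liesAbove_of_mem_rationalPts h2 h0 hξ q.2.2
  refine Nat.card_eq_of_bijective
    (fun q => (⟨F q, (hF q).mem_hypersurfacePts h2 h0 hξ q.2.1⟩ : ↥(hypersurfacePts k n d)))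
    ⟨fun q q' h => ?_, fun P => ?_⟩
  · obtain ⟨z, hz⟩ := exists_coord_toricT q.1
    obtain ⟨z', hz'⟩ := exists_coord_toricT q'.1
    have hw := wp_wm_ne_zero_of_mem_rationalPts h2 h0 hξ hk q.2.2 hz
    have hw' := wp_wm_ne_zero_of_mem_rationalPts h2 h0 hξ hk q'.2.2 hz'
    have h' := hF q'
    have hFF : F q = F q' := Subtype.ext_iff.1 h
    rw [← hFF] at h'
    exact Subtype.ext ((hF q).eq_of_ne_zero h2 h0 h' hz hz' hw.1 hw.2 hw'.1 hw'.2)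
  · obtain ⟨q, hq, hqP, hX⟩ :=
      exists_mem_rationalPts_liesAbove_of_not_isSquare (d := d) h2 h0 hξ hk P.1
    exact ⟨⟨q, hX P.2, hq⟩, Subtype.ext ((hF _).unique hqP)⟩

end RationalPoints

/-! ### The factorisation of `φ̄` -/

section Birational

variable {k Ω : Type*} [Field k] [Field Ω] [Algebra k Ω] {n d : ℕ} {ξ : Ω}

theorem two_ne_zero_of_not_isSquare (hk : ¬ IsSquare (-3 : k)) : (2 : Ω) ≠ 0 := by
  rw [← map_ofNat (algebraMap k Ω), map_ne_zero]
  -- In characteristic 2 one has `-3 = 1²`.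
  exact fun h => hk ⟨1, by linear_combination -2 * h⟩

theorem three_ne_zero_of_not_isSquare (hk : ¬ IsSquare (-3 : k)) : (3 : Ω) ≠ 0 := by
  rw [← map_ofNat (algebraMap k Ω), map_ne_zero]
  exact fun h => hk ⟨0, by linear_combination -h⟩

theorem exists_birational_lift [IsAlgClosed Ω] (h2 : (2 : Ω) ≠ 0) (h3 : (3 : Ω) ≠ 0)
    (hξ : ξ ^ 2 = -3) (hn : 1 ≤ n) (hd : 1 ≤ d) :
    ∃ lift : CoxVar n → MvPolynomial (UIdx n) Ω,
      CoxSpace.InducesBirational k ξ (A := projCox (UIdx n)) (B := toricT n)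
        Set.univ (Xtilde ξ n d) lift ∧
      ∃ U : Set ((projCox (UIdx n)).Pt Ω), CoxSpace.OpenDenseIn U Set.univ ∧
        ∀ u ∈ U, ∃ p q, CoxSpace.Sends (A := projCox (UIdx n)) (B := toricT n) lift u p ∧
          CoxSpace.Sends (A := toricT n) (B := projCox (XIdx n)) (blowDown ξ n) p q ∧
          CoxSpace.Sends (A := projCox (UIdx n)) (B := projCox (XIdx n)) (phiBar Ω n d) u q := by
  refine ⟨liftT ξ n d, inducesBirational_liftT h2 h3 hξ hn hd, _,
    openDenseIn_goodU h2 h3 hξ hd, fun u hu => ?_⟩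
  obtain ⟨p, hp, hup, -⟩ := exists_sends_liftT h2 h3 hξ u hu
  obtain ⟨q, -, hpq, -⟩ := exists_sends_blowDown h2 h3 hξ p hp
  exact ⟨p, q, hup, hpq, sends_phiBar h2 h3 hξ hup hpq⟩

end Birational

/-! ### Counting tools over finite fields, and characteristic 3 -/

section FiniteCounting

/-- The nonzero vectors are the multiples of the representatives of points. -/
def Projectivization.repEquiv (k V : Type*) [Field k] [AddCommGroup V] [Module k V] :
    ℙ k V × kˣ ≃ {v : V // v ≠ 0} :=
  Equiv.ofBijective
    (fun p => ⟨p.2 • p.1.rep, (smul_ne_zero_iff_ne p.2).2 p.1.rep_nonzero⟩) <| by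
      constructor
      · rintro ⟨P, s⟩ ⟨Q, t⟩ h
        have h' : s • P.rep = t • Q.rep := Subtype.ext_iff.1 h
        have hPQ : P = Q := by
          rw [← P.mk_rep, ← Q.mk_rep, Projectivization.mk_eq_mk_iff]
          exact ⟨s⁻¹ * t, by rw [mul_smul, ← h', inv_smul_smul]⟩
        subst hPQ
        have : s = t := Units.ext (smul_left_injective k P.rep_nonzero h')
        rw [this]
      · rintro ⟨v, hv⟩
        obtain ⟨a, ha⟩ := Projectivization.exists_smul_eq_mk_rep k v hv
        exact ⟨(Projectivization.mk k v hv, a⁻¹), Subtype.ext (by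
          change a⁻¹ • (Projectivization.mk k v hv).rep = v
          rw [← ha, inv_smul_smul])⟩

theorem Projectivization.coe_repEquiv {k V : Type*} [Field k] [AddCommGroup V] [Module k V]
    (p : ℙ k V × kˣ) : (Projectivization.repEquiv k V p : V) = p.2 • p.1.rep := rfl

/-- Passage from projective to affine counts; the `+ 1` is the origin. -/
theorem card_zeroLocus_add_one {k V : Type*} [Field k] [Finite k] [AddCommGroup V] [Module k V]
    [Finite V] (S : V → Prop) (h0 : S 0) (hS : ∀ (t : kˣ) v, S (t • v) ↔ S v) :
    Nat.card {v // S v} = Nat.card {P : ℙ k V // S P.rep} * (Nat.card k - 1) + 1 := by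
  have e : ({P : ℙ k V // S P.rep} × kˣ) ≃ {v : {v : V // v ≠ 0} // S v} :=
    (Equiv.prodSubtypeFstEquivSubtypeProd (p := fun P : ℙ k V => S P.rep)).symm.trans
      ((Projectivization.repEquiv k V).subtypeEquiv fun p => by
        rw [Projectivization.coe_repEquiv, hS])
  have e' : Option {v : {v : V // v ≠ 0} // S v} ≃ {v // S v} :=
    Equiv.ofBijective (fun o => o.elim ⟨0, h0⟩ fun v => ⟨v.1.1, v.2⟩) <| by
      constructor
      · rintro (_ | ⟨⟨v, hv⟩, hSv⟩) (_ | ⟨⟨w, hw⟩, hSw⟩) h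
        · rfl
        · exact absurd (Subtype.ext_iff.1 h).symm hw
        · exact absurd (Subtype.ext_iff.1 h) hv
        · have : v = w := Subtype.ext_iff.1 h
          subst this
          rfl
      · rintro ⟨v, hv⟩
        by_cases h : v = 0
        · exact ⟨none, Subtype.ext h.symm⟩
        · exact ⟨some ⟨⟨v, h⟩, hv⟩, rfl⟩
  have : Finite {v : {v : V // v ≠ 0} // S v} := Subtype.finite
  rw [← Nat.card_congr e', Finite.card_option, ← Nat.card_congr e, Nat.card_prod, Nat.card_units]

/-- The averaging device: pairs `(g, y)` with `C (σ g y)` are counted in two ways, each `σ g` being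
a bijection. -/
theorem card_mul_card_eq_sum {G Y : Type*} [Finite G] [Fintype Y] (σ : G → Equiv.Perm Y)
    (C : Y → Prop) :
    Nat.card G * Nat.card {y // C y} = ∑ y, Nat.card {g // C (σ g y)} := by
  rw [← Nat.card_prod, ← Nat.card_sigma]
  have e : G × {y // C y} ≃ {p : Y × G // C (σ p.2 p.1)} :=
    { toFun := fun p => ⟨((σ p.1).symm p.2.1, p.1), by simpa using p.2.2⟩
      invFun := fun p => (p.1.2, ⟨σ p.1.2 p.1.1, p.2⟩)
      left_inv := fun p => by simp
      right_inv := fun p => by simp }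
  exact Nat.card_congr (e.trans (Equiv.subtypeProdEquivSigmaSubtype fun y g => C (σ g y)))

/-- Multiplication by `-1` carries the solutions to the `m`-torsion of a cyclic group. -/
theorem card_units_pow_eq_neg_one {k : Type*} [Field k] [Finite k] {m : ℕ}
    (hm : (-1 : k) ^ m = -1) : Nat.card {a : kˣ // a ^ m = -1} = Nat.gcd m (Nat.card k - 1) := by
  have hm' : (-1 : kˣ) ^ m = -1 := Units.ext (by simpa using hm)
  rw [Nat.gcd_comm, ← Nat.card_units, ← IsCyclic.card_powMonoidHom_ker]
  refine Nat.card_congr ((Equiv.mulLeft (-1 : kˣ)).subtypeEquiv fun a => ?_)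
  rw [MonoidHom.mem_ker, powMonoidHom_apply, Equiv.coe_mulLeft, mul_pow, hm', neg_one_mul,
    neg_eq_iff_eq_neg]

theorem card_pow_add_pow_eq_zero {k : Type*} [Field k] [Finite k] {m : ℕ} (h0 : m ≠ 0)
    (hm : (-1 : k) ^ m = -1) : Nat.card {p : k × k // p.1 ^ m + p.2 ^ m = 0} =
      1 + (Nat.card k - 1) * Nat.gcd m (Nat.card k - 1) := by
  have e : Option (kˣ × {a : kˣ // a ^ m = -1}) ≃ {p : k × k // p.1 ^ m + p.2 ^ m = 0} :=
    Equiv.ofBijective (fun o => o.elim ⟨(0, 0), by simp [h0]⟩ fun a =>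
      ⟨(a.1, a.1 * a.2.1), by
        have h : ((a.2.1 : kˣ) : k) ^ m = -1 := by
          rw [← Units.val_pow_eq_pow_val, a.2.2]; simp
        rw [mul_pow, h]; ring⟩) <| by
      constructor
      · rintro (_ | ⟨a, b, hb⟩) (_ | ⟨a', b', hb'⟩) h
        · rfl
        · exact absurd (congrArg Prod.fst (Subtype.ext_iff.1 h)).symm a'.ne_zero
        · exact absurd (congrArg Prod.fst (Subtype.ext_iff.1 h)) a.ne_zero
        · have h1 : a = a' := Units.ext (congrArg Prod.fst (Subtype.ext_iff.1 h))
          subst h1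
          have h2 : (a : k) * b = a * b' := congrArg Prod.snd (Subtype.ext_iff.1 h)
          have h3 : b = b' := Units.ext (mul_left_cancel₀ a.ne_zero h2)
          subst h3
          rfl
      · rintro ⟨⟨x, y⟩, h⟩
        change x ^ m + y ^ m = 0 at h
        by_cases hx : x = 0
        · subst hx
          rw [zero_pow h0, zero_add, pow_eq_zero_iff h0] at h
          exact ⟨none, Subtype.ext (by simp [h])⟩
        · have hy : y ≠ 0 := by
            rintro rfl
            rw [zero_pow h0, add_zero, pow_eq_zero_iff h0] at h
            exact hx h
          refine ⟨some (Units.mk0 x hx, ⟨Units.mk0 (y / x) (div_ne_zero hy hx), Units.ext ?_⟩),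
            Subtype.ext (Prod.ext rfl (mul_div_cancel₀ y hx))⟩
          simp only [Units.val_pow_eq_pow_val, Units.val_mk0, Units.val_neg, Units.val_one, div_pow]
          rw [div_eq_iff (pow_ne_zero _ hx)]
          linear_combination h
  rw [← Nat.card_congr e, Finite.card_option, Nat.card_prod, Nat.card_units,
    card_units_pow_eq_neg_one hm, add_comm]

theorem card_sum_eq_zero {A : Type*} [AddCommGroup A] [Finite A] (n : ℕ) :
    Nat.card {y : Fin (n + 1) → A // ∑ i, y i = 0} = Nat.card A ^ n := by
  rw [show Nat.card A ^ n = Nat.card (Fin n → A) by simp [Nat.card_fun]]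
  refine Nat.card_congr
    { toFun := fun y i => y.1 i.succ
      invFun := fun z => ⟨Fin.cons (-∑ i, z i) z, by simp [Fin.sum_univ_succ]⟩
      left_inv := ?_
      right_inv := fun z => by simp }
  rintro ⟨y, hy⟩
  rw [Fin.sum_univ_succ] at hy
  refine Subtype.ext (funext fun i => ?_)
  refine Fin.cases ?_ (fun i => ?_) i
  · simp only [Fin.cons_zero]
    rw [eq_neg_of_add_eq_zero_left hy]
  · simp

variable {F : Type*} [Field F] [Finite F] {n d : ℕ}

/-- Counting the points of the hypersurface after a change of the pairs of coordinates. -/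
theorem card_hypersurfacePts_mul {A M : Type*} [AddCommMonoid M] (e : F × F ≃ A) (g : A → M)
    (f : F → M) (hf : ∀ x : Fin (n + 1) → F, ∑ i, x i = 0 ↔ ∑ i, f (x i) = 0)
    (h : ∀ x : F × F, f ((x.1 + x.2) * (x.1 ^ 2 - x.1 * x.2 + x.2 ^ 2) ^ d) = g (e x)) :
    Nat.card ↥(hypersurfacePts F n d) * (Nat.card F - 1) + 1 =
      Nat.card {y : Fin (n + 1) → A // ∑ i, g (y i) = 0} := by
  have h1 := card_zeroLocus_add_one (k := F)
    (fun x : XIdx n → F => eval x (hypersurfaceEq F n d) = 0)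
    (by rw [eval_hypersurfaceEq]; simp) fun t x => by
      rw [show t • x = fun v => (t : F) * x v from rfl, eval_smul_hypersurfaceEq, mul_eq_zero,
        or_iff_right (pow_ne_zero _ t.ne_zero)]
  refine h1.symm.trans (Nat.card_congr (Equiv.subtypeEquiv ((Equiv.curry _ _ _).trans
    (Equiv.piCongrRight fun _ => (finTwoArrowEquiv F).trans e)) fun x => ?_))
  rw [eval_hypersurfaceEq, hf]
  refine Eq.congr (Finset.sum_congr rfl fun i _ => ?_) rfl
  exact h (x (i, 0), x (i, 1))

theorem card_fin_two_arrow {A M : Type*} [AddCommMonoid M] (g : A → M) :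
    Nat.card {y : Fin (1 + 1) → A // ∑ i, g (y i) = 0} =
      Nat.card {y : A × A // g y.1 + g y.2 = 0} :=
  Nat.card_congr ((finTwoArrowEquiv A).subtypeEquiv fun y => by
    rw [Fin.sum_univ_two]; rfl)

/-- In characteristic 3 the quadratic factor is `(x_{2i} + x_{2i+1})²`, so each pair contributes
only the power `2d+1` of its sum, and the second coordinate of the pair is free. -/
theorem card_hypersurfacePts_of_three_eq_zero (h3 : (3 : F) = 0) :
    Nat.card ↥(hypersurfacePts F 1 d) = Nat.gcd (2 * d + 1) (Nat.card F - 1) * Nat.card F ^ 2 +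
      Nat.card F + 1 := by
  let e : F × F ≃ F × F :=
    { toFun := fun x => (x.1 + x.2, x.2)
      invFun := fun x => (x.1 - x.2, x.2)
      left_inv := fun x => by simp
      right_inv := fun x => by simp }
  have h := card_hypersurfacePts_mul (n := 1) (d := d) e (fun x => x.1 ^ (2 * d + 1)) id
    (fun _ => Iff.rfl) fun x => by
      change (x.1 + x.2) * _ = (x.1 + x.2) ^ (2 * d + 1)
      rw [show x.1 ^ 2 - x.1 * x.2 + x.2 ^ 2 = (x.1 + x.2) ^ 2 by
        linear_combination -x.1 * x.2 * h3, ← pow_mul]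
      ring
  rw [card_fin_two_arrow fun x : F × F => x.1 ^ (2 * d + 1)] at h
  have e' : {y : (F × F) × (F × F) // y.1.1 ^ (2 * d + 1) + y.2.1 ^ (2 * d + 1) = 0} ≃
      {p : F × F // p.1 ^ (2 * d + 1) + p.2 ^ (2 * d + 1) = 0} × (F × F) :=
    { toFun := fun y => (⟨(y.1.1.1, y.1.2.1), y.2⟩, (y.1.1.2, y.1.2.2))
      invFun := fun y => ⟨((y.1.1.1, y.2.1), (y.1.1.2, y.2.2)), y.1.2⟩
      left_inv := fun _ => rfl
      right_inv := fun _ => rfl }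
  rw [Nat.card_congr e', Nat.card_prod, Nat.card_prod,
    card_pow_add_pow_eq_zero (by omega) (Odd.neg_one_pow ⟨d, rfl⟩)] at h
  obtain ⟨q, hq⟩ : ∃ q, Nat.card F = q + 2 := ⟨_, (Nat.sub_add_cancel Finite.one_lt_card).symm⟩
  rw [hq] at h ⊢
  generalize Nat.gcd (2 * d + 1) (q + 2 - 1) = s at *
  rw [show q + 2 - 1 = q + 1 by omega] at h
  refine Nat.eq_of_mul_eq_mul_right (Nat.succ_pos q) ?_
  rw [Nat.succ_eq_add_one]
  linarith

end FiniteCounting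

theorem natCast_card_subtype {Y : Type*} [Fintype Y] (P : Y → Prop) [DecidablePred P] :
    (Nat.card {y // P y} : ℤ) = ∑ y, if P y then 1 else 0 := by
  rw [Nat.card_eq_fintype_card, Fintype.card_subtype, Finset.card_filter]
  push_cast
  rfl

theorem natCast_card_fintype (Y : Type*) [Fintype Y] : (Nat.card Y : ℤ) = ∑ _y : Y, 1 := by
  simp

theorem two_mul_sub_one_ne_zero {E : Type*} [Field E] {ω : E} (hω : ω ^ 2 - ω + 1 = 0)
    (h3 : (3 : E) ≠ 0) : 2 * ω - 1 ≠ 0 := fun h =>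
  h3 (by linear_combination -(2 * ω - 1) * h + 4 * hω)

theorem frobenius_pow_add_one {E : Type*} [Field E] [Finite E] {q : ℕ} (hE : Nat.card E = q ^ 2)
    (y : E) : (y ^ (q + 1)) ^ q = y ^ (q + 1) := by
  have := Fintype.ofFinite E
  rw [← pow_mul, add_mul, one_mul, ← pow_two, ← hE, pow_add, Nat.card_eq_fintype_card,
    FiniteField.pow_card, pow_succ, mul_comm]

/-! ### Counting when `q ≡ 2 mod 3`: reduction to a diagonal equation over `𝔽_{q²}` -/

section Inert

variable {F E : Type*} [Field F] [Finite F] [Field E] [Algebra F E] {ω : E} {n d : ℕ}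

/-- The bijection `(a, b) ↦ a - ω b` for a generator `ω` of a quadratic extension. -/
def pairEquiv [Finite E] (ω : E) (hω : ω ∉ Set.range (algebraMap F E))
    (hE : Nat.card E = Nat.card F ^ 2) : F × F ≃ E :=
  Equiv.ofBijective (fun x => algebraMap F E x.1 - ω * algebraMap F E x.2) <| by
    refine Function.Injective.bijective_of_nat_card_le ?_ (by
      rw [hE, Nat.card_prod, pow_two])
    rintro ⟨a, b⟩ ⟨a', b'⟩ h
    simp only at h
    by_cases hb : b = b'
    · subst hb
      rw [sub_left_inj] at h
      rw [(algebraMap F E).injective h]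
    · refine absurd ⟨(a - a') / (b - b'), ?_⟩ hω
      rw [map_div₀, div_eq_iff ((map_ne_zero _).2 (sub_ne_zero.2 hb)), map_sub, map_sub]
      linear_combination h

theorem frobenius_add (x y : E) :
    (x + y) ^ Nat.card F = x ^ Nat.card F + y ^ Nat.card F := by
  have := Fintype.ofFinite F
  rw [Nat.card_eq_fintype_card]
  exact map_add (FiniteField.frobeniusAlgHom F E) x y

theorem frobenius_algebraMap (a : F) : algebraMap F E a ^ Nat.card F = algebraMap F E a := by
  have := Fintype.ofFinite F
  rw [Nat.card_eq_fintype_card, ← map_pow, FiniteField.pow_card]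

theorem pow_card_eq_one_sub (hω : ω ^ 2 - ω + 1 = 0)
    (hq : Nat.card F % 6 = 5 ∨ Nat.card F % 6 = 2) : ω ^ Nat.card F = 1 - ω := by
  have h3 : ω ^ 3 = -1 := by linear_combination (ω + 1) * hω
  rcases hq with h | h
  · rw [← Nat.div_add_mod (Nat.card F) 6, h, pow_add, pow_mul, show ω ^ 6 = 1 by
      linear_combination (ω ^ 3 - 1) * h3, one_pow]
    linear_combination ω ^ 2 * h3 - hω
  · have h2 : (-1 : E) ^ Nat.card F = -1 := by
      simpa using frobenius_algebraMap (F := F) (E := E) (-1)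
    rw [Even.neg_one_pow (Nat.even_iff.2 (by omega))] at h2
    rw [← Nat.div_add_mod (Nat.card F) 6, h, pow_add, pow_mul, show ω ^ 6 = 1 by
      linear_combination (ω ^ 3 - 1) * h3, one_pow]
    linear_combination hω + (ω - 1) * h2

/-- The kernel of the trace is the `F`-line spanned by `ω - ω^q = 2ω - 1`. -/
theorem card_units_trace_eq_zero [Finite E] (hω : ω ^ 2 - ω + 1 = 0) (h3 : (3 : E) ≠ 0)
    (hq : ω ^ Nat.card F = 1 - ω) (hF : ω ∉ Set.range (algebraMap F E))
    (hE : Nat.card E = Nat.card F ^ 2) {h : E} (hh : h ≠ 0) :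
    Nat.card {t : Eˣ // t * h + (t * h) ^ Nat.card F = 0} = Nat.card F - 1 := by
  have hw := two_mul_sub_one_ne_zero hω h3
  have hwq : (2 * ω - 1) ^ Nat.card F = -(2 * ω - 1) := by
    have h1 := frobenius_add (F := F) (2 * ω - 1) 1
    rw [sub_add_cancel, mul_pow, hq, one_pow] at h1
    have h2 := frobenius_algebraMap (F := F) (E := E) 2
    rw [map_ofNat] at h2
    rw [h2] at h1
    linear_combination -h1
  rw [← Nat.card_units]
  refine (Nat.card_eq_of_bijective
    (fun a : Fˣ => (⟨Units.mk0 (algebraMap F E a * (2 * ω - 1) / h)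
      (div_ne_zero (mul_ne_zero ((map_ne_zero _).2 a.ne_zero) hw) hh), ?_⟩ :
        {t : Eˣ // t * h + (t * h) ^ Nat.card F = 0})) ⟨?_, ?_⟩).symm
  · rw [Units.val_mk0, div_mul_cancel₀ _ hh, mul_pow, hwq, frobenius_algebraMap]
    ring
  · intro a b hab
    have h1 : algebraMap F E a * (2 * ω - 1) / h = algebraMap F E b * (2 * ω - 1) / h :=
      congrArg Units.val (Subtype.ext_iff.1 hab)
    rw [div_left_inj' hh, mul_left_inj' hw] at h1
    exact Units.ext ((algebraMap F E).injective h1)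
  · rintro ⟨t, ht⟩
    obtain ⟨⟨a, b⟩, hab⟩ := (pairEquiv (F := F) ω hF hE).surjective (t * h)
    change algebraMap F E a - ω * algebraMap F E b = _ at hab
    have hsub : (algebraMap F E a - ω * algebraMap F E b) ^ Nat.card F =
        algebraMap F E a - (1 - ω) * algebraMap F E b := by
      have := frobenius_add (F := F) (algebraMap F E a - ω * algebraMap F E b)
        (ω * algebraMap F E b)
      rw [sub_add_cancel, mul_pow, hq, frobenius_algebraMap, frobenius_algebraMap] at this
      linear_combination -this
    have ht' := ht
    rw [← hab, hsub] at ht'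
    have hth : (t : E) * h = algebraMap F E (-a) * (2 * ω - 1) := by
      rw [← hab, map_neg]
      linear_combination ω * ht'
    have ha : a ≠ 0 := by
      rintro rfl
      rw [neg_zero, map_zero, zero_mul] at hth
      exact mul_ne_zero t.ne_zero hh hth
    refine ⟨Units.mk0 (-a) (neg_ne_zero.2 ha), Subtype.ext (Units.ext ?_)⟩
    simp only [Units.val_mk0]
    rw [← hth, mul_div_cancel_right₀ _ hh]

/-- For `y = a - ωb` the norm is `a² - ab + b²` and the trace of `ωy` is `a + b`, so each summand is
`Tr(ω y^m)` with `y^m = y N(y)^d`. Replacing all `y_i` by `t y_i` turns the sum into `N(t)^d Tr(t ω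
∑ y_i^m)`. For a fixed vector this vanishes for all `q² - 1` units `t` if `∑ y_i^m = 0`, and for `q
- 1` of them otherwise; averaging over `t` and cancelling `q - 1` gives the formula. -/
theorem card_hypersurfacePts_of_inert [Finite E] (hω : ω ^ 2 - ω + 1 = 0) (h3 : (3 : E) ≠ 0)
    (hq : ω ^ Nat.card F = 1 - ω) (hE : Nat.card E = Nat.card F ^ 2) :
    (Nat.card F + 1) * (Nat.card ↥(hypersurfacePts F n d) * (Nat.card F - 1) + 1) =
      Nat.card F * Nat.card {y : Fin (n + 1) → E //
        ∑ i, y i ^ (1 + d * (Nat.card F + 1)) = 0} + Nat.card F ^ (2 * n + 2) := by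
  classical
  have := Fintype.ofFinite E
  have hω0 : ω ≠ 0 := by
    rintro rfl
    simp at hω
  have hF : ω ∉ Set.range (algebraMap F E) := by
    rintro ⟨a, rfl⟩
    rw [frobenius_algebraMap] at hq
    exact two_mul_sub_one_ne_zero hω h3 (by linear_combination hq)
  set q := Nat.card F with hqdef
  set m := 1 + d * (q + 1) with hm
  have hq1 : 1 < q := Finite.one_lt_card
  let φ : E →+ E :=
    { toFun := fun z => z + z ^ q
      map_zero' := by rw [zero_pow (by omega), add_zero]
      map_add' := fun x y => by rw [hqdef, frobenius_add]; ring }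
  have hφ : ∀ z, φ z = z + z ^ q := fun _ => rfl
  have hφm : ∀ t h : E, φ (t ^ m * h) = (t ^ (q + 1)) ^ d * φ (t * h) := fun t h => by
    have h1 : ((t ^ (q + 1)) ^ d) ^ q = (t ^ (q + 1)) ^ d := by
      rw [← pow_mul, mul_comm d, pow_mul, frobenius_pow_add_one hE]
    have h2 : t ^ m = (t ^ (q + 1)) ^ d * t := by rw [hm]; ring
    rw [hφ, hφ, h2, mul_assoc, mul_pow _ (t * h), h1]
    ring
  rw [card_hypersurfacePts_mul (n := n) (d := d) (pairEquiv ω hF hE) (fun y => φ (ω * y ^ m))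
    (algebraMap F E) (fun x => by rw [← map_sum, map_eq_zero]) fun x => ?_]
  · have key := card_mul_card_eq_sum (fun t : Eˣ => MulAction.toPerm (β := Fin (n + 1) → E) t)
      (fun y => ∑ i, φ (ω * y i ^ m) = 0)
    rw [Nat.card_units, hE] at key
    have hsum : ∀ y : Fin (n + 1) → E,
        (Nat.card {t : Eˣ // ∑ i, φ (ω * (MulAction.toPerm t y) i ^ m) = 0} : ℤ) =
          ((q : ℤ) ^ 2 - q) * (if ∑ i, y i ^ m = 0 then 1 else 0) + ((q : ℤ) - 1) * 1 := by
      intro y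
      have h1 : ∀ t : Eˣ, ∑ i, φ (ω * (MulAction.toPerm t y) i ^ m) = 0 ↔
          t * (ω * ∑ i, y i ^ m) + (t * (ω * ∑ i, y i ^ m)) ^ q = 0 := fun t => by
        rw [← map_sum, ← Finset.mul_sum]
        have : ∑ i, (MulAction.toPerm t y) i ^ m = (t : E) ^ m * ∑ i, y i ^ m := by
          rw [Finset.mul_sum]
          refine Finset.sum_congr rfl fun i _ => ?_
          rw [← mul_pow]
          rfl
        rw [this, mul_left_comm, hφm, mul_eq_zero,
          or_iff_right (pow_ne_zero _ (pow_ne_zero _ t.ne_zero)), hφ]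
      simp_rw [h1]
      split_ifs with hy
      · rw [hy]
        simp only [mul_zero, zero_add, zero_pow (show q ≠ 0 by omega)]
        have : Nat.card {t : Eˣ // True} = q ^ 2 - 1 := by
          rw [Nat.card_congr (Equiv.subtypeUnivEquiv fun _ => trivial), Nat.card_units, hE]
        rw [this, Nat.cast_sub (Nat.one_le_pow _ _ (by omega))]
        push_cast
        ring
      · rw [card_units_trace_eq_zero hω h3 hq hF hE (mul_ne_zero hω0 hy),
          Nat.cast_sub hq1.le]
        push_cast
        ring
    have key' := congrArg (Nat.cast : ℕ → ℤ) key
    rw [Nat.cast_mul, Nat.cast_sum, Nat.cast_sub (Nat.one_le_pow _ _ (by omega))] at key'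
    rw [Finset.sum_congr rfl fun y _ => hsum y, Finset.sum_add_distrib, ← Finset.mul_sum,
      ← Finset.mul_sum, ← natCast_card_fintype, ← natCast_card_subtype, Nat.card_fun,
      Nat.card_fin, hE] at key'
    have hq1' : (q : ℤ) - 1 ≠ 0 := by
      have : (1 : ℤ) < q := by exact_mod_cast hq1
      omega
    zify
    refine mul_left_cancel₀ hq1' ?_
    push_cast at key'
    rw [← pow_mul, show 2 * (n + 1) = 2 * n + 2 by ring] at key'
    linear_combination key'
  · obtain ⟨a, b⟩ := x
    change _ = φ (ω * (algebraMap F E a - ω * algebraMap F E b) ^ m)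
    set y := algebraMap F E a - ω * algebraMap F E b with hy
    have hyq : y ^ q = algebraMap F E a - (1 - ω) * algebraMap F E b := by
      have := frobenius_add (F := F) y (ω * algebraMap F E b)
      rw [hy, sub_add_cancel, mul_pow, hq, frobenius_algebraMap, frobenius_algebraMap] at this
      rw [hqdef, hy]
      linear_combination -this
    rw [mul_comm ω, hφm, pow_succ y q, hφ, mul_pow y ω, hq, hyq, hy]
    simp only [map_mul, map_add, map_sub, map_pow]
    have h1 : (algebraMap F E a - (1 - ω) * algebraMap F E b) *
        (algebraMap F E a - ω * algebraMap F E b) = algebraMap F E a ^ 2 -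
          algebraMap F E a * algebraMap F E b + algebraMap F E b ^ 2 := by
      linear_combination -algebraMap F E b ^ 2 * hω
    rw [h1, mul_comm]
    congr 1
    linear_combination 2 * algebraMap F E b * hω

end Inert

/-! ### Point counts when `q ≡ 2 mod 3` -/

section InertCount

variable {F : Type*} [Field F] [Finite F] {n d : ℕ}

theorem three_ne_zero_of_card_mod (hq : Nat.card F % 3 ≠ 0) : (3 : F) ≠ 0 := by
  have := Fintype.ofFinite F
  intro h
  have h1 := FiniteField.cast_card_eq_zero F
  rw [← Nat.card_eq_fintype_card, ← Nat.div_add_mod (Nat.card F) 3] at h1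
  push_cast at h1
  rw [h, zero_mul, zero_add] at h1
  rcases (by omega : Nat.card F % 3 = 1 ∨ Nat.card F % 3 = 2) with h2 | h2
  · rw [h2, Nat.cast_one] at h1
    exact one_ne_zero h1
  · rw [h2, Nat.cast_ofNat] at h1
    exact one_ne_zero (α := F) (by linear_combination h - h1)

/-- Frobenius fixes `r` but would send a root `r` to `1 - r`, the other root. -/
theorem sq_sub_self_add_one_ne_zero (hq : Nat.card F % 6 = 5 ∨ Nat.card F % 6 = 2) (r : F) :
    r ^ 2 - r + 1 ≠ 0 := fun h => by
  have := frobenius_algebraMap (E := F) r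
  rw [Algebra.algebraMap_self_apply, pow_card_eq_one_sub h hq] at this
  exact two_mul_sub_one_ne_zero h (three_ne_zero_of_card_mod (by omega))
    (by linear_combination -this)

theorem exists_quadratic_extension (hq : Nat.card F % 6 = 5 ∨ Nat.card F % 6 = 2) :
    ∃ f : Polynomial F, ∃ _ : Fact (Irreducible f), Finite (AdjoinRoot f) ∧
      Nat.card (AdjoinRoot f) = Nat.card F ^ 2 ∧ ∃ ω : AdjoinRoot f, ω ^ 2 - ω + 1 = 0 := by
  let f : Polynomial F := Polynomial.X ^ 2 - Polynomial.X + 1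
  have hdeg : f.natDegree = 2 := by
    unfold f
    compute_degree!
  have hirr : Irreducible f :=
    Polynomial.irreducible_of_degree_le_three_of_not_isRoot (by rw [hdeg]; decide) fun r hr =>
      sq_sub_self_add_one_ne_zero hq r (by simpa [f, Polynomial.IsRoot] using hr)
  have : Fact (Irreducible f) := ⟨hirr⟩
  have hfin : Module.Finite F (AdjoinRoot f) := (AdjoinRoot.powerBasis hirr.ne_zero).finite
  refine ⟨f, ⟨hirr⟩, Module.finite_of_finite F, ?_, AdjoinRoot.root f, ?_⟩
  · rw [Module.natCard_eq_pow_finrank (K := F), (AdjoinRoot.powerBasis hirr.ne_zero).finrank,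
      AdjoinRoot.powerBasis_dim, hdeg]
  · have := AdjoinRoot.eval₂_root f
    simpa [f] using this

/-- The exponent is prime to `q + 1`, and it is congruent to `2d + 1` modulo `q - 1`. -/
theorem gcd_exponent {q : ℕ} (hq : 1 ≤ q) :
    Nat.gcd (1 + d * (q + 1)) (q ^ 2 - 1) = Nat.gcd (2 * d + 1) (q - 1) := by
  rw [show q ^ 2 - 1 = (q - 1) * (q + 1) by rw [mul_comm, ← Nat.sq_sub_sq, one_pow],
    Nat.Coprime.gcd_mul_right_cancel_right _ (by simp)]
  obtain ⟨r, rfl⟩ := Nat.exists_eq_add_of_le' hq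
  rw [Nat.add_sub_cancel, show 1 + d * (r + 1 + 1) = 2 * d + 1 + d * r by ring,
    Nat.gcd_add_mul_right_left]

/-- Here `y ↦ y^m` permutes `𝔽_{q²}`, so the diagonal equation has as many solutions as the
hyperplane `∑ y_i = 0`. -/
theorem card_hypersurfacePts_of_gcd_eq_one (hq : Nat.card F % 6 = 5 ∨ Nat.card F % 6 = 2)
    (hd : Nat.gcd (2 * d + 1) (Nat.card F - 1) = 1) :
    Nat.card ↥(hypersurfacePts F n d) * (Nat.card F - 1) + 1 = Nat.card F ^ (2 * n + 1) := by
  obtain ⟨f, hf, hfin, hE, ω, hω⟩ := exists_quadratic_extension hq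
  have h3 : (3 : AdjoinRoot f) ≠ 0 := by
    rw [← map_ofNat (algebraMap F (AdjoinRoot f)), map_ne_zero]
    exact three_ne_zero_of_card_mod (by omega)
  have key := card_hypersurfacePts_of_inert (n := n) (d := d) hω h3
    (pow_card_eq_one_sub hω hq) hE
  have hq1 : 1 < Nat.card F := Finite.one_lt_card
  set m := 1 + d * (Nat.card F + 1) with hm
  have hcop : (Nat.card (AdjoinRoot f)ˣ).Coprime m := by
    rw [Nat.card_units, hE, Nat.coprime_comm]
    exact (gcd_exponent hq1.le).trans hd
  have hm0 : m ≠ 0 := by omega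
  have hinj : Function.Injective fun x : AdjoinRoot f => x ^ m := by
    intro x y h
    simp only at h
    by_cases hx : x = 0
    · rw [hx, zero_pow hm0, eq_comm, pow_eq_zero_iff hm0] at h
      rw [hx, h]
    · have hy : y ≠ 0 := by
        rintro rfl
        rw [zero_pow hm0, pow_eq_zero_iff hm0] at h
        exact hx h
      exact congrArg Units.val ((powCoprime hcop).injective
        (a₁ := Units.mk0 x hx) (a₂ := Units.mk0 y hy) (Units.ext h))
  have e : {y : Fin (n + 1) → AdjoinRoot f // ∑ i, y i ^ m = 0} ≃
      {y : Fin (n + 1) → AdjoinRoot f // ∑ i, y i = 0} :=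
    (Equiv.piCongrRight fun _ =>
      Equiv.ofBijective _ (Finite.injective_iff_bijective.1 hinj)).subtypeEquiv fun y => Iff.rfl
  rw [Nat.card_congr e, card_sum_eq_zero, hE] at key
  refine Nat.eq_of_mul_eq_mul_left (Nat.succ_pos (Nat.card F)) (key.trans ?_)
  rw [Nat.succ_eq_add_one]
  ring

theorem card_hypersurfacePts_one_of_inert (hq : Nat.card F % 6 = 5 ∨ Nat.card F % 6 = 2) :
    Nat.card ↥(hypersurfacePts F 1 d) =
      Nat.card F ^ 2 + Nat.gcd (2 * d + 1) (Nat.card F - 1) * Nat.card F + 1 := by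
  obtain ⟨f, hf, hfin, hE, ω, hω⟩ := exists_quadratic_extension hq
  have h3 : (3 : AdjoinRoot f) ≠ 0 := by
    rw [← map_ofNat (algebraMap F (AdjoinRoot f)), map_ne_zero]
    exact three_ne_zero_of_card_mod (by omega)
  have key := card_hypersurfacePts_of_inert (n := 1) (d := d) hω h3
    (pow_card_eq_one_sub hω hq) hE
  have hq1 : 1 < Nat.card F := Finite.one_lt_card
  have hneg : (-1 : AdjoinRoot f) ^ (1 + d * (Nat.card F + 1)) = -1 := by
    have := frobenius_algebraMap (F := F) (E := AdjoinRoot f) (-1)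
    rw [map_neg, map_one] at this
    rw [pow_add, mul_comm d, pow_mul, pow_succ _ (Nat.card F), this]
    simp
  rw [card_fin_two_arrow fun x : AdjoinRoot f => x ^ (1 + d * (Nat.card F + 1)),
    card_pow_add_pow_eq_zero (by omega) hneg, hE, gcd_exponent hq1.le] at key
  generalize Nat.gcd (2 * d + 1) (Nat.card F - 1) = s at *
  generalize Nat.card ↥(hypersurfacePts F 1 d) = N at *
  obtain ⟨r, hr⟩ : ∃ r, Nat.card F = r + 2 := ⟨_, (Nat.sub_add_cancel hq1).symm⟩
  rw [hr, show (r + 2) ^ 2 - 1 = (r + 1) * (r + 3) by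
    rw [Nat.sub_eq_iff_eq_add (Nat.one_le_pow _ _ (by omega))]; ring,
    show r + 2 - 1 = r + 1 by omega] at key
  rw [hr]
  refine Nat.eq_of_mul_eq_mul_left (show 0 < (r + 3) * (r + 1) by positivity) ?_
  zify at key ⊢
  linear_combination key

end InertCount

/-! ### Counting when `q ≡ 1 mod 3` -/

section SplitCount

variable {F : Type*} [Field F] {d : ℕ}

theorem exists_root_of_card_mod [Finite F] (hq : Nat.card F % 3 = 1) : ∃ ω : F, ω ^ 2 - ω + 1 = 0 := by
  have := Fintype.ofFinite F
  have : Fact (Nat.Prime 3) := ⟨Nat.prime_three⟩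
  have hdvd : 3 ∣ Nat.card Fˣ := by
    rw [Nat.card_units]
    exact (Nat.modEq_iff_dvd' Finite.one_lt_card.le).1 hq.symm
  obtain ⟨ζ, hζ⟩ := exists_prime_orderOf_dvd_card' 3 hdvd
  have h3 : (ζ : F) ^ 3 = 1 := by
    rw [← Units.val_pow_eq_pow_val, ← hζ, pow_orderOf_eq_one, Units.val_one]
  have h1 : (ζ : F) - 1 ≠ 0 := fun h => by
    have : ζ = 1 := Units.ext (sub_eq_zero.1 h)
    rw [this, orderOf_one] at hζ
    omega
  exact ⟨-ζ, mul_left_cancel₀ h1 (by linear_combination h3)⟩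

theorem card_mul_eq_zero [Finite F] : Nat.card {w : F × F // w.1 * w.2 = 0} = 2 * Nat.card F - 1 := by
  have e : {w : F × F // ¬ w.1 * w.2 = 0} ≃ Fˣ × Fˣ :=
    { toFun := fun w => (Units.mk0 w.1.1 (left_ne_zero_of_mul w.2),
        Units.mk0 w.1.2 (right_ne_zero_of_mul w.2))
      invFun := fun t => ⟨(t.1, t.2), mul_ne_zero t.1.ne_zero t.2.ne_zero⟩
      left_inv := fun _ => rfl
      right_inv := fun _ => Prod.ext (Units.ext rfl) (Units.ext rfl) }
  classical
  have h := Nat.card_congr (Equiv.sumCompl fun w : F × F => w.1 * w.2 = 0)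
  rw [Nat.card_sum, Nat.card_congr e, Nat.card_prod, Nat.card_prod, Nat.card_units] at h
  obtain ⟨r, hr⟩ := Nat.exists_eq_add_of_le' (Finite.one_lt_card (α := F)).le
  rw [hr] at h ⊢
  rw [Nat.add_sub_cancel] at h
  have : 2 * (r + 1) - 1 = 2 * r + 1 := by omega
  rw [this]
  linarith

/-- Counting pairs of pairs by the vanishing of the products, and otherwise by ratios. -/
theorem card_pairs_eq [Finite F] {C : (F × F) × (F × F) → Prop} {R : Fˣ × Fˣ → Prop}
    (h0 : ∀ w w' : F × F, w.1 * w.2 = 0 → (C (w, w') ↔ w'.1 * w'.2 = 0))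
    (h1 : ∀ w w' : F × F, w.1 * w.2 ≠ 0 → C (w, w') → w'.1 * w'.2 ≠ 0)
    (h2 : ∀ t r : Fˣ × Fˣ, C ((↑t.1, ↑t.2), (t.1 * r.1, t.2 * r.2)) ↔ R r) :
    Nat.card {y // C y} =
      (2 * Nat.card F - 1) ^ 2 + (Nat.card F - 1) ^ 2 * Nat.card {r // R r} := by
  let Z := {w : F × F // w.1 * w.2 = 0}
  have e : (Z × Z) ⊕ ((Fˣ × Fˣ) × {r // R r}) ≃ {y // C y} :=
    Equiv.ofBijective (Sum.elim
      (fun z => ⟨(z.1.1, z.2.1), (h0 _ _ z.1.2).2 z.2.2⟩)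
      (fun p => ⟨((↑p.1.1, ↑p.1.2), (p.1.1 * p.2.1.1, p.1.2 * p.2.1.2)), (h2 _ _).2 p.2.2⟩)) <| by
      constructor
      · rintro (⟨⟨w, hw⟩, ⟨w', hw'⟩⟩ | ⟨⟨t, t'⟩, ⟨⟨r, r'⟩, hr⟩⟩)
          (⟨⟨z, hz⟩, ⟨z', hz'⟩⟩ | ⟨⟨s, s'⟩, ⟨⟨u, u'⟩, hu⟩⟩) h
        · obtain ⟨h, h'⟩ := Prod.ext_iff.1 (Subtype.ext_iff.1 h)
          simp only [Sum.elim_inl] at h h'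
          subst h h'
          rfl
        · obtain ⟨h, h'⟩ := Prod.ext_iff.1 (Subtype.ext_iff.1 h)
          simp only [Sum.elim_inl, Sum.elim_inr] at h h'
          subst h
          exact absurd hw (mul_ne_zero s.ne_zero s'.ne_zero)
        · obtain ⟨h, h'⟩ := Prod.ext_iff.1 (Subtype.ext_iff.1 h)
          simp only [Sum.elim_inl, Sum.elim_inr] at h h'
          subst h
          exact absurd hz (mul_ne_zero t.ne_zero t'.ne_zero)
        · obtain ⟨h, h'⟩ := Prod.ext_iff.1 (Subtype.ext_iff.1 h)
          simp only [Sum.elim_inr, Prod.mk.injEq] at h h'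
          obtain rfl := Units.ext h.1
          obtain rfl := Units.ext h.2
          obtain rfl := Units.ext (mul_left_cancel₀ t.ne_zero h'.1)
          obtain rfl := Units.ext (mul_left_cancel₀ t'.ne_zero h'.2)
          rfl
      · rintro ⟨⟨w, w'⟩, hC⟩
        by_cases hw : w.1 * w.2 = 0
        · exact ⟨.inl (⟨w, hw⟩, ⟨w', (h0 _ _ hw).1 hC⟩), rfl⟩
        · have hw' := h1 _ _ hw hC
          obtain ⟨a, b⟩ := w
          obtain ⟨a', b'⟩ := w'
          have ha := left_ne_zero_of_mul hw
          have hb := right_ne_zero_of_mul hw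
          have ha' := left_ne_zero_of_mul hw'
          have hb' := right_ne_zero_of_mul hw'
          have key : ((a, b), (a', b')) =
              ((a, b), ((a * (a' / a), b * (b' / b)) : F × F)) := by
            rw [mul_div_cancel₀ _ ha, mul_div_cancel₀ _ hb]
          rw [key] at hC
          exact ⟨.inr ((Units.mk0 a ha, Units.mk0 b hb),
            ⟨(Units.mk0 _ (div_ne_zero ha' ha), Units.mk0 _ (div_ne_zero hb' hb)),
              (h2 (Units.mk0 a ha, Units.mk0 b hb) _).1 hC⟩), Subtype.ext key.symm⟩
  rw [← Nat.card_congr e, Nat.card_sum, Nat.card_prod, Nat.card_prod, Nat.card_prod,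
    card_mul_eq_zero, Nat.card_units, pow_two, pow_two]

/-- The form `u₀ (u₀ v₀)^d + u₁ (u₁ v₁)^d`. -/
def pairP (d : ℕ) (y : (F × F) × (F × F)) : F :=
  y.1.1 * (y.1.1 * y.1.2) ^ d + y.2.1 * (y.2.1 * y.2.2) ^ d

/-- The form `v₀ (u₀ v₀)^d + v₁ (u₁ v₁)^d`. -/
def pairQ (d : ℕ) (y : (F × F) × (F × F)) : F :=
  y.1.2 * (y.1.1 * y.1.2) ^ d + y.2.2 * (y.2.1 * y.2.2) ^ d

theorem pairP_eq_zero_iff (hd : 1 ≤ d) (w w' : F × F) (hw : w.1 * w.2 = 0) :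
    pairP d (w, w') = 0 ↔ w'.1 * w'.2 = 0 := by
  simp only [pairP, hw, zero_pow (show d ≠ 0 by omega), mul_zero, zero_add, mul_eq_zero,
    pow_eq_zero_iff (show d ≠ 0 by omega)]
  tauto

theorem pairQ_eq_zero_iff (hd : 1 ≤ d) (w w' : F × F) (hw : w.1 * w.2 = 0) :
    pairQ d (w, w') = 0 ↔ w'.1 * w'.2 = 0 := by
  simp only [pairQ, hw, zero_pow (show d ≠ 0 by omega), mul_zero, zero_add, mul_eq_zero,
    pow_eq_zero_iff (show d ≠ 0 by omega)]
  tauto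

theorem mul_ne_zero_of_pairP (hd : 1 ≤ d) (w w' : F × F) (hw : w.1 * w.2 ≠ 0)
    (h : pairP d (w, w') = 0) : w'.1 * w'.2 ≠ 0 := fun h' => by
  simp only [pairP, h', zero_pow (show d ≠ 0 by omega), mul_zero, add_zero] at h
  exact mul_ne_zero (left_ne_zero_of_mul hw) (pow_ne_zero d hw) h

theorem pairP_units (t r : Fˣ × Fˣ) :
    pairP d (((t.1 : F), (t.2 : F)), (t.1 * r.1, t.2 * r.2)) = 0 ↔ r.1 * (r.1 * r.2) ^ d = -1 := by
  rw [show pairP d (((t.1 : F), (t.2 : F)), (t.1 * r.1, t.2 * r.2)) =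
    (t.1 * (t.1 * t.2) ^ d : Fˣ) * ((r.1 * (r.1 * r.2) ^ d : Fˣ) + 1 : F) by
      simp only [pairP]; push_cast; ring]
  rw [Units.mul_right_eq_zero, Units.ext_iff, add_eq_zero_iff_eq_neg, Units.val_neg, Units.val_one]

theorem pairQ_units (t r : Fˣ × Fˣ) :
    pairQ d (((t.1 : F), (t.2 : F)), (t.1 * r.1, t.2 * r.2)) = 0 ↔ r.2 * (r.1 * r.2) ^ d = -1 := by
  rw [show pairQ d (((t.1 : F), (t.2 : F)), (t.1 * r.1, t.2 * r.2)) =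
    (t.2 * (t.1 * t.2) ^ d : Fˣ) * ((r.2 * (r.1 * r.2) ^ d : Fˣ) + 1 : F) by
      simp only [pairQ]; push_cast; ring]
  rw [Units.mul_right_eq_zero, Units.ext_iff, add_eq_zero_iff_eq_neg, Units.val_neg, Units.val_one]

theorem card_pairP_eq_zero [Finite F] (hd : 1 ≤ d) : Nat.card {y : (F × F) × (F × F) // pairP d y = 0} =
    (2 * Nat.card F - 1) ^ 2 + (Nat.card F - 1) ^ 2 * (Nat.card F - 1) := by
  rw [card_pairs_eq (pairP_eq_zero_iff hd) (mul_ne_zero_of_pairP hd) pairP_units]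
  congr 2
  rw [← Nat.card_units]
  -- A solution is determined by the product of its two entries, which may be any unit.
  exact Nat.card_congr
    { toFun := fun p => p.1.1 * p.1.2
      invFun := fun r => ⟨(-(r ^ d)⁻¹, -(r * r ^ d)), by simp⟩
      left_inv := fun p => by
        obtain ⟨⟨a, b⟩, h⟩ := p
        simp only at h
        have ha : -((a * b) ^ d)⁻¹ = a := by
          rw [← neg_one_mul]
          exact (eq_mul_inv_of_mul_eq h).symm
        refine Subtype.ext (Prod.ext ha ?_)
        change -(a * b * (a * b) ^ d) = b
        rw [show a * b * (a * b) ^ d = b * (a * (a * b) ^ d) by ac_rfl, h]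
        simp
      right_inv := fun r => by simp }

theorem card_pairQ_eq_zero [Finite F] (hd : 1 ≤ d) : Nat.card {y : (F × F) × (F × F) // pairQ d y = 0} =
    (2 * Nat.card F - 1) ^ 2 + (Nat.card F - 1) ^ 2 * (Nat.card F - 1) := by
  rw [← card_pairP_eq_zero hd]
  refine Nat.card_congr (((Equiv.prodComm F F).prodCongr (Equiv.prodComm F F)).subtypeEquiv ?_)
  rintro ⟨⟨a, b⟩, ⟨a', b'⟩⟩
  simp [pairP, pairQ, mul_comm]

/-- Dividing the two equations on ratios forces the ratios to agree, leaving `a^{2d+1} = -1`. -/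
theorem card_pairP_pairQ_eq_zero [Finite F] (hd : 1 ≤ d) :
    Nat.card {y : (F × F) × (F × F) // pairP d y = 0 ∧ pairQ d y = 0} =
    (2 * Nat.card F - 1) ^ 2 + (Nat.card F - 1) ^ 2 * Nat.gcd (2 * d + 1) (Nat.card F - 1) := by
  rw [card_pairs_eq (C := fun y => pairP d y = 0 ∧ pairQ d y = 0)
    (fun w w' h => by rw [pairP_eq_zero_iff hd w w' h, pairQ_eq_zero_iff hd w w' h, and_self])
    (fun w w' h h' => mul_ne_zero_of_pairP hd w w' h h'.1)
    (fun t r => and_congr (pairP_units t r) (pairQ_units t r)),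
    ← card_units_pow_eq_neg_one (k := F) (Odd.neg_one_pow ⟨d, rfl⟩)]
  have mul_pow_two_eq : ∀ a : Fˣ, a * (a * a) ^ d = a ^ (2 * d + 1) := fun a => by
    rw [← pow_two, ← pow_mul, ← pow_succ']
  congr 2
  exact Nat.card_congr
    { toFun := fun p => ⟨p.1.1, by
        obtain ⟨⟨a, b⟩, h, h'⟩ := p
        have hab : a = b := mul_right_cancel (h.trans h'.symm)
        subst hab
        exact (mul_pow_two_eq a).symm.trans h⟩
      invFun := fun a => ⟨(a.1, a.1), (mul_pow_two_eq a.1).trans a.2, (mul_pow_two_eq a.1).trans a.2⟩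
      left_inv := fun p => by
        obtain ⟨⟨a, b⟩, h, h'⟩ := p
        have hab : a = b := mul_right_cancel (h.trans h'.symm)
        subst hab
        rfl
      right_inv := fun _ => rfl }

theorem card_units_linear_eq_zero {a b : F} (ha : a ≠ 0) (hb : b ≠ 0) :
    Nat.card {t : Fˣ × Fˣ // t.1 * a + t.2 * b = 0} = Nat.card F - 1 := by
  rw [← Nat.card_units]
  exact Nat.card_congr
    { toFun := fun t => t.1.1
      invFun := fun t => ⟨(t, -(t * Units.mk0 a ha / Units.mk0 b hb)), by
        push_cast
        rw [Units.val_mk0, Units.val_mk0]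
        field_simp
        ring⟩
      left_inv := fun t => by
        obtain ⟨⟨x, y⟩, h⟩ := t
        refine Subtype.ext (Prod.ext rfl (Units.ext ?_))
        push_cast
        rw [Units.val_mk0, Units.val_mk0, neg_eq_iff_eq_neg, div_eq_iff hb]
        linear_combination h
      right_inv := fun _ => rfl }

/-- In the coordinates `u = a - ωb`, `v = a - (1 - ω)b` the summand is `(ωu + (1 - ω)v)(uv)^d`.
Scaling all `u` by `t_1` and all `v` by `t_2` turns the equation into `t_1 ω P + t_2 (1 - ω) Q = 0`.
This holds for all `(q-1)²` pairs if `P = Q = 0`, for none if exactly one of `P`, `Q` vanishes, and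
for `q - 1` pairs otherwise. Averaging over the torus leaves the three counts just obtained. -/
theorem card_hypersurfacePts_of_split [Finite F] (hd : 1 ≤ d) (hq : Nat.card F % 3 = 1) :
    Nat.card ↥(hypersurfacePts F 1 d) =
      Nat.card F ^ 2 + (4 + Nat.gcd (2 * d + 1) (Nat.card F - 1)) * Nat.card F + 1 := by
  classical
  have := Fintype.ofFinite F
  obtain ⟨ω, hω⟩ := exists_root_of_card_mod hq
  have h3 : (3 : F) ≠ 0 := three_ne_zero_of_card_mod (by omega)
  have hw := two_mul_sub_one_ne_zero hω h3
  have hω0 : ω ≠ 0 := by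
    rintro rfl
    simp at hω
  have hω1 : 1 - ω ≠ 0 := fun h => hω0 (pow_eq_zero_iff two_ne_zero |>.1
    (by linear_combination hω - h))
  have hinj : Function.Injective fun x : F × F => (x.1 - ω * x.2, x.1 - (1 - ω) * x.2) := by
    rintro ⟨a, b⟩ ⟨a', b'⟩ h
    obtain ⟨h1, h2⟩ := Prod.ext_iff.1 h
    simp only at h1 h2
    have hb : b = b' := mul_left_cancel₀ hw (by linear_combination h2 - h1)
    subst hb
    rw [sub_left_inj.1 h1]
  have hq1 : 1 < Nat.card F := Finite.one_lt_card
  have hN := card_hypersurfacePts_mul (n := 1) (d := d)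
    (Equiv.ofBijective _ (Finite.injective_iff_bijective.1 hinj))
    (fun y : F × F => (ω * y.1 + (1 - ω) * y.2) * (y.1 * y.2) ^ d) id (fun _ => Iff.rfl)
    fun x => by
      obtain ⟨a, b⟩ := x
      change (a + b) * (a ^ 2 - a * b + b ^ 2) ^ d =
        (ω * (a - ω * b) + (1 - ω) * (a - (1 - ω) * b)) * ((a - ω * b) * (a - (1 - ω) * b)) ^ d
      congr 1
      · linear_combination 2 * b * hω
      · congr 1
        linear_combination b ^ 2 * hω
  rw [card_fin_two_arrow fun y : F × F => (ω * y.1 + (1 - ω) * y.2) * (y.1 * y.2) ^ d] at hN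
  let σ : Fˣ × Fˣ → Equiv.Perm ((F × F) × (F × F)) := fun t =>
    let s := (MulAction.toPerm (β := F) t.1).prodCongr (MulAction.toPerm (β := F) t.2)
    s.prodCongr s
  have key := card_mul_card_eq_sum σ
    fun y => (ω * y.1.1 + (1 - ω) * y.1.2) * (y.1.1 * y.1.2) ^ d +
      (ω * y.2.1 + (1 - ω) * y.2.2) * (y.2.1 * y.2.2) ^ d = 0
  have hsum : ∀ y : (F × F) × (F × F), (Nat.card {t : Fˣ × Fˣ //
      (ω * (σ t y).1.1 + (1 - ω) * (σ t y).1.2) * ((σ t y).1.1 * (σ t y).1.2) ^ d +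
      (ω * (σ t y).2.1 + (1 - ω) * (σ t y).2.2) * ((σ t y).2.1 * (σ t y).2.2) ^ d = 0} : ℤ) =
      ((Nat.card F : ℤ) - 1) ^ 2 * (if pairP d y = 0 ∧ pairQ d y = 0 then 1 else 0) +
      ((Nat.card F : ℤ) - 1) * (1 - (if pairP d y = 0 then 1 else 0) -
        (if pairQ d y = 0 then 1 else 0) + (if pairP d y = 0 ∧ pairQ d y = 0 then 1 else 0)) := by
    intro y
    have h1 : ∀ t : Fˣ × Fˣ,
        (ω * (σ t y).1.1 + (1 - ω) * (σ t y).1.2) * ((σ t y).1.1 * (σ t y).1.2) ^ d +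
          (ω * (σ t y).2.1 + (1 - ω) * (σ t y).2.2) * ((σ t y).2.1 * (σ t y).2.2) ^ d = 0 ↔
        t.1 * (ω * pairP d y) + t.2 * ((1 - ω) * pairQ d y) = 0 := fun t => by
      have : (ω * (σ t y).1.1 + (1 - ω) * (σ t y).1.2) * ((σ t y).1.1 * (σ t y).1.2) ^ d +
          (ω * (σ t y).2.1 + (1 - ω) * (σ t y).2.2) * ((σ t y).2.1 * (σ t y).2.2) ^ d =
          ((t.1 * t.2) ^ d : Fˣ) * (t.1 * (ω * pairP d y) + t.2 * ((1 - ω) * pairQ d y)) := by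
        change (ω * (t.1 * y.1.1) + (1 - ω) * (t.2 * y.1.2)) *
          ((t.1 * y.1.1) * (t.2 * y.1.2)) ^ d + (ω * (t.1 * y.2.1) + (1 - ω) * (t.2 * y.2.2)) *
          ((t.1 * y.2.1) * (t.2 * y.2.2)) ^ d = _
        rw [show (t.1 : F) * y.1.1 * (t.2 * y.1.2) = t.1 * t.2 * (y.1.1 * y.1.2) by ring,
          show (t.1 : F) * y.2.1 * (t.2 * y.2.2) = t.1 * t.2 * (y.2.1 * y.2.2) by ring,
          mul_pow, mul_pow]
        push_cast
        simp only [pairP, pairQ]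
        ring
      rw [this, Units.mul_right_eq_zero]
    simp_rw [h1]
    by_cases hP : pairP d y = 0 <;> by_cases hQ : pairQ d y = 0
    · simp only [hP, hQ, mul_zero, add_zero, and_self, if_true]
      rw [Nat.card_congr (Equiv.subtypeUnivEquiv fun _ => trivial), Nat.card_prod, Nat.card_units,
        Nat.cast_mul, Nat.cast_sub hq1.le]
      push_cast
      ring
    · have : IsEmpty {t : Fˣ × Fˣ // (t.1 : F) * (ω * pairP d y) +
          t.2 * ((1 - ω) * pairQ d y) = 0} := ⟨by
        rintro ⟨t, this⟩
        rw [hP, mul_zero, mul_zero, zero_add] at this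
        exact mul_ne_zero t.2.ne_zero (mul_ne_zero hω1 hQ) this⟩
      rw [Nat.card_of_isEmpty]
      simp [hP, hQ]
    · have : IsEmpty {t : Fˣ × Fˣ // (t.1 : F) * (ω * pairP d y) +
          t.2 * ((1 - ω) * pairQ d y) = 0} := ⟨by
        rintro ⟨t, this⟩
        rw [hQ, mul_zero, mul_zero, add_zero] at this
        exact mul_ne_zero t.1.ne_zero (mul_ne_zero hω0 hP) this⟩
      rw [Nat.card_of_isEmpty]
      simp [hP, hQ]
    · rw [card_units_linear_eq_zero (mul_ne_zero hω0 hP) (mul_ne_zero hω1 hQ),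
        Nat.cast_sub hq1.le]
      simp [hP, hQ]
  have key' := congrArg (Nat.cast : ℕ → ℤ) key
  rw [Nat.cast_sum, Finset.sum_congr rfl fun y _ => hsum y, Finset.sum_add_distrib,
    ← Finset.mul_sum, ← Finset.mul_sum, Finset.sum_add_distrib, Finset.sum_sub_distrib,
    Finset.sum_sub_distrib, ← natCast_card_fintype, ← natCast_card_subtype,
    ← natCast_card_subtype, ← natCast_card_subtype, card_pairP_eq_zero hd, card_pairQ_eq_zero hd,
    card_pairP_pairQ_eq_zero hd, Nat.cast_mul, Nat.card_prod, Nat.card_units, Nat.card_prod,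
    Nat.card_prod, ← hN] at key'
  generalize Nat.gcd (2 * d + 1) (Nat.card F - 1) = s at *
  generalize Nat.card ↥(hypersurfacePts F 1 d) = N at *
  obtain ⟨r, hr⟩ : ∃ r, Nat.card F = r + 2 := ⟨_, (Nat.sub_add_cancel hq1).symm⟩
  rw [hr, show r + 2 - 1 = r + 1 by omega, show 2 * (r + 2) - 1 = 2 * r + 3 by omega]
    at key'
  rw [hr]
  zify
  have hr0 : ((r : ℤ) + 1) ^ 3 ≠ 0 := by positivity
  refine mul_left_cancel₀ hr0 ?_
  push_cast at key'
  linear_combination key'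

end SplitCount

/-! ### Rational Cox coordinates when `ξ` is rational -/

section SplitPoints

/-- The Cox coordinates with prescribed blocks. -/
def coxVec {R : Type*} {n : ℕ} (a b : Fin (n + 1) → R) (c : Fin 2 → R) : CoxVar n → R
  | .ev i => a i
  | .od i => b i
  | .wp => c 0
  | .wm => c 1

variable {k Ω : Type*} [Field k] [Field Ω] [Algebra k Ω] {n d : ℕ} {ξ : Ω}

theorem coord_toricT_of_scaling {x y : CoxVar n → Ω} {p : (toricT n).Pt Ω}
    (hx : (toricT n).Coord x p) {r s a b : Ω} (ha : a ≠ 0) (hb : b ≠ 0) (hr : r ≠ 0) (hs : s ≠ 0)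
    (h : r * a = s * b) (h1 : ∀ i, y (.ev i) = r * x (.ev i)) (h2 : ∀ i, y (.od i) = s * x (.od i))
    (h3 : y .wp = a * x .wp) (h4 : y .wm = b * x .wm) : (toricT n).Coord y p := by
  obtain ⟨⟨i, hi⟩, ⟨j, hj⟩, hw⟩ := stable_toricT.1 hx.stable
  have hy : (toricT n).Stable y := stable_toricT.2
    ⟨⟨i, h1 i ▸ mul_ne_zero hr hi⟩, ⟨j, h2 j ▸ mul_ne_zero hs hj⟩,
      hw.imp (fun h => h3 ▸ mul_ne_zero ha h) fun h => h4 ▸ mul_ne_zero hb h⟩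
  obtain ⟨q, hq⟩ := hy.exists_point
  rwa [(coord_eq_iff_toricT hx hq).2 ⟨r, s, a, b, ha, hb, hr, hs, h, h1, h2, h3, h4⟩]

theorem exists_rep_of_scaling [IsGalois k Ω] {ι : Type} {x : ι → Ω} (hx : ∃ i, x i ≠ 0)
    (h : ∀ τ : Ω ≃ₐ[k] Ω, ∃ t : Ω, t ≠ 0 ∧ ∀ i, τ (x i) = t * x i) :
    ∃ (P : ℙ k (ι → k)) (t : Ω), t ≠ 0 ∧ ∀ i, x i = t * algebraMap k Ω (P.rep i) := by
  obtain ⟨r, hr⟩ := (stable_projCox.2 hx).exists_point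
  obtain ⟨P, hP⟩ := exists_rep_of_gal_eq (k := k) (ξ := (0 : Ω)) (r := r) fun τ => by
    obtain ⟨t, ht, ht'⟩ := h τ
    exact ((coord_eq_iff_projCox hr (coord_gal_projCox hr 0 τ)).2 ⟨t, ht, ht'⟩).symm
  obtain ⟨t, ht, ht'⟩ := (coord_eq_iff_projCox hP hr).1 rfl
  exact ⟨P, t, ht, ht'⟩

theorem Projectivization.eq_of_algebraMap_rep {ι : Type} {P Q : ℙ k (ι → k)} {t : Ω} (ht : t ≠ 0)
    (h : ∀ i, algebraMap k Ω (Q.rep i) = t * algebraMap k Ω (P.rep i)) : P = Q := by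
  obtain ⟨r, hr⟩ := coord_algebraMap_rep (Ω := Ω) P
  obtain ⟨s, hs⟩ := coord_algebraMap_rep (Ω := Ω) Q
  obtain rfl := (coord_eq_iff_projCox hr hs).2 ⟨t, ht, h⟩
  exact rep_eq_of_coord hr hs

theorem eval_coxF_algebraMap (x : k) (z : CoxVar n → k) :
    eval (fun v => algebraMap k Ω (z v)) (coxF (algebraMap k Ω x) n d) =
      algebraMap k Ω (eval z (coxF x n d)) := by
  simp only [eval_coxF, map_sum, map_mul, map_pow, map_sub, map_add, map_ofNat]

theorem stable_coxVec_rep (p : ℙ k (Fin (n + 1) → k) × ℙ k (Fin (n + 1) → k) × ℙ k (Fin 2 → k)) :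
    (toricT n).Stable (fun v : CoxVar n =>
      algebraMap k Ω (coxVec p.1.rep p.2.1.rep p.2.2.rep v)) := by
  obtain ⟨i, hi⟩ := Function.ne_iff.1 p.1.rep_nonzero
  obtain ⟨j, hj⟩ := Function.ne_iff.1 p.2.1.rep_nonzero
  obtain ⟨l, hl⟩ := Function.ne_iff.1 p.2.2.rep_nonzero
  refine stable_toricT.2 ⟨⟨i, (map_ne_zero _).2 hi⟩, ⟨j, (map_ne_zero _).2 hj⟩, ?_⟩
  fin_cases l
  · exact .inl ((map_ne_zero _).2 hl)
  · exact .inr ((map_ne_zero _).2 hl)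

/-- When `ξ` is rational, rational points have rational Cox coordinates. -/
theorem card_Xtilde_of_mem_range [IsGalois k Ω] (x : k) :
    Nat.card ↥(Xtilde (algebraMap k Ω x) n d ∩ (toricT n).rationalPts k (algebraMap k Ω x)) =
      Nat.card {p : ℙ k (Fin (n + 1) → k) × ℙ k (Fin (n + 1) → k) × ℙ k (Fin 2 → k) //
        eval (coxVec p.1.rep p.2.1.rep p.2.2.rep) (coxF x n d) = 0} := by
  have hperm : ∀ (τ : Ω ≃ₐ[k] Ω) (v : CoxVar n),
      (toricT n).perm (algebraMap k Ω x) τ v = v := fun τ v =>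
    perm_toricT_of_eq (τ.commutes x) v
  choose f hf using fun p : ℙ k (Fin (n + 1) → k) × ℙ k (Fin (n + 1) → k) × ℙ k (Fin 2 → k) =>
    (stable_coxVec_rep (Ω := Ω) p).exists_point
  have hfc : ∀ p, (toricT n).Coord (fun v : CoxVar n =>
      algebraMap k Ω (coxVec p.1.rep p.2.1.rep p.2.2.rep v)) (f p) := hf
  refine (Nat.card_eq_of_bijective (fun p : {p : ℙ k (Fin (n + 1) → k) × ℙ k (Fin (n + 1) → k) ×
    ℙ k (Fin 2 → k) // eval (coxVec p.1.rep p.2.1.rep p.2.2.rep) (coxF x n d) = 0} =>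
    (⟨f p.1, ?_, fun τ => ?_⟩ : ↥(Xtilde (algebraMap k Ω x) n d ∩
      (toricT n).rationalPts k (algebraMap k Ω x)))) ⟨?_, ?_⟩).symm
  · rw [mem_Xtilde_iff (hfc p.1), eval_coxF_algebraMap, p.2, map_zero]
  · have := coord_gal_toricT (hfc p.1) (algebraMap k Ω x) τ
    simp only [hperm, τ.commutes] at this
    exact this.unique (hfc p.1)
  · rintro ⟨p, hp⟩ ⟨p', hp'⟩ h
    have h' : f p = f p' := Subtype.ext_iff.1 h
    obtain ⟨r, s, a, b, ha, hb, hr, hs, hrs, h1, h2, h3, h4⟩ :=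
      (coord_eq_iff_toricT (hfc p) (hfc p')).1 h'
    obtain ⟨P, Q, W⟩ := p
    obtain ⟨P', Q', W'⟩ := p'
    obtain rfl := Projectivization.eq_of_algebraMap_rep hr h1
    obtain rfl := Projectivization.eq_of_algebraMap_rep hs h2
    obtain ⟨i, hi⟩ := Function.ne_iff.1 P.rep_nonzero
    obtain ⟨j, hj⟩ := Function.ne_iff.1 Q.rep_nonzero
    have hi' : algebraMap k Ω (P.rep i) ≠ 0 := (map_ne_zero _).2 hi
    have hj' : algebraMap k Ω (Q.rep j) ≠ 0 := (map_ne_zero _).2 hj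
    obtain rfl : 1 = r := mul_right_cancel₀ hi' ((one_mul _).trans (h1 i))
    obtain rfl : 1 = s := mul_right_cancel₀ hj' ((one_mul _).trans (h2 j))
    rw [one_mul, one_mul] at hrs
    subst hrs
    obtain rfl := Projectivization.eq_of_algebraMap_rep (P := W) (Q := W') ha
      (Fin.forall_fin_two.2 ⟨h3, h4⟩)
    rfl
  · rintro ⟨q, hqX, hqr⟩
    obtain ⟨z, hz⟩ := exists_coord_toricT q
    have hg : ∀ τ : Ω ≃ₐ[k] Ω, (toricT n).Coord (fun v : CoxVar n => τ (z v)) q := fun τ => by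
      have := coord_gal_toricT hz (algebraMap k Ω x) τ
      rw [hqr τ] at this
      simpa only [hperm] using this
    obtain ⟨hze, hzo, hzw⟩ := stable_toricT.1 hz.stable
    obtain ⟨P, t, ht, hP⟩ := exists_rep_of_scaling (k := k) hze fun τ => by
      obtain ⟨r, s, a, b, -, -, hr, -, -, h1, -⟩ := (coord_eq_iff_toricT hz (hg τ)).1 rfl
      exact ⟨r, hr, h1⟩
    obtain ⟨Q, s, hs, hQ⟩ := exists_rep_of_scaling (k := k) hzo fun τ => by
      obtain ⟨r, s, a, b, -, -, -, hs, -, -, h2, -⟩ := (coord_eq_iff_toricT hz (hg τ)).1 rfl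
      exact ⟨s, hs, h2⟩
    -- The scalars that make the two blocks rational are absorbed into `w_+` and `w_-`.
    have hz1 : (toricT n).Coord (coxVec (fun i => algebraMap k Ω (P.rep i))
        (fun i => algebraMap k Ω (Q.rep i)) ![t * z .wp, s * z .wm]) q :=
      coord_toricT_of_scaling hz ht hs (inv_ne_zero ht) (inv_ne_zero hs)
        (by rw [inv_mul_cancel₀ ht, inv_mul_cancel₀ hs])
        (fun i => by rw [hP i, inv_mul_cancel_left₀ ht]; rfl)
        (fun i => by rw [hQ i, inv_mul_cancel_left₀ hs]; rfl) rfl rfl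
    -- With both blocks fixed by Galois, their scalars are `1`; the relation `r a = s b` then gives
    -- `w_+` and `w_-` a common scalar, so they define a rational point of `ℙ¹`.
    obtain ⟨W, u, hu, hW⟩ := exists_rep_of_scaling (k := k) (x := ![t * z .wp, s * z .wm])
      (hzw.elim (fun h => ⟨0, mul_ne_zero ht h⟩) fun h => ⟨1, mul_ne_zero hs h⟩) fun τ => by
        have h := coord_gal_toricT hz1 (algebraMap k Ω x) τ
        rw [hqr τ] at h
        simp only [hperm] at h
        obtain ⟨r', s', a, b, ha, hb, -, -, hrs, h1, h2, h3, h4⟩ :=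
          (coord_eq_iff_toricT hz1 h).1 rfl
        simp only [coxVec, τ.commutes] at h1 h2 h3 h4
        obtain ⟨i, hi⟩ := Function.ne_iff.1 P.rep_nonzero
        obtain ⟨j, hj⟩ := Function.ne_iff.1 Q.rep_nonzero
        have hi' : algebraMap k Ω (P.rep i) ≠ 0 := (map_ne_zero _).2 hi
        have hj' : algebraMap k Ω (Q.rep j) ≠ 0 := (map_ne_zero _).2 hj
        obtain rfl : 1 = r' := mul_right_cancel₀ hi' ((one_mul _).trans (h1 i))
        obtain rfl : 1 = s' := mul_right_cancel₀ hj' ((one_mul _).trans (h2 j))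
        rw [one_mul, one_mul] at hrs
        subst hrs
        exact ⟨a, ha, Fin.forall_fin_two.2 ⟨h3, h4⟩⟩
    have hz2 : (toricT n).Coord (fun v : CoxVar n =>
        algebraMap k Ω (coxVec P.rep Q.rep W.rep v)) q :=
      coord_toricT_of_scaling hz1 (inv_ne_zero hu) (inv_ne_zero hu) one_ne_zero one_ne_zero rfl
        (fun i => (one_mul _).symm) (fun i => (one_mul _).symm)
        (by
          change algebraMap k Ω (W.rep 0) = u⁻¹ * _
          have : coxVec (fun i => algebraMap k Ω (P.rep i)) (fun i => algebraMap k Ω (Q.rep i))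
            ![t * z .wp, s * z .wm] .wp = _ := hW 0
          rw [this, inv_mul_cancel_left₀ hu])
        (by
          change algebraMap k Ω (W.rep 1) = u⁻¹ * _
          have : coxVec (fun i => algebraMap k Ω (P.rep i)) (fun i => algebraMap k Ω (Q.rep i))
            ![t * z .wp, s * z .wm] .wm = _ := hW 1
          rw [this, inv_mul_cancel_left₀ hu])
    have hq : f (P, Q, W) = q := (hfc (P, Q, W)).unique hz2
    refine ⟨⟨(P, Q, W), ?_⟩, Subtype.ext hq⟩
    rw [mem_Xtilde_iff hz2, eval_coxF_algebraMap, map_eq_zero] at hqX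
    exact hqX

end SplitPoints

/-! ### Counting `X̃` when `ξ` is rational -/

section SplitPointCount

theorem card_prod_zeroLocus {α k V : Type*} [Finite α] [Field k] [Finite k] [AddCommGroup V]
    [Module k V] [Finite V] (S : α → V → Prop) (h0 : ∀ a, S a 0)
    (hS : ∀ a (t : kˣ) v, S a (t • v) ↔ S a v) :
    Nat.card {p : α × V // S p.1 p.2} =
      Nat.card {p : α × ℙ k V // S p.1 p.2.rep} * (Nat.card k - 1) + Nat.card α := by
  have := Fintype.ofFinite α
  rw [Nat.card_congr (Equiv.subtypeProdEquivSigmaSubtype S),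
    Nat.card_congr (Equiv.subtypeProdEquivSigmaSubtype fun a (P : ℙ k V) => S a P.rep),
    Nat.card_sigma, Nat.card_sigma,
    Finset.sum_congr rfl fun a _ => card_zeroLocus_add_one (S a) (h0 a) (hS a),
    Finset.sum_add_distrib, Finset.sum_mul]
  simp

variable {F Ω : Type*} [Field F] [Field Ω] [Algebra F Ω] {d : ℕ}

theorem card_linear_eq {a b : F} (h : ¬ (a = 0 ∧ b = 0)) :
    Nat.card {v : Fin 2 → F // a * v 0 = b * v 1} = Nat.card F := by
  by_cases ha : a = 0
  · have hb : b ≠ 0 := fun hb => h ⟨ha, hb⟩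
    refine Nat.card_congr
      { toFun := fun v => v.1 0
        invFun := fun t => ⟨![t, a * t / b], by simp [mul_div_cancel₀ _ hb]⟩
        left_inv := fun v => ?_
        right_inv := fun _ => rfl }
    refine Subtype.ext (funext (Fin.forall_fin_two.2 ⟨rfl, ?_⟩))
    change a * v.1 0 / b = v.1 1
    rw [v.2, mul_div_cancel_left₀ _ hb]
  · refine Nat.card_congr
      { toFun := fun v => v.1 1
        invFun := fun t => ⟨![b * t / a, t], by simp [mul_div_cancel₀ _ ha]⟩
        left_inv := fun v => ?_
        right_inv := fun _ => rfl }
    refine Subtype.ext (funext (Fin.forall_fin_two.2 ⟨?_, rfl⟩))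
    change b * v.1 1 / a = v.1 0
    rw [← v.2, mul_div_cancel_left₀ _ ha]

theorem eval_coxF_coxVec (x : F) (a b c : Fin 2 → F) : eval (coxVec (n := 1) a b c) (coxF x 1 d) =
    (3 - x) * pairP d ((a 0, b 0), (a 1, b 1)) * c 0 -
      (3 + x) * pairQ d ((a 0, b 0), (a 1, b 1)) * c 1 := by
  rw [eval_coxF, Fin.sum_univ_two]
  simp only [coxVec, pairP, pairQ]
  ring

/-- Both forms are homogeneous in `u` and in `v` separately, so the affine count descends to `ℙ¹ ×
ℙ¹` by projectivising one factor after the other. -/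
theorem card_projective_pairs [Finite F] (hd : 1 ≤ d) :
    Nat.card {p : ℙ F (Fin 2 → F) × ℙ F (Fin 2 → F) //
      pairP d ((p.1.rep 0, p.2.rep 0), (p.1.rep 1, p.2.rep 1)) = 0 ∧
      pairQ d ((p.1.rep 0, p.2.rep 0), (p.1.rep 1, p.2.rep 1)) = 0} =
    Nat.gcd (2 * d + 1) (Nat.card F - 1) + 2 := by
  have hd0 : d ≠ 0 := by omega
  let S : (Fin 2 → F) → (Fin 2 → F) → Prop := fun u v =>
    pairP d ((u 0, v 0), (u 1, v 1)) = 0 ∧ pairQ d ((u 0, v 0), (u 1, v 1)) = 0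
  have hS0 : ∀ u, S u 0 := fun u => by simp [S, pairP, pairQ, hd0]
  have hS0' : ∀ u, S 0 u := fun u => by simp [S, pairP, pairQ, hd0]
  have hSt : ∀ u (t : Fˣ) v, S u (t • v) ↔ S u v := fun u t v => by
    have h1 : pairP d ((u 0, (t • v) 0), (u 1, (t • v) 1)) =
        (t : F) ^ d * pairP d ((u 0, v 0), (u 1, v 1)) := by
      simp only [pairP, Pi.smul_apply, Units.smul_def, smul_eq_mul]
      rw [mul_left_comm, mul_left_comm (u 1), mul_pow, mul_pow]
      ring
    have h2 : pairQ d ((u 0, (t • v) 0), (u 1, (t • v) 1)) =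
        (t : F) ^ (d + 1) * pairQ d ((u 0, v 0), (u 1, v 1)) := by
      simp only [pairQ, Pi.smul_apply, Units.smul_def, smul_eq_mul]
      rw [mul_left_comm (u 0), mul_left_comm (u 1), mul_pow, mul_pow]
      ring
    simp only [S, h1, h2, mul_eq_zero, pow_ne_zero _ t.ne_zero, false_or]
  have hSt' : ∀ v (t : Fˣ) u, S (t • u) v ↔ S u v := fun v t u => by
    have h1 : pairP d (((t • u) 0, v 0), ((t • u) 1, v 1)) =
        (t : F) ^ (d + 1) * pairP d ((u 0, v 0), (u 1, v 1)) := by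
      simp only [pairP, Pi.smul_apply, Units.smul_def, smul_eq_mul]
      rw [mul_assoc (t : F) (u 0) (v 0), mul_assoc (t : F) (u 1) (v 1), mul_pow, mul_pow]
      ring
    have h2 : pairQ d (((t • u) 0, v 0), ((t • u) 1, v 1)) =
        (t : F) ^ d * pairQ d ((u 0, v 0), (u 1, v 1)) := by
      simp only [pairQ, Pi.smul_apply, Units.smul_def, smul_eq_mul]
      rw [mul_assoc (t : F) (u 0) (v 0), mul_assoc (t : F) (u 1) (v 1), mul_pow, mul_pow]
      ring
    simp only [S, h1, h2, mul_eq_zero, pow_ne_zero _ t.ne_zero, false_or]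
  have e0 : {y : (F × F) × (F × F) // pairP d y = 0 ∧ pairQ d y = 0} ≃
      {p : (Fin 2 → F) × (Fin 2 → F) // S p.1 p.2} :=
    { toFun := fun y => ⟨(![y.1.1.1, y.1.2.1], ![y.1.1.2, y.1.2.2]), y.2⟩
      invFun := fun p => ⟨((p.1.1 0, p.1.2 0), (p.1.1 1, p.1.2 1)), p.2⟩
      left_inv := fun _ => rfl
      right_inv := fun p => Subtype.ext (Prod.ext
        (funext (Fin.forall_fin_two.2 ⟨rfl, rfl⟩)) (funext (Fin.forall_fin_two.2 ⟨rfl, rfl⟩))) }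
  have h1 := card_prod_zeroLocus (k := F) S hS0 hSt
  have h2 := card_prod_zeroLocus (k := F) (fun (P : ℙ F (Fin 2 → F)) u => S u P.rep)
    (fun _ => hS0' _) fun P => hSt' P.rep
  have e1 : {p : (Fin 2 → F) × ℙ F (Fin 2 → F) // S p.1 p.2.rep} ≃
      {p : ℙ F (Fin 2 → F) × (Fin 2 → F) // S p.2 p.1.rep} :=
    (Equiv.prodComm _ _).subtypeEquiv fun _ => Iff.rfl
  have e2 : {p : ℙ F (Fin 2 → F) × ℙ F (Fin 2 → F) // S p.2.rep p.1.rep} ≃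
      {p : ℙ F (Fin 2 → F) × ℙ F (Fin 2 → F) // S p.1.rep p.2.rep} :=
    (Equiv.prodComm _ _).subtypeEquiv fun _ => Iff.rfl
  rw [← Nat.card_congr e0, card_pairP_pairQ_eq_zero hd, Nat.card_congr e1, h2, Nat.card_congr e2,
    Projectivization.card_of_finrank_two F _ (by simp), Nat.card_fun, Nat.card_fin] at h1
  change Nat.card {p : ℙ F (Fin 2 → F) × ℙ F (Fin 2 → F) // S p.1.rep p.2.rep} = _
  generalize Nat.gcd (2 * d + 1) (Nat.card F - 1) = s at *
  generalize Nat.card {p : ℙ F (Fin 2 → F) × ℙ F (Fin 2 → F) // S p.1.rep p.2.rep} = M at *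
  obtain ⟨r, hr⟩ : ∃ r, Nat.card F = r + 2 :=
    ⟨_, (Nat.sub_add_cancel (Finite.one_lt_card (α := F))).symm⟩
  rw [hr, show r + 2 - 1 = r + 1 by omega, show 2 * (r + 2) - 1 = 2 * r + 3 by omega] at h1
  refine Nat.eq_of_mul_eq_mul_left (show 0 < (r + 1) ^ 2 by positivity) ?_
  zify at h1 ⊢
  linear_combination -h1

/-- Over a point of `ℙ¹ × ℙ¹` the equation is linear in `(w_+, w_-)`: one point in general, and a
whole `ℙ¹` over the `s + 2` common zeros of `P` and `Q`. The total is `(q+1)² + q(s+2)`. -/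
theorem card_Xtilde_of_split [Finite F] [IsGalois F Ω] (hd : 1 ≤ d) {x : F} (hm : 3 - x ≠ 0)
    (hp : 3 + x ≠ 0) :
    Nat.card ↥(Xtilde (algebraMap F Ω x) 1 d ∩ (toricT 1).rationalPts F (algebraMap F Ω x)) =
      Nat.card F ^ 2 + (4 + Nat.gcd (2 * d + 1) (Nat.card F - 1)) * Nat.card F + 1 := by
  classical
  have : Fintype (ℙ F (Fin 2 → F)) := Fintype.ofFinite _
  rw [card_Xtilde_of_mem_range]
  let P : ℙ F (Fin 2 → F) × ℙ F (Fin 2 → F) → F := fun p =>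
    pairP d ((p.1.rep 0, p.2.rep 0), (p.1.rep 1, p.2.rep 1))
  let Q : ℙ F (Fin 2 → F) × ℙ F (Fin 2 → F) → F := fun p =>
    pairQ d ((p.1.rep 0, p.2.rep 0), (p.1.rep 1, p.2.rep 1))
  let S : ℙ F (Fin 2 → F) × ℙ F (Fin 2 → F) → (Fin 2 → F) → Prop := fun p c =>
    (3 - x) * P p * c 0 = (3 + x) * Q p * c 1
  have h1 := card_prod_zeroLocus (k := F) S (fun p => by simp [S]) fun p t c => by
    simp only [S, Pi.smul_apply, Units.smul_def, smul_eq_mul, mul_left_comm _ (t : F)]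
    exact mul_right_inj' t.ne_zero
  have e1 : {p : ℙ F (Fin 2 → F) × ℙ F (Fin 2 → F) × ℙ F (Fin 2 → F) //
      eval (coxVec (n := 1) p.1.rep p.2.1.rep p.2.2.rep) (coxF x 1 d) = 0} ≃
      {p : (ℙ F (Fin 2 → F) × ℙ F (Fin 2 → F)) × ℙ F (Fin 2 → F) // S p.1 p.2.rep} :=
    (Equiv.prodAssoc _ _ _).symm.subtypeEquiv fun p => by
      rw [eval_coxF_coxVec, sub_eq_zero]
      rfl
  refine (Nat.card_congr e1).trans ?_
  have h2 : ∀ p, (Nat.card {c // S p c} : ℤ) =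
      ((Nat.card F : ℤ) ^ 2 - Nat.card F) * (if P p = 0 ∧ Q p = 0 then 1 else 0) +
        (Nat.card F : ℤ) * 1 := fun p => by
    split_ifs with h
    · have : ∀ c, S p c := fun c => by simp [S, h.1, h.2]
      rw [Nat.card_congr (Equiv.subtypeUnivEquiv this), Nat.card_fun, Nat.card_fin]
      push_cast
      ring
    · rw [card_linear_eq]
      · ring
      · rwa [mul_eq_zero, mul_eq_zero, or_iff_right hm, or_iff_right hp]
  have := Fintype.ofFinite F
  rw [Nat.card_congr (Equiv.subtypeProdEquivSigmaSubtype S), Nat.card_sigma] at h1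
  have h3 := congrArg (Nat.cast : ℕ → ℤ) h1
  have h4 : Nat.card {p // P p = 0 ∧ Q p = 0} = _ := card_projective_pairs (F := F) hd
  rw [Nat.cast_sum, Finset.sum_congr rfl fun p _ => h2 p, Finset.sum_add_distrib,
    ← Finset.mul_sum, ← Finset.mul_sum, ← natCast_card_subtype, ← natCast_card_fintype, h4,
    Nat.card_prod, Projectivization.card_of_finrank_two F _ (by simp)] at h3
  generalize Nat.gcd (2 * d + 1) (Nat.card F - 1) = s at *
  generalize Nat.card {p : (ℙ F (Fin 2 → F) × ℙ F (Fin 2 → F)) × ℙ F (Fin 2 → F) //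
    S p.1 p.2.rep} = M at *
  obtain ⟨r, hr⟩ : ∃ r, Nat.card F = r + 2 :=
    ⟨_, (Nat.sub_add_cancel (Finite.one_lt_card (α := F))).symm⟩
  rw [hr, show r + 2 - 1 = r + 1 by omega] at h3
  rw [hr]
  refine Nat.eq_of_mul_eq_mul_left (show 0 < r + 1 by positivity) ?_
  zify
  push_cast at h3
  linear_combination -h3

end SplitPointCount

/-! ### The formulas over finite fields -/

section FiniteFieldCount

variable {F Ω : Type*} [Field F] [Finite F] [Field Ω] [Algebra F Ω] {n d : ℕ} {ξ : Ω}

theorem isGalois_of_finite [IsAlgClosure F Ω] : IsGalois F Ω := by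
  have := IsAlgClosure.isAlgebraic (R := F) (K := Ω)
  have := IsAlgClosure.isAlgClosed F (K := Ω)
  have : Algebra.IsSeparable F Ω := Algebra.IsAlgebraic.isSeparable_of_perfectField
  have : Normal F Ω := IsAlgClosure.normal F Ω
  exact ⟨⟩

theorem two_ne_zero_of_card_mod (hq : Nat.card F % 2 = 1) : (2 : F) ≠ 0 := fun h => by
  have := Fintype.ofFinite F
  have h1 := FiniteField.cast_card_eq_zero F
  rw [← Nat.card_eq_fintype_card, ← Nat.div_add_mod (Nat.card F) 2, hq] at h1
  push_cast at h1
  rw [h, zero_mul, zero_add] at h1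
  exact one_ne_zero h1

theorem three_eq_zero_of_card_mod (hq : Nat.card F % 3 = 0) : (3 : F) = 0 := by
  have := Fintype.ofFinite F
  obtain ⟨p, hp⟩ := CharP.exists F
  obtain ⟨m, hpp, hm⟩ := FiniteField.card F p
  have h3 : 3 ∣ p ^ (m : ℕ) := by
    rw [← hm, ← Nat.card_eq_fintype_card]
    exact Nat.dvd_of_mod_eq_zero hq
  have h4 := (Nat.prime_dvd_prime_iff_eq Nat.prime_three hpp).1 (Nat.prime_three.dvd_of_dvd_pow h3)
  rw [← Nat.cast_ofNat, h4, CharP.cast_eq_zero]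

theorem not_isSquare_of_card_mod (hq : Nat.card F % 6 = 5) : ¬ IsSquare (-3 : F) := by
  rintro ⟨c, hc⟩
  have h2 := two_ne_zero_of_card_mod (F := F) (by omega)
  refine sq_sub_self_add_one_ne_zero (.inl hq) ((1 + c) / 2) ?_
  field_simp
  linear_combination -hc

theorem exists_algebraMap_eq_of_card_mod (hq : Nat.card F % 6 = 1) (hξ : ξ ^ 2 = -3) :
    ∃ x : F, algebraMap F Ω x = ξ ∧ x ^ 2 = -3 := by
  obtain ⟨ω, hω⟩ := exists_root_of_card_mod (F := F) (by omega)
  have h : (2 * ω - 1) ^ 2 = -3 := by linear_combination 4 * hω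
  have h' : algebraMap F Ω (2 * ω - 1) ^ 2 = ξ ^ 2 := by
    rw [← map_pow, h, hξ, map_neg, map_ofNat]
  rcases sq_eq_sq_iff_eq_or_eq_neg.1 h' with h1 | h1
  · exact ⟨_, h1, h⟩
  · exact ⟨-(2 * ω - 1), by rw [map_neg, h1, neg_neg], by rw [neg_sq, h]⟩

theorem card_Xtilde_eq_of_card_mod [IsAlgClosure F Ω] (hξ : ξ ^ 2 = -3)
    (hq : Nat.card F % 6 = 5) :
    Nat.card ↥(Xtilde ξ n d ∩ (toricT n).rationalPts F ξ) =
      Nat.card ↥(hypersurfacePts F n d) := by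
  have := isGalois_of_finite (F := F) (Ω := Ω)
  have hk := not_isSquare_of_card_mod hq
  exact card_Xtilde_eq_card_hypersurfacePts (two_ne_zero_of_not_isSquare hk)
    (sqrt_neg_three_ne_zero (three_ne_zero_of_not_isSquare hk) hξ) hξ hk

theorem card_Xtilde_of_card_mod_six_eq_one [IsAlgClosure F Ω] (hd : 1 ≤ d) (hξ : ξ ^ 2 = -3)
    (hq : Nat.card F % 6 = 1) :
    Nat.card ↥(Xtilde ξ 1 d ∩ (toricT 1).rationalPts F ξ) =
      Nat.card F ^ 2 + (4 + Nat.gcd (2 * d + 1) (Nat.card F - 1)) * Nat.card F + 1 := by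
  have := isGalois_of_finite (F := F) (Ω := Ω)
  obtain ⟨x, rfl, hx⟩ := exists_algebraMap_eq_of_card_mod hq hξ
  have h2 := two_ne_zero_of_card_mod (F := F) (by omega)
  have h3 := three_ne_zero_of_card_mod (F := F) (by omega)
  exact card_Xtilde_of_split hd (three_sub_ne_zero h2 h3 hx) (three_add_ne_zero h2 h3 hx)

theorem card_Xtilde_of_gcd_eq_one [IsAlgClosure F Ω] (hξ : ξ ^ 2 = -3) (hq : Nat.card F % 6 = 5)
    (hd : Nat.gcd (2 * d + 1) (Nat.card F - 1) = 1) :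
    Nat.card ↥(Xtilde ξ n d ∩ (toricT n).rationalPts F ξ) =
        Nat.card (ℙ F (Fin (2 * n + 1) → F)) ∧
      (Nat.card ↥(Xtilde ξ n d ∩ (toricT n).rationalPts F ξ) : ℚ) =
        ((Nat.card F : ℚ) ^ (2 * n + 1) - 1) / ((Nat.card F : ℚ) - 1) := by
  have h1 := card_hypersurfacePts_of_gcd_eq_one (n := n) (.inl hq) hd
  have hq1 : 1 < Nat.card F := Finite.one_lt_card
  rw [card_Xtilde_eq_of_card_mod hξ hq]
  constructor
  · have h2 := Projectivization.card' F (Fin (2 * n + 1) → F)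
    rw [Nat.card_fun, Nat.card_fin] at h2
    exact Nat.eq_of_mul_eq_mul_right (show 0 < Nat.card F - 1 by omega)
      (Nat.succ_injective (h1.trans h2))
  · have h2 : (Nat.card F : ℚ) - 1 ≠ 0 := by
      rw [sub_ne_zero]
      exact_mod_cast hq1.ne'
    rw [eq_div_iff h2]
    have h3 := congrArg (Nat.cast : ℕ → ℚ) h1
    push_cast [Nat.cast_sub hq1.le] at h3
    linear_combination h3

end FiniteFieldCount

theorem gcd_of_eq_three_pow_mul {d q : ℕ} (hq : q % 6 = 3) {i g : ℕ} (h : 2 * d + 1 = 3 ^ i * g) :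
    Nat.gcd (2 * d + 1) (q - 1) = Nat.gcd g (q - 1) := by
  rw [h, Nat.Coprime.gcd_mul_left_cancel]
  exact Nat.Coprime.pow_left _ ((Nat.Prime.coprime_iff_not_dvd Nat.prime_three).2 (by omega))

/-! ### Elements of bounded height in a number field, by a gap principle -/

section Gap

open NumberField Height

variable {K : Type*} [Field K]

theorem finitePlace_apply_sub_le [NumberField K] (w : FinitePlace K) (x y : K) :
    w (x - y) ≤ max (w x) 1 * max (w y) 1 := by
  have h : w (x + -y) ≤ max (w x) (w (-y)) := FinitePlace.add_le w x (-y)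
  have h' : w (-y) = w y := map_neg_eq_map w y
  rw [← sub_eq_add_neg, h'] at h
  refine h.trans (max_le ?_ ?_)
  · exact (le_max_left _ _).trans (le_mul_of_one_le_right (by positivity) (le_max_right _ _))
  · exact (le_max_left _ _).trans (le_mul_of_one_le_left (by positivity) (le_max_right _ _))

theorem hasFiniteMulSupport_max_finitePlace [NumberField K] (x : K) :
    (fun w : FinitePlace K => max (w x) 1).HasFiniteMulSupport := by
  rcases eq_or_ne x 0 with rfl | hx
  · simpa using Function.hasFiniteMulSupport_one
  · exact (FinitePlace.hasFiniteMulSupport hx).max Function.hasFiniteMulSupport_one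

/-- Distinct elements cannot be close to each other at all infinite places. -/
theorem one_le_pow_mul_mulHeight₁ [NumberField K] {x y : K} (hxy : x ≠ y) {ε : ℝ}
    (h : ∀ v : InfinitePlace K, v (x - y) ≤ ε * (max (v x) 1 * max (v y) 1)) :
    1 ≤ ε ^ Module.finrank ℚ K * (mulHeight₁ x * mulHeight₁ y) := by
  have hx := hasFiniteMulSupport_max_finitePlace x
  have hy := hasFiniteMulSupport_max_finitePlace y
  rw [NumberField.mulHeight₁_eq, NumberField.mulHeight₁_eq]
  -- The product formula for `x - y`; finite places are bounded by the ultrametric inequality,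
  -- infinite ones by `h`, and the local degrees at infinity add up to the exponent of `ε`.
  refine (prod_abs_eq_one (sub_ne_zero.2 hxy)).ge.trans ?_
  calc _ ≤ (∏ v : InfinitePlace K, (ε * (max (v x) 1 * max (v y) 1)) ^ v.mult) *
        ∏ᶠ w : FinitePlace K, (max (w x) 1 * max (w y) 1) := by
        refine mul_le_mul (Finset.prod_le_prod (fun v _ => by positivity) fun v _ =>
          pow_le_pow_left₀ (apply_nonneg _ _) (h v) _) (finprod_le_finprod ?_ ?_ ?_ ?_) ?_ ?_
        · exact FinitePlace.hasFiniteMulSupport (sub_ne_zero.2 hxy)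
        · exact fun w => apply_nonneg w _
        · exact hx.mul hy
        · exact fun w => finitePlace_apply_sub_le w x y
        · exact finprod_nonneg fun w => apply_nonneg w _
        · exact Finset.prod_nonneg fun v _ =>
            pow_nonneg ((apply_nonneg _ _).trans (h v)) _
    _ = _ := by
        rw [finprod_mul_distrib hx hy]
        simp only [mul_pow, Finset.prod_mul_distrib, Finset.prod_pow_eq_pow_sum]
        rw [InfinitePlace.sum_mult_eq]
        ring

/-- The cell of an element of the closed unit disc in the grid of mesh `1 / M`. -/
def gridCell (M : ℕ) (z : ℂ) : ℤ × ℤ := (⌊M * z.re⌋, ⌊M * z.im⌋)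

theorem abs_sub_le_of_floor_eq {M : ℕ} (hM : 0 < M) {a b : ℝ} (h : ⌊M * a⌋ = ⌊M * b⌋) :
    |a - b| ≤ 1 / M := by
  have hM' : (0 : ℝ) < M := by exact_mod_cast hM
  have := Int.abs_sub_lt_one_of_floor_eq_floor h
  rw [← mul_sub, abs_mul, abs_of_pos hM'] at this
  rw [le_div_iff₀ hM', mul_comm]
  exact this.le

theorem norm_sub_le_of_gridCell_eq {M : ℕ} (hM : 0 < M) {z w : ℂ}
    (h : gridCell M z = gridCell M w) : ‖z - w‖ ≤ 2 / M := by
  obtain ⟨h1, h2⟩ := Prod.ext_iff.1 h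
  refine (Complex.norm_le_abs_re_add_abs_im _).trans ?_
  rw [Complex.sub_re, Complex.sub_im]
  have := add_le_add (abs_sub_le_of_floor_eq hM h1) (abs_sub_le_of_floor_eq hM h2)
  refine this.trans (le_of_eq ?_)
  ring

theorem floor_mem_Icc {M : ℕ} {a : ℝ} (h : |a| ≤ 1) : ⌊M * a⌋ ∈ Finset.Icc (-(M : ℤ)) M := by
  have hM : (0 : ℝ) ≤ M := Nat.cast_nonneg M
  obtain ⟨h1, h2⟩ := abs_le.1 h
  rw [Finset.mem_Icc]
  constructor
  · rw [Int.le_floor]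
    push_cast
    nlinarith
  · have h3 : M * a ≤ M := by nlinarith
    have := Int.floor_le_floor h3
    rwa [Int.floor_natCast] at this

theorem embedding_im_eq_zero {v : InfinitePlace K} (hv : v.IsReal) (x : K) :
    (v.embedding x).im = 0 := by
  have := RingHom.congr_fun (ComplexEmbedding.isReal_iff.1 (InfinitePlace.isReal_iff.1 hv)) x
  rw [ComplexEmbedding.conjugate_coe_eq] at this
  exact Complex.conj_eq_iff_im.1 this

open Classical in
/-- The cell of an element of `ℙ¹(K)` at an infinite place. -/
def placeCell (M : ℕ) (x : K) (v : InfinitePlace K) : Bool × (ℤ × ℤ) :=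
  if v x ≤ 1 then (true, gridCell M (v.embedding x)) else (false, gridCell M (v.embedding x⁻¹))

open Classical in
/-- The possible cells at an infinite place. -/
def placeCells (M : ℕ) (v : InfinitePlace K) : Finset (Bool × (ℤ × ℤ)) :=
  Finset.univ ×ˢ (Finset.Icc (-(M : ℤ)) M ×ˢ
    if v.IsReal then {0} else Finset.Icc (-(M : ℤ)) M)

/-- At a real place imaginary parts vanish, so the grid is one-dimensional and its dimension is
always `v.mult`; the factor `2` records whether `x` or `x⁻¹` lies in the unit disc. -/
theorem card_placeCells (M : ℕ) (v : InfinitePlace K) :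
    (placeCells M v).card = 2 * (2 * M + 1) ^ v.mult := by
  have h : (Finset.Icc (-(M : ℤ)) M).card = 2 * M + 1 := by
    rw [Int.card_Icc]
    omega
  unfold placeCells InfinitePlace.mult
  rw [Finset.card_product, Finset.card_product, h, Finset.card_univ, Fintype.card_bool]
  split_ifs
  · rw [Finset.card_singleton, mul_one, pow_one]
  · rw [h, pow_two]

theorem gridCell_embedding_mem {M : ℕ} {v : InfinitePlace K} {x : K} (h : v x ≤ 1) (b : Bool) :
    (b, gridCell M (v.embedding x)) ∈ placeCells M v := by
  rw [← InfinitePlace.norm_embedding_eq] at h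
  unfold placeCells gridCell
  refine Finset.mem_product.2 ⟨Finset.mem_univ _, Finset.mem_product.2 ⟨floor_mem_Icc
    ((Complex.abs_re_le_norm _).trans h), ?_⟩⟩
  split_ifs with hv
  · simp [embedding_im_eq_zero hv]
  · exact floor_mem_Icc ((Complex.abs_im_le_norm _).trans h)

theorem placeCell_mem (M : ℕ) (x : K) (v : InfinitePlace K) :
    placeCell M x v ∈ placeCells M v := by
  unfold placeCell
  split_ifs with h
  · exact gridCell_embedding_mem h _
  · refine gridCell_embedding_mem ?_ _
    rw [map_inv₀]
    exact inv_le_one_of_one_le₀ (not_le.1 h).le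

theorem apply_sub_le_of_placeCell_eq {M : ℕ} (hM : 0 < M) {x y : K} {v : InfinitePlace K}
    (h : placeCell M x v = placeCell M y v) :
    v (x - y) ≤ 2 / M * (max (v x) 1 * max (v y) 1) := by
  have key : ∀ a b : K, gridCell M (v.embedding a) = gridCell M (v.embedding b) →
      v (a - b) ≤ 2 / M := fun a b hab => by
    rw [← InfinitePlace.norm_embedding_eq, map_sub]
    exact norm_sub_le_of_gridCell_eq hM hab
  unfold placeCell at h
  split_ifs at h with hx hy hy
  · rw [max_eq_right hx, max_eq_right hy, mul_one, mul_one]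
    exact key x y (Prod.ext_iff.1 h).2
  · simp at h
  · simp at h
  · rw [not_le] at hx hy
    rw [max_eq_left hx.le, max_eq_left hy.le]
    have hx0 : x ≠ 0 := by
      rintro rfl
      rw [map_zero] at hx
      linarith
    have hy0 : y ≠ 0 := by
      rintro rfl
      rw [map_zero] at hy
      linarith
    -- Outside the unit disc closeness is measured on the inverses.
    rw [show x - y = (y⁻¹ - x⁻¹) * (x * y) by field_simp, map_mul, map_mul]
    exact mul_le_mul_of_nonneg_right (key _ _ (Prod.ext_iff.1 h).2.symm)
      (mul_nonneg (apply_nonneg v x) (apply_nonneg v y))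

/-- Two elements with the same cell at every infinite place would be too close for their heights, so
the cells separate the elements. -/
theorem encard_mulHeight₁_le [NumberField K] {M : ℕ} (hM : 0 < M) {B : ℝ}
    (hB : (2 / M : ℝ) ^ Module.finrank ℚ K * (B * B) < 1) :
    {x : K | mulHeight₁ x ≤ B}.encard ≤
      (2 ^ Fintype.card (InfinitePlace K) * (2 * M + 1) ^ Module.finrank ℚ K : ℕ) := by
  classical
  have hcard : (Fintype.piFinset fun v : InfinitePlace K => placeCells M v).card =
      2 ^ Fintype.card (InfinitePlace K) * (2 * M + 1) ^ Module.finrank ℚ K := by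
    rw [Fintype.card_piFinset]
    simp only [card_placeCells, Finset.prod_mul_distrib, Finset.prod_pow_eq_pow_sum,
      InfinitePlace.sum_mult_eq, Finset.prod_const, Finset.card_univ]
  rw [← hcard, ← Set.encard_coe_eq_coe_finsetCard]
  refine Set.encard_le_encard_of_injOn (f := placeCell M)
    (fun x _ => Fintype.mem_piFinset.2 (placeCell_mem M x)) fun x hx y hy h => ?_
  by_contra hxy
  have h1 := one_le_pow_mul_mulHeight₁ hxy fun v =>
    apply_sub_le_of_placeCell_eq hM (congrFun h v)
  refine hB.not_ge (h1.trans (mul_le_mul_of_nonneg_left (mul_le_mul hx hy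
    (mulHeight₁_nonneg y) ((mulHeight₁_nonneg x).trans hx)) (by positivity)))

/-- The number of elements of height at most `B` is `O(B²)`. -/
theorem exists_encard_mulHeight₁_le (K : Type*) [Field K] [NumberField K] :
    ∃ c : ℝ, 0 < c ∧ ∀ B : ℝ, 1 ≤ B →
      ∃ N : ℕ, {x : K | mulHeight₁ x ≤ B}.encard ≤ N ∧ (N : ℝ) ≤ c * B ^ 2 := by
  set D := Module.finrank ℚ K with hD
  have hD0 : (D : ℝ) ≠ 0 := by
    have : 0 < D := Module.finrank_pos
    positivity
  refine ⟨2 ^ Fintype.card (InfinitePlace K) * 7 ^ D, by positivity, fun B hB => ?_⟩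
  -- With `R^D = B²` the separation condition amounts to `M > 2R`, and then `2M + 1 ≤ 4R + 3 ≤ 7R`,
  -- whence the constant `7 ^ D`.
  set R : ℝ := B ^ (2 / D : ℝ) with hR
  have hRD : R ^ D = B ^ 2 := by
    rw [hR, ← Real.rpow_natCast, ← Real.rpow_mul (by linarith), div_mul_cancel₀ _ hD0,
      Real.rpow_ofNat]
  have hR1 : 1 ≤ R := Real.one_le_rpow hB (by positivity)
  set M := ⌊2 * R⌋₊ + 1 with hM
  have hM1 : 2 * R < M := by
    rw [hM]
    push_cast
    exact Nat.lt_floor_add_one _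
  have hM2 : (M : ℝ) ≤ 2 * R + 1 := by
    rw [hM]
    push_cast
    linarith [Nat.floor_le (show 0 ≤ 2 * R by linarith)]
  have hM0 : (0 : ℝ) < M := by linarith
  refine ⟨_, encard_mulHeight₁_le (K := K) (M := M) (by omega) ?_, ?_⟩
  · rw [← hD, ← pow_two, ← hRD, ← mul_pow]
    refine pow_lt_one₀ (by positivity) ?_ (fun h => hD0 (by rw [h, Nat.cast_zero]))
    rw [div_mul_eq_mul_div, div_lt_one hM0]
    exact hM1
  · rw [← hRD]
    push_cast
    rw [mul_assoc, ← mul_pow]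
    gcongr
    linarith

end Gap

/-! ### Upper bounds for points of bounded height -/

section UpperBounds

open NumberField Height

theorem countUpper_of_encard_le {P : Type*} {S : ℝ → Set P} {α c : ℝ} (hc : 0 < c)
    (h : ∀ B : ℝ, 1 ≤ B → ∃ N : ℕ, (S B).encard ≤ N ∧ (N : ℝ) ≤ c * B ^ α) : CountUpper S α := by
  refine ⟨c, hc, 1, one_pos, fun B hB => ?_⟩
  obtain ⟨N, h1, h2⟩ := h B hB
  calc ((S B).encard : ℝ≥0∞) ≤ ((N : ℕ∞) : ℝ≥0∞) := ENat.toENNReal_le.2 h1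
    _ = ENNReal.ofReal N := by rw [ENat.toENNReal_coe, ENNReal.ofReal_natCast]
    _ ≤ _ := ENNReal.ofReal_le_ofReal h2

variable {K : Type*} [Field K] [NumberField K]

/-- A point is encoded by the index of a nonzero coordinate and the ratios of the others to it; each
ratio has height at most that of the point. -/
theorem encard_mulHeight_le {ι : Type} [Fintype ι] {B : ℝ} {N : ℕ}
    (hN : {x : K | mulHeight₁ x ≤ B}.encard ≤ N) :
    {P : ℙ K (ι → K) | P.mulHeight ≤ B}.encard ≤
      (Fintype.card ι * N ^ (Fintype.card ι - 1) : ℕ) := by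
  classical
  have hfin : {x : K | mulHeight₁ x ≤ B}.Finite := Set.finite_of_encard_le_coe hN
  have hle : hfin.toFinset.card ≤ N := by
    rwa [hfin.encard_eq_coe_toFinset_card, Nat.cast_le] at hN
  have hex : ∀ P : ℙ K (ι → K), ∃ i, P.rep i ≠ 0 := fun P => Function.ne_iff.1 P.rep_nonzero
  choose f hf using hex
  let T : Finset (Σ i : ι, ({j : ι // j ≠ i} → K)) :=
    Finset.univ.sigma fun i => Fintype.piFinset fun _ => hfin.toFinset
  have hT : T.card ≤ Fintype.card ι * N ^ (Fintype.card ι - 1) := by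
    unfold T
    rw [Finset.card_sigma]
    simp only [Fintype.card_piFinset, Finset.prod_const, Finset.card_univ,
      Fintype.card_subtype_compl, Fintype.card_unique, Finset.sum_const, smul_eq_mul]
    gcongr
  refine le_trans ?_ (Nat.cast_le.2 hT)
  rw [← Set.encard_coe_eq_coe_finsetCard]
  refine Set.encard_le_encard_of_injOn
    (f := fun P : ℙ K (ι → K) => ⟨f P, fun j => P.rep j / P.rep (f P)⟩) (fun P hP => ?_)
    fun P _ Q _ h => ?_
  · refine Finset.mem_sigma.2 ⟨Finset.mem_univ _, Fintype.mem_piFinset.2 fun j => ?_⟩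
    rw [Set.Finite.mem_toFinset]
    change mulHeight₁ (P.rep j / P.rep (f P)) ≤ B
    rw [mulHeight₁_div_eq_mulHeight]
    have h1 := mulHeight_comp_le ![(j : ι), f P] P.rep
    have h2 : P.rep ∘ ![(j : ι), f P] = ![P.rep j, P.rep (f P)] := by
      funext i
      fin_cases i <;> rfl
    rw [h2] at h1
    refine h1.trans (le_trans (le_of_eq ?_) hP)
    conv_rhs => rw [← P.mk_rep]
    rw [Projectivization.mulHeight_mk]
  · obtain ⟨h1, h2⟩ := Sigma.mk.inj_iff.1 h
    have h3 : ∀ j, P.rep j / P.rep (f P) = Q.rep j / Q.rep (f P) := by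
      intro j
      by_cases hj : j = f P
      · subst hj
        rw [div_self (hf P), div_self (h1 ▸ hf Q)]
      · have key : ∀ (i i' : ι) (_ : i = i') (a : {j // j ≠ i} → K) (b : {j // j ≠ i'} → K),
            a ≍ b → ∀ (hj : j ≠ i) (hj' : j ≠ i'), a ⟨j, hj⟩ = b ⟨j, hj'⟩ := by
          rintro i _ rfl a b hab hj hj'
          rw [eq_of_heq hab]
        have h4 : P.rep j / P.rep (f P) = Q.rep j / Q.rep (f Q) := key _ _ h1 _ _ h2 hj (h1 ▸ hj)
        rw [h4, h1]
    have hQ : Q.rep (f P) ≠ 0 := h1 ▸ hf Q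
    rw [← P.mk_rep, ← Q.mk_rep, Projectivization.mk_eq_mk_iff']
    refine ⟨P.rep (f P) / Q.rep (f P), funext fun j => ?_⟩
    have := h3 j
    rw [div_eq_iff (hf P)] at this
    rw [Pi.smul_apply, smul_eq_mul, this]
    ring

/-- The number of points of height at most `B` of the projective space containing `X`. -/
theorem exists_encard_mulHeight_le (K : Type*) [Field K] [NumberField K] (n : ℕ) :
    ∃ c : ℝ, 0 < c ∧ ∀ B : ℝ, 1 ≤ B → ∃ N : ℕ,
      {P : ℙ K (XIdx n → K) | P.mulHeight ≤ B}.encard ≤ N ∧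
        (N : ℝ) ≤ c * B ^ (4 * n + 2 : ℝ) := by
  obtain ⟨c, hc, h⟩ := exists_encard_mulHeight₁_le K
  refine ⟨(2 * n + 2) * c ^ (2 * n + 1), by positivity, fun B hB => ?_⟩
  obtain ⟨N, h1, h2⟩ := h B hB
  refine ⟨_, encard_mulHeight_le (ι := XIdx n) h1, ?_⟩
  have hcard : Fintype.card (XIdx n) = 2 * n + 2 := by
    rw [Fintype.card_prod, Fintype.card_fin, Fintype.card_fin]
    ring
  rw [hcard, show 2 * n + 2 - 1 = 2 * n + 1 by omega]
  have hB' : B ^ (4 * n + 2 : ℝ) = (B ^ 2) ^ (2 * n + 1) := by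
    rw [← pow_mul, ← Real.rpow_natCast]
    congr 1
    push_cast
    ring
  rw [hB', mul_assoc, ← mul_pow]
  push_cast
  gcongr

theorem countUpper_hypersurfaceBounded (n d : ℕ) :
    CountUpper (hypersurfaceBounded K n d) (4 * n + 2 : ℝ) := by
  obtain ⟨c, hc, h⟩ := exists_encard_mulHeight_le K n
  refine countUpper_of_encard_le hc fun B hB => ?_
  obtain ⟨N, h1, h2⟩ := h B hB
  exact ⟨N, (Set.encard_le_encard fun P hP => hP.2).trans h1, h2⟩

theorem encard_le_mul_of_fibres {α β : Type*} {S : Set α} {T : Set β} {N C : ℕ}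
    (hT : T.encard ≤ N) (f : α → β) (hf : ∀ a ∈ S, f a ∈ T)
    (h : ∀ b ∈ T, {a ∈ S | f a = b}.encard ≤ C) : S.encard ≤ (C * N : ℕ) := by
  classical
  have hTf : T.Finite := Set.finite_of_encard_le_coe hT
  have hfib : ∀ b ∈ T, {a ∈ S | f a = b}.Finite := fun b hb => Set.finite_of_encard_le_coe (h b hb)
  have hS : S.Finite := (hTf.biUnion hfib).subset fun a ha => Set.mem_iUnion₂.2 ⟨f a, hf a ha, ha, rfl⟩
  have h1 : hS.toFinset.card ≤ C * hTf.toFinset.card := by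
    refine Finset.card_le_mul_card_image_of_maps_to (f := f) (fun a ha => ?_) C fun b hb => ?_
    · rw [Set.Finite.mem_toFinset] at ha ⊢
      exact hf a ha
    · rw [Set.Finite.mem_toFinset] at hb
      have h2 := h b hb
      rw [(hfib b hb).encard_eq_coe_toFinset_card, Nat.cast_le] at h2
      refine (Finset.card_le_card fun a ha => ?_).trans h2
      rw [Finset.mem_filter, Set.Finite.mem_toFinset] at ha
      rw [Set.Finite.mem_toFinset]
      exact ha
  rw [hTf.encard_eq_coe_toFinset_card, Nat.cast_le] at hT
  rw [hS.encard_eq_coe_toFinset_card, Nat.cast_le]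
  exact h1.trans (Nat.mul_le_mul_left _ hT)

variable {Ω : Type*} [Field Ω] [Algebra K Ω] {n d : ℕ} {ξ : Ω}

theorem countUpper_XtildeBounded_of_fibres {C : ℕ} (hC : 0 < C)
    (h : ∀ P : ℙ K (XIdx n → K), {q : (toricT n).Pt Ω | q ∈ Xtilde ξ n d ∧
      q ∈ (toricT n).rationalPts K ξ ∧ LiesAbove ξ q P}.encard ≤ C) :
    CountUpper (XtildeBounded K ξ n d) (4 * n + 2 : ℝ) := by
  classical
  obtain ⟨c, hc, hK⟩ := exists_encard_mulHeight_le K n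
  refine countUpper_of_encard_le (c := C * c) (by positivity) fun B hB => ?_
  obtain ⟨N, h1, h2⟩ := hK B hB
  have hne : Nonempty (ℙ K (XIdx n → K)) :=
    ⟨Projectivization.mk K (fun _ => 1) fun h => one_ne_zero (congrFun h ((0 : Fin (n + 1)), 0))⟩
  have hex : ∀ q : (toricT n).Pt Ω, ∃ P : ℙ K (XIdx n → K),
      q ∈ XtildeBounded K ξ n d B → LiesAbove ξ q P ∧ P.mulHeight ≤ B := by
    intro q
    by_cases hq : q ∈ XtildeBounded K ξ n d B
    · obtain ⟨-, -, P, r, h1, h2, h3⟩ := hq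
      exact ⟨P, fun _ => ⟨⟨r, h1, h2⟩, h3⟩⟩
    · exact ⟨hne.some, fun h => absurd h hq⟩
  choose f hf using hex
  refine ⟨C * N, encard_le_mul_of_fibres h1 f (fun q hq => (hf q hq).2) fun P _ =>
    (Set.encard_le_encard ?_).trans (h P), ?_⟩
  · rintro q ⟨hq, rfl⟩
    exact ⟨hq.1, hq.2.1, (hf q hq).1⟩
  · push_cast
    rw [mul_assoc]
    gcongr

/-- Rational points avoid the exceptional divisors, where the blow-down could fail to be injective.
-/
theorem countUpper_XtildeBounded_of_not_isSquare [IsGalois K Ω] (hξ : ξ ^ 2 = -3)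
    (hK : ¬ IsSquare (-3 : K)) : CountUpper (XtildeBounded K ξ n d) (4 * n + 2 : ℝ) := by
  have h2 : (2 : Ω) ≠ 0 := two_ne_zero_of_not_isSquare hK
  have h0 := sqrt_neg_three_ne_zero (three_ne_zero_of_not_isSquare hK) hξ
  refine countUpper_XtildeBounded_of_fibres one_pos fun P => ?_
  rw [Nat.cast_one, Set.encard_le_one_iff]
  rintro q q' ⟨-, hq, hP⟩ ⟨-, hq', hP'⟩
  obtain ⟨z, hz⟩ := exists_coord_toricT q
  obtain ⟨z', hz'⟩ := exists_coord_toricT q'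
  have hw := wp_wm_ne_zero_of_mem_rationalPts h2 h0 hξ hK hq hz
  have hw' := wp_wm_ne_zero_of_mem_rationalPts h2 h0 hξ hK hq' hz'
  exact hP.eq_of_ne_zero h2 h0 hP' hz hz' hw.1 hw.2 hw'.1 hw'.2

end UpperBounds

/-! ### Fibres of the blow-down for surfaces -/

section SurfaceFibres

variable {Ω : Type*} [Field Ω]

theorem exists_eq_mul_of_cross {u v : Fin 2 → Ω} (hu : u ≠ 0) (hv : v ≠ 0)
    (h : u 0 * v 1 = v 0 * u 1) : ∃ r : Ω, r ≠ 0 ∧ ∀ i, v i = r * u i := by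
  have ext0 : ∀ w : Fin 2 → Ω, w 0 = 0 → w 1 = 0 → w = 0 := fun w h0 h1 => by
    funext i
    fin_cases i
    · exact h0
    · exact h1
  by_cases hu0 : u 0 = 0
  · have hu1 : u 1 ≠ 0 := fun h1 => hu (ext0 u hu0 h1)
    have hv0 : v 0 = 0 := by simpa [hu0, hu1] using h.symm
    have hv1 : v 1 ≠ 0 := fun h1 => hv (ext0 v hv0 h1)
    refine ⟨v 1 / u 1, div_ne_zero hv1 hu1, Fin.forall_fin_two.2 ⟨?_, ?_⟩⟩
    · rw [hv0, hu0, mul_zero]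
    · rw [div_mul_cancel₀ _ hu1]
  · have hv0 : v 0 ≠ 0 := fun h0 => hv (ext0 v h0 (by simpa [h0, hu0] using h))
    refine ⟨v 0 / u 0, div_ne_zero hv0 hu0, Fin.forall_fin_two.2 ⟨?_, ?_⟩⟩
    · rw [div_mul_cancel₀ _ hu0]
    · field_simp
      linear_combination h

/-- The equation `v₀^{d+1} u₀^d + v₁^{d+1} u₁^d = 0` has at most `d` solutions `u` up to scaling. -/
theorem encard_le_of_binary_eq_zero {α : Type*} {S : Set α} {u : α → Fin 2 → Ω} {v : Fin 2 → Ω}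
    {d : ℕ} (hd : 1 ≤ d) (hv : v ≠ 0) (hu : ∀ q ∈ S, u q ≠ 0)
    (h : ∀ q ∈ S, ∑ i, u q i ^ d * v i ^ (d + 1) = 0)
    (hinj : ∀ q ∈ S, ∀ q' ∈ S, (∃ r : Ω, r ≠ 0 ∧ ∀ i, u q' i = r * u q i) → q = q') :
    S.encard ≤ d := by
  classical
  simp only [Fin.sum_univ_two] at h
  by_cases hv0 : v 0 = 0
  · have hv1 : v 1 ≠ 0 := fun h1 => hv (by
      funext i
      fin_cases i
      · exact hv0
      · exact h1)
    have hu1 : ∀ q ∈ S, u q 1 = 0 := fun q hq => by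
      have := h q hq
      rw [hv0, zero_pow (by omega), mul_zero, zero_add, mul_eq_zero] at this
      exact eq_zero_of_pow_eq_zero (this.resolve_right (pow_ne_zero _ hv1))
    refine (Set.encard_le_one_iff.2 fun q q' hq hq' => hinj q hq q' hq'
      (exists_eq_mul_of_cross (hu q hq) (hu q' hq') ?_)).trans (by exact_mod_cast hd)
    rw [hu1 q hq, hu1 q' hq', mul_zero, mul_zero]
  · have hu1 : ∀ q ∈ S, u q 1 ≠ 0 := fun q hq h1 => hu q hq (by
      have := h q hq
      rw [h1, zero_pow (by omega), zero_mul, add_zero, mul_eq_zero] at this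
      funext i
      fin_cases i
      · exact eq_zero_of_pow_eq_zero (this.resolve_right (pow_ne_zero _ hv0))
      · exact h1)
    let p : Polynomial Ω := .C (v 0 ^ (d + 1)) * .X ^ d + .C (v 1 ^ (d + 1))
    have hdeg : p.natDegree = d := Polynomial.natDegree_add_C.trans
      (Polynomial.natDegree_C_mul_X_pow _ _ (pow_ne_zero _ hv0))
    have hp : p ≠ 0 := by
      rintro hp
      rw [hp, Polynomial.natDegree_zero] at hdeg
      omega
    have hcard : p.roots.toFinset.card ≤ d :=
      (Multiset.toFinset_card_le _).trans ((Polynomial.card_roots' p).trans hdeg.le)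
    refine le_trans ?_ (Nat.cast_le.2 hcard)
    rw [← Set.encard_coe_eq_coe_finsetCard]
    refine Set.encard_le_encard_of_injOn (f := fun q => u q 0 / u q 1) (fun q hq => ?_)
      fun q hq q' hq' e => hinj q hq q' hq' (exists_eq_mul_of_cross (hu q hq) (hu q' hq') ?_)
    · refine Finset.mem_coe.2 (Multiset.mem_toFinset.2 ((Polynomial.mem_roots hp).2 ?_))
      have h1 := hu1 q hq
      simp only [p, Polynomial.IsRoot, Polynomial.eval_add, Polynomial.eval_mul, Polynomial.eval_C,
        Polynomial.eval_pow, Polynomial.eval_X, div_pow]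
      field_simp
      linear_combination h q hq
    · exact (div_eq_div_iff (hu1 q hq) (hu1 q' hq')).1 e

variable {k : Type*} [Field k] [Algebra k Ω] {n d : ℕ} {ξ : Ω}

theorem LiesAbove.exists_scale (h2 : (2 : Ω) ≠ 0) (h0 : ξ ≠ 0) {q : (toricT n).Pt Ω}
    {P : ℙ k (XIdx n → k)} (h : LiesAbove ξ q P) {z : CoxVar n → Ω} (hz : (toricT n).Coord z q) :
    ∃ t : Ω, t ≠ 0 ∧
      (∀ i, z (.ev i) * z .wp =
        t * (algebraMap k Ω (P.rep (i, 0)) - (1 + ξ) / 2 * algebraMap k Ω (P.rep (i, 1)))) ∧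
      ∀ i, z (.od i) * z .wm =
        t * (algebraMap k Ω (P.rep (i, 0)) - (1 - ξ) / 2 * algebraMap k Ω (P.rep (i, 1))) := by
  obtain ⟨r, hr, hqr⟩ := h
  have hx : (projCox (XIdx n)).Coord (fun v : XIdx n => eval z (blowDown ξ n v)) r := hqr z hz
  obtain ⟨t, ht, htx⟩ := (coord_eq_iff_projCox hr hx).1 rfl
  refine ⟨t, ht, fun i => ?_, fun i => ?_⟩
  · rw [← eval_toCox_ev_blowDown h2 h0 z i, eval_toCox_ev, htx, htx]
    ring
  · rw [← eval_toCox_od_blowDown h2 h0 z i, eval_toCox_od, htx, htx]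
    ring

/-- For surfaces the fibres of the blow-down over rational points are finite. -/
theorem encard_fibre_Xtilde_le (h2 : (2 : Ω) ≠ 0) (h3 : (3 : Ω) ≠ 0) (hξ : ξ ^ 2 = -3)
    (hd : 1 ≤ d) (P : ℙ k (XIdx 1 → k)) :
    {q : (toricT 1).Pt Ω | q ∈ Xtilde ξ 1 d ∧ q ∈ (toricT 1).rationalPts k ξ ∧
      LiesAbove ξ q P}.encard ≤ (1 + d + d : ℕ) := by
  have h0 := sqrt_neg_three_ne_zero h3 hξ
  have hp := three_add_ne_zero h2 h3 hξ
  have hm := three_sub_ne_zero h2 h3 hξ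
  set S := {q : (toricT 1).Pt Ω | q ∈ Xtilde ξ 1 d ∧ q ∈ (toricT 1).rationalPts k ξ ∧
    LiesAbove ξ q P} with hS
  choose z hz using fun q : (toricT 1).Pt Ω => exists_coord_toricT q
  have hst := fun q => stable_toricT.1 (hz q).stable
  set e : Fin 2 → Ω := fun i =>
    algebraMap k Ω (P.rep (i, 0)) - (1 + ξ) / 2 * algebraMap k Ω (P.rep (i, 1)) with he
  set o : Fin 2 → Ω := fun i =>
    algebraMap k Ω (P.rep (i, 0)) - (1 - ξ) / 2 * algebraMap k Ω (P.rep (i, 1)) with ho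
  have hF : ∀ q ∈ S, _ := fun q hq => (mem_Xtilde_iff (hz q)).1 hq.1
  simp only [eval_coxF] at hF
  have hscale : ∀ q ∈ S, ∃ t : Ω, t ≠ 0 ∧ (∀ i, z q (.ev i) * z q .wp = t * e i) ∧
      ∀ i, z q (.od i) * z q .wm = t * o i := fun q hq => hq.2.2.exists_scale h2 h0 (hz q)
  have hsub : S ⊆ ({q ∈ S | z q .wp ≠ 0 ∧ z q .wm ≠ 0} ∪ {q ∈ S | z q .wp = 0}) ∪
      {q ∈ S | z q .wm = 0} := fun q hq => by
    by_cases h1 : z q .wp = 0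
    · exact .inl (.inr ⟨hq, h1⟩)
    · by_cases h2 : z q .wm = 0
      · exact .inr ⟨hq, h2⟩
      · exact .inl (.inl ⟨hq, h1, h2⟩)
  refine (Set.encard_le_encard hsub).trans ((Set.encard_union_le _ _).trans ?_)
  push_cast
  refine add_le_add ((Set.encard_union_le _ _).trans (add_le_add ?_ ?_)) ?_
  · exact Set.encard_le_one_iff.2 fun q q' hq hq' => hq.1.2.2.eq_of_ne_zero h2 h0 hq'.1.2.2
      (hz q) (hz q') hq.2.1 hq.2.2 hq'.2.1 hq'.2.2
  -- On `w_+ = 0` the odd block is proportional to the nonzero vector `o` attached to `P` (there is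
  -- no such point if `o = 0`), and `F̂ = 0` becomes a binary equation of degree `d` for the even
  -- block. The case `w_- = 0` is symmetric.
  · by_cases ho0 : o = 0
    · refine (Set.encard_eq_zero.2 (Set.eq_empty_of_forall_notMem ?_)).trans_le zero_le
      rintro q ⟨hq, hw⟩
      obtain ⟨-, ⟨i, hi⟩, hw'⟩ := hst q
      obtain ⟨t, -, -, h⟩ := hscale q hq
      have := h i
      rw [ho0, Pi.zero_apply, mul_zero] at this
      exact mul_ne_zero hi (hw'.resolve_left (not_not.2 hw)) this
    · refine encard_le_of_binary_eq_zero (u := fun q i => z q (.ev i)) hd ho0 ?_ ?_ ?_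
      · rintro q ⟨hq, hw⟩ h
        obtain ⟨i, hi⟩ := (hst q).1
        exact hi (congrFun h i)
      · rintro q ⟨hq, hw⟩
        obtain ⟨t, ht, -, h⟩ := hscale q hq
        have hw' := (hst q).2.2.resolve_left (not_not.2 hw)
        have hsum : (-(3 + ξ) * t ^ (d + 1)) * ∑ i, z q (.ev i) ^ d * o i ^ (d + 1) =
            z q .wm ^ d * 0 := by
          rw [← hF q hq, Finset.mul_sum, Finset.mul_sum]
          refine Finset.sum_congr rfl fun i _ => ?_
          have h' : t ^ (d + 1) * o i ^ (d + 1) = z q (.od i) ^ (d + 1) * z q .wm ^ (d + 1) := by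
            rw [← mul_pow, ← mul_pow, h]
          rw [hw, mul_pow]
          linear_combination (-(3 + ξ)) * z q (.ev i) ^ d * h'
        rw [mul_zero] at hsum
        exact (mul_eq_zero.1 hsum).resolve_left (mul_ne_zero (neg_ne_zero.2 hp) (pow_ne_zero _ ht))
      · rintro q ⟨hq, hw⟩ q' ⟨hq', hw'⟩ ⟨r, hr, hrr⟩
        obtain ⟨t, ht, -, h⟩ := hscale q hq
        obtain ⟨t', ht', -, h'⟩ := hscale q' hq'
        have hb := (hst q).2.2.resolve_left (not_not.2 hw)
        have hb' := (hst q').2.2.resolve_left (not_not.2 hw')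
        refine (coord_eq_iff_toricT (hz q) (hz q')).2 ⟨r, t' / t * (z q .wm / z q' .wm),
          t' / t / r, z q' .wm / z q .wm, by positivity, by positivity, hr, by positivity, ?_, hrr,
          fun i => ?_, ?_, ?_⟩
        · field_simp
        · field_simp
          linear_combination t * h' i - t' * h i
        · rw [hw, hw', mul_zero]
        · field_simp
  · by_cases he0 : e = 0
    · refine (Set.encard_eq_zero.2 (Set.eq_empty_of_forall_notMem ?_)).trans_le zero_le
      rintro q ⟨hq, hw⟩
      obtain ⟨⟨i, hi⟩, -, hw'⟩ := hst q
      obtain ⟨t, -, h, -⟩ := hscale q hq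
      have := h i
      rw [he0, Pi.zero_apply, mul_zero] at this
      exact mul_ne_zero hi (hw'.resolve_right (not_not.2 hw)) this
    · refine encard_le_of_binary_eq_zero (u := fun q i => z q (.od i)) hd he0 ?_ ?_ ?_
      · rintro q ⟨hq, hw⟩ h
        obtain ⟨i, hi⟩ := (hst q).2.1
        exact hi (congrFun h i)
      · rintro q ⟨hq, hw⟩
        obtain ⟨t, ht, h, -⟩ := hscale q hq
        have hw' := (hst q).2.2.resolve_right (not_not.2 hw)
        have hsum : ((3 - ξ) * t ^ (d + 1)) * ∑ i, z q (.od i) ^ d * e i ^ (d + 1) =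
            z q .wp ^ d * 0 := by
          rw [← hF q hq, Finset.mul_sum, Finset.mul_sum]
          refine Finset.sum_congr rfl fun i _ => ?_
          have h' : t ^ (d + 1) * e i ^ (d + 1) = z q (.ev i) ^ (d + 1) * z q .wp ^ (d + 1) := by
            rw [← mul_pow, ← mul_pow, h]
          rw [hw, mul_pow]
          linear_combination (3 - ξ) * z q (.od i) ^ d * h'
        rw [mul_zero] at hsum
        exact (mul_eq_zero.1 hsum).resolve_left (mul_ne_zero hm (pow_ne_zero _ ht))
      · rintro q ⟨hq, hw⟩ q' ⟨hq', hw'⟩ ⟨s, hs, hss⟩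
        obtain ⟨t, ht, h, -⟩ := hscale q hq
        obtain ⟨t', ht', h', -⟩ := hscale q' hq'
        have ha := (hst q).2.2.resolve_right (not_not.2 hw)
        have ha' := (hst q').2.2.resolve_right (not_not.2 hw')
        refine (coord_eq_iff_toricT (hz q) (hz q')).2 ⟨t' / t * (z q .wp / z q' .wp), s,
          z q' .wp / z q .wp, t' / t / s, by positivity, by positivity, by positivity, hs, ?_,
          fun i => ?_, hss, ?_, ?_⟩
        · field_simp
        · field_simp
          linear_combination t * h' i - t' * h i
        · field_simp
        · rw [hw, hw', mul_zero]

theorem countUpper_XtildeBounded_one {K : Type*} [Field K] [NumberField K] [Algebra K Ω]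
    (h2 : (2 : Ω) ≠ 0) (h3 : (3 : Ω) ≠ 0) (hξ : ξ ^ 2 = -3) (hd : 1 ≤ d) :
    CountUpper (XtildeBounded K ξ 1 d) (4 * (1 : ℕ) + 2 : ℝ) :=
  countUpper_XtildeBounded_of_fibres (by omega) fun P => encard_fibre_Xtilde_le h2 h3 hξ hd P

end SurfaceFibres

/-! ### Lower bounds from a linear subspace -/

section LowerBounds

open NumberField Height

theorem countLower_of_finset {P : Type*} {S : ℝ → Set P} {α c : ℝ} (hc : 0 < c)
    (h : ∀ B : ℝ, 1 ≤ B → ∃ T : Finset P, (∀ p ∈ T, p ∈ S B) ∧ c * B ^ α ≤ T.card) :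
    CountLower S α := by
  refine ⟨c, hc, 1, one_pos, fun B hB => ?_⟩
  obtain ⟨T, h1, h2⟩ := h B hB
  calc ENNReal.ofReal (c * B ^ α) ≤ ENNReal.ofReal T.card := ENNReal.ofReal_le_ofReal h2
    _ = ((T.card : ℕ∞) : ℝ≥0∞) := by rw [ENat.toENNReal_coe, ENNReal.ofReal_natCast]
    _ ≤ _ := ENat.toENNReal_le.2 (by
      rw [← Set.encard_coe_eq_coe_finsetCard]
      exact Set.encard_le_encard fun p hp => h1 p hp)

variable {K : Type*} [Field K] [NumberField K]

/-- Integral coordinates, one of them `1`, generate the unit ideal, so only the infinite places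
contribute. -/
theorem mulHeight_integral_le {ι : Type*} [Finite ι] {x : ι → 𝓞 K} {i : ι} (hi : x i = 1) {R : ℝ}
    (h : ∀ (v : InfinitePlace K) j, v (x j) ≤ R) :
    mulHeight (fun j => (x j : K)) ≤ R ^ Module.finrank ℚ K := by
  have : Nonempty ι := ⟨i⟩
  have hx : x ≠ 0 := fun h0 => one_ne_zero (hi.symm.trans (congrFun h0 i))
  have hx' : (fun j => (x j : K)) ≠ 0 := fun h0 => hx (by
    funext j
    exact RingOfIntegers.coe_injective (congrFun h0 j))
  have htop : Ideal.span (Set.range x) = ⊤ :=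
    (Ideal.eq_top_iff_one _).2 (Ideal.subset_span ⟨i, hi⟩)
  have hfin := absNorm_mul_finprod_finitePlace_eq_one hx
  rw [htop, Ideal.absNorm_top, Nat.cast_one, one_mul] at hfin
  rw [NumberField.mulHeight_eq hx', hfin, mul_one, ← InfinitePlace.sum_mult_eq,
    ← Finset.prod_pow_eq_pow_sum]
  refine Finset.prod_le_prod (fun v _ => pow_nonneg (Real.iSup_nonneg fun j => apply_nonneg _ _) _)
    fun v _ => pow_le_pow_left₀ (Real.iSup_nonneg fun j => apply_nonneg _ _) (ciSup_le (h v)) _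

/-- The vector whose pairs of coordinates are `(-β i, β i)`. -/
def antidiagVec {R : Type*} [Neg R] {n : ℕ} (β : Fin (n + 1) → R) (v : XIdx n) : R :=
  if v.2 = 0 then -β v.1 else β v.1

variable (K) in
/-- Boxes of algebraic integers. -/
theorem exists_integers_box : ∃ C : ℝ, 0 < C ∧ ∀ R : ℝ, 1 ≤ R → ∃ T : Finset (𝓞 K),
    (∀ a ∈ T, ∀ v : InfinitePlace K, v a ≤ R) ∧ (R / C) ^ Module.finrank ℚ K ≤ T.card := by
  classical
  set b := RingOfIntegers.basis K with hb
  -- `C` dominates the total size of the integral basis at every infinite place, so coefficients up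
  -- to `⌊R / C⌋` keep all absolute values below `R`.
  set C : ℝ := 1 + ∑ v : InfinitePlace K, ∑ j, v (b j) with hC
  have hnn : ∀ v : InfinitePlace K, 0 ≤ ∑ j, v (b j) :=
    fun v => Finset.sum_nonneg fun j _ => apply_nonneg _ _
  have hC0 : 0 < C := by
    have := Finset.sum_nonneg fun v (_ : v ∈ Finset.univ) => hnn v
    linarith
  have hCv : ∀ v : InfinitePlace K, ∑ j, v (b j) ≤ C := fun v => by
    have := Finset.single_le_sum (fun v _ => hnn v) (Finset.mem_univ v)
    linarith
  refine ⟨C, hC0, fun R hR => ?_⟩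
  set M := ⌊R / C⌋₊ with hM
  have hRC : 0 ≤ R / C := by positivity
  have hMC : M * C ≤ R := (le_div_iff₀ hC0).1 (Nat.floor_le hRC)
  let g : (Module.Free.ChooseBasisIndex ℤ (𝓞 K) → Fin (M + 1)) → 𝓞 K :=
    fun m => ∑ j, ((m j : ℕ) : ℤ) • b j
  have hg : Function.Injective g := fun m m' h => by
    have h1 : (fun j => ((m j : ℕ) : ℤ)) = fun j => ((m' j : ℕ) : ℤ) :=
      b.equivFun.symm.injective (by simpa only [Module.Basis.equivFun_symm_apply] using h)
    funext j
    have := congrFun h1 j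
    exact Fin.ext (by exact_mod_cast this)
  refine ⟨Finset.univ.image g, fun a ha v => ?_, ?_⟩
  · obtain ⟨m, -, rfl⟩ := Finset.mem_image.1 ha
    have h1 : ((g m : 𝓞 K) : K) = ∑ j, ((m j : ℕ) : K) * (b j : K) := by
      simp [g, zsmul_eq_mul]
    rw [h1]
    calc v (∑ j, ((m j : ℕ) : K) * (b j : K)) ≤ ∑ j, v (((m j : ℕ) : K) * (b j : K)) :=
          v.1.sum_le _ _
      _ ≤ ∑ j, M * v (b j) := Finset.sum_le_sum fun j _ => by
          rw [map_mul]
          refine mul_le_mul_of_nonneg_right ?_ (apply_nonneg _ _)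
          rw [← InfinitePlace.norm_embedding_eq, map_natCast, Complex.norm_natCast]
          exact_mod_cast Nat.lt_succ_iff.1 (m j).2
      _ = M * ∑ j, v (b j) := (Finset.mul_sum _ _ _).symm
      _ ≤ M * C := mul_le_mul_of_nonneg_left (hCv v) (Nat.cast_nonneg _)
      _ ≤ R := hMC
  · rw [Finset.card_image_of_injective _ hg, Finset.card_univ, Fintype.card_fun, Fintype.card_fin,
      ← Module.finrank_eq_card_chooseBasisIndex, RingOfIntegers.rank]
    push_cast
    exact pow_le_pow_left₀ hRC (Nat.lt_floor_add_one _).le _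

variable (K) in
/-- Rational points of bounded height on the `n`-plane `x_{2i} + x_{2i+1} = 0`. -/
theorem exists_finset_antidiag (n : ℕ) : ∃ c : ℝ, 0 < c ∧ ∀ B : ℝ, 1 ≤ B →
    ∃ T : Finset (ℙ K (XIdx n → K)),
      (∀ P ∈ T, P.mulHeight ≤ B ∧ ∀ i, P.rep (i, 0) = -P.rep (i, 1)) ∧ c * B ^ n ≤ T.card := by
  classical
  obtain ⟨C, hC, h⟩ := exists_integers_box K
  set D := Module.finrank ℚ K with hD
  have hD0 : D ≠ 0 := Module.finrank_pos.ne'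
  refine ⟨((1 / C) ^ D) ^ n, by positivity, fun B hB => ?_⟩
  set R : ℝ := B ^ (1 / D : ℝ) with hR
  have hRD : R ^ D = B := by
    rw [hR, one_div, Real.rpow_inv_natCast_pow (by linarith) hD0]
  have hR1 : 1 ≤ R := Real.one_le_rpow hB (by positivity)
  obtain ⟨T, hT, hcard⟩ := h R hR1
  have h1 : ∀ a : Fin n → 𝓞 K,
      antidiagVec (Fin.cons 1 a : Fin (n + 1) → 𝓞 K) ((0 : Fin (n + 1)), 1) = 1 := fun a => rfl
  have hne : ∀ a : Fin n → 𝓞 K,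
      (fun v => ((antidiagVec (Fin.cons 1 a : Fin (n + 1) → 𝓞 K) v : 𝓞 K) : K)) ≠ 0 := fun a h => by
    have := congrFun h ((0 : Fin (n + 1)), 1)
    rw [h1] at this
    simp at this
  let f : (Fin n → 𝓞 K) → ℙ K (XIdx n → K) := fun a => Projectivization.mk K _ (hne a)
  have hf : Function.Injective f := fun a a' haa => by
    obtain ⟨t, ht⟩ := (Projectivization.mk_eq_mk_iff' K _ _ _ _).1 haa
    have ht1 : t = 1 := by
      have := congrFun ht ((0 : Fin (n + 1)), 1)
      rw [Pi.smul_apply, h1, h1] at this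
      simpa using this
    funext i
    have := congrFun ht (i.succ, 1)
    rw [ht1, one_smul] at this
    exact (RingOfIntegers.coe_injective this).symm
  refine ⟨(Fintype.piFinset fun _ => T).image f, fun P hP => ?_, ?_⟩
  · obtain ⟨a, ha, rfl⟩ := Finset.mem_image.1 hP
    have ha' := Fintype.mem_piFinset.1 ha
    refine ⟨?_, fun i => ?_⟩
    · rw [Projectivization.mulHeight_mk, ← hRD]
      refine mulHeight_integral_le (h1 a) fun v j => ?_
      have hβ : ∀ i, v ((Fin.cons 1 a : Fin (n + 1) → 𝓞 K) i : K) ≤ R := fun i => by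
        induction i using Fin.cases with
        | zero =>
          change v (1 : K) ≤ R
          rwa [map_one]
        | succ i =>
          rw [Fin.cons_succ]
          exact hT _ (ha' i) v
      unfold antidiagVec
      split_ifs
      · change v (-((Fin.cons 1 a : Fin (n + 1) → 𝓞 K) j.1 : K)) ≤ R
        rw [← InfinitePlace.norm_embedding_eq, map_neg, norm_neg, InfinitePlace.norm_embedding_eq]
        exact hβ _
      · exact hβ _
    · obtain ⟨t, ht⟩ := Projectivization.exists_smul_eq_mk_rep K _ (hne a)
      have e0 := congrFun ht (i, 0)
      have e1 := congrFun ht (i, 1)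
      change _ = (f a).rep (i, 0) at e0
      change _ = (f a).rep (i, 1) at e1
      rw [← e0, ← e1, Pi.smul_apply, Pi.smul_apply, ← smul_neg]
      simp [antidiagVec]
  · rw [Finset.card_image_of_injective _ hf, Fintype.card_piFinset, Finset.prod_const,
      Finset.card_univ, Fintype.card_fin, ← mul_pow]
    push_cast
    refine pow_le_pow_left₀ (by positivity) (le_trans (le_of_eq ?_) hcard) n
    rw [div_pow, div_pow, hRD, one_pow, one_div_mul_eq_div]

theorem mem_hypersurfacePts_of_antidiag {F : Type*} [Field F] {n d : ℕ} {P : ℙ F (XIdx n → F)}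
    (h : ∀ i, P.rep (i, 0) = -P.rep (i, 1)) : P ∈ hypersurfacePts F n d := by
  change eval P.rep (hypersurfaceEq F n d) = 0
  rw [eval_hypersurfaceEq]
  refine Finset.sum_eq_zero fun i _ => ?_
  rw [h i, neg_add_cancel, zero_mul]

variable {n d : ℕ} {α : ℝ}

theorem countLower_hypersurfaceBounded (hα : α ≤ n) :
    CountLower (hypersurfaceBounded K n d) α := by
  obtain ⟨c, hc, h⟩ := exists_finset_antidiag K n
  refine countLower_of_finset hc fun B hB => ?_
  obtain ⟨T, hT, hcard⟩ := h B hB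
  refine ⟨T, fun P hP => ⟨mem_hypersurfacePts_of_antidiag (hT P hP).2, (hT P hP).1⟩,
    le_trans (mul_le_mul_of_nonneg_left ?_ hc.le) hcard⟩
  rw [← Real.rpow_natCast]
  exact Real.rpow_le_rpow_of_exponent_le hB hα

/-- The plane `x_{2i} = -x_{2i+1}` does not meet the centre, because `3 ± ξ ≠ 0`; its rational
points therefore lift to `X̃`, whether or not `ξ` is rational. -/
theorem countLower_XtildeBounded {Ω : Type*} [Field Ω] [Algebra K Ω] {ξ : Ω} (h2 : (2 : Ω) ≠ 0)
    (h3 : (3 : Ω) ≠ 0) (hξ : ξ ^ 2 = -3) (hα : α ≤ n) :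
    CountLower (XtildeBounded K ξ n d) α := by
  classical
  obtain ⟨c, hc, h⟩ := exists_finset_antidiag K n
  refine countLower_of_finset hc fun B hB => ?_
  obtain ⟨T, hT, hcard⟩ := h B hB
  have hlift : ∀ P ∈ T, ∃ q ∈ (toricT n).rationalPts K ξ, LiesAbove ξ q P ∧
      (P ∈ hypersurfacePts K n d → q ∈ Xtilde ξ n d) := fun P hP => by
    have hPr := (hT P hP).2
    have hex : ∃ i, P.rep (i, 1) ≠ 0 := by
      by_contra! h0
      refine P.rep_nonzero (funext fun ⟨i, j⟩ => ?_)
      change P.rep (i, j) = 0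
      fin_cases j
      · exact (hPr i).trans (by rw [h0 i, neg_zero])
      · exact h0 i
    obtain ⟨i, hi⟩ := hex
    have hi' : algebraMap K Ω (P.rep (i, 1)) ≠ 0 := (map_ne_zero _).2 hi
    refine exists_mem_rationalPts_liesAbove h2 (sqrt_neg_three_ne_zero h3 hξ) hξ P ⟨i, ?_⟩ ⟨i, ?_⟩
    · rw [hPr i, map_neg]
      intro h0
      refine mul_ne_zero (three_add_ne_zero h2 h3 hξ) hi' ?_
      field_simp at h0
      linear_combination -h0
    · rw [hPr i, map_neg]
      intro h0
      refine mul_ne_zero (three_sub_ne_zero h2 h3 hξ) hi' ?_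
      field_simp at h0
      linear_combination -h0
  choose g hg1 hg2 hg3 using hlift
  refine ⟨T.attach.image fun P => g P.1 P.2, fun q hq => ?_, ?_⟩
  · obtain ⟨⟨P, hP⟩, -, rfl⟩ := Finset.mem_image.1 hq
    obtain ⟨r, hr, hqr⟩ := hg2 P hP
    exact ⟨hg3 P hP (mem_hypersurfacePts_of_antidiag (hT P hP).2), hg1 P hP, P, r, hr, hqr,
      (hT P hP).1⟩
  · rw [Finset.card_image_of_injective, Finset.card_attach]
    · refine le_trans (mul_le_mul_of_nonneg_left ?_ hc.le) hcard
      rw [← Real.rpow_natCast]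
      exact Real.rpow_le_rpow_of_exponent_le hB hα
    · rintro ⟨P, hP⟩ ⟨Q, hQ⟩ hPQ
      have h1 := hg2 P hP
      have e : g P hP = g Q hQ := hPQ
      rw [e] at h1
      exact Subtype.ext (h1.unique (hg2 Q hQ))

/-- The exponent to be proved is at most the exponent `n` provided by the plane. -/
theorem two_mul_add_one_div_le (hn : 1 ≤ n) (hd : 1 ≤ d) :
    ((2 * n + 1 : ℝ) / (2 * d + 2)) ≤ n := by
  have hn' : (1 : ℝ) ≤ n := by exact_mod_cast hn
  have hd' : (1 : ℝ) ≤ d := by exact_mod_cast hd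
  rw [div_le_iff₀ (by positivity)]
  nlinarith

theorem three_div_le (hd : 1 ≤ d) : (3 / (2 * d + 1 : ℝ)) ≤ (1 : ℕ) := by
  have hd' : (1 : ℝ) ≤ d := by exact_mod_cast hd
  rw [Nat.cast_one, div_le_one (by positivity)]
  linarith

theorem isGalois_of_charZero {k Ω : Type*} [Field k] [CharZero k] [Field Ω] [Algebra k Ω]
    [IsAlgClosure k Ω] : IsGalois k Ω := by
  have := IsAlgClosure.isAlgebraic (R := k) (K := Ω)
  have : Normal k Ω := IsAlgClosure.normal k Ω
  exact ⟨⟩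

end LowerBounds

end

theorem mainTheorem1 (n d : ℕ) (hn : 1 ≤ n) (hd : 1 ≤ d) :
    -- (i), over a field `k` with quadratic extension `k(ξ)`, `ξ² = -3`
    (∀ (k Ω : Type*) [Field k] [Field Ω] [Algebra k Ω] [IsAlgClosure k Ω] (ξ : Ω),
      ¬ IsSquare (-3 : k) → ξ ^ 2 = -3 →
      -- the strict transform is cut out by `F̂`, of class `(2d+1, -d, -d)`
      MvPolynomial.IsWeightedHomogeneous (CoxVar.deg (n := n)) (coxF ξ n d)
        ![2 * (d : ℤ) + 1, -(d : ℤ), -(d : ℤ)] ∧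
      Xtilde ξ n d = strictTransform ξ n d ∧
      (∃ c : Ω, c ≠ 0 ∧ MvPolynomial.bind₁ (blowDown ξ n) (hypersurfaceEq Ω n d) =
        MvPolynomial.C c * (MvPolynomial.X CoxVar.wp ^ d * MvPolynomial.X CoxVar.wm ^ d *
          coxF ξ n d)) ∧
      ¬ MvPolynomial.X CoxVar.wp ∣ coxF ξ n d ∧
      ¬ MvPolynomial.X CoxVar.wm ∣ coxF ξ n d ∧
      -- `φ̄` has degree `2d+2`
      (∀ v, (phiBar Ω n d v).IsHomogeneous (2 * d + 2)) ∧
      (∀ g : MvPolynomial (UIdx n) Ω, (∀ v, g ∣ phiBar Ω n d v) → IsUnit g) ∧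
      -- `φ̄` is birational onto `X`, and factors through a birational map to the strict transform
      CoxSpace.InducesBirational k ξ (A := projCox (UIdx n)) (B := projCox (XIdx n))
        Set.univ (hypersurface Ω n d) (phiBar Ω n d) ∧
      (∃ lift : CoxVar n → MvPolynomial (UIdx n) Ω,
        CoxSpace.InducesBirational k ξ (A := projCox (UIdx n)) (B := toricT n)
          Set.univ (Xtilde ξ n d) lift ∧
        ∃ U : Set ((projCox (UIdx n)).Pt Ω), CoxSpace.OpenDenseIn U Set.univ ∧
          ∀ u ∈ U, ∃ p q, CoxSpace.Sends (A := projCox (UIdx n)) (B := toricT n) lift u p ∧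
            CoxSpace.Sends (A := toricT n) (B := projCox (XIdx n)) (blowDown ξ n) p q ∧
            CoxSpace.Sends (A := projCox (UIdx n)) (B := projCox (XIdx n)) (phiBar Ω n d) u q) ∧
      CoxSpace.InducesBirational k ξ (A := toricT n) (B := projCox (XIdx n))
        (Xtilde ξ n d) (hypersurface Ω n d) (blowDown ξ n) ∧
      -- for `d = 1` the hypersurface is the Fermat cubic
      (d = 1 → hypersurfaceEq k n d = ∑ v : XIdx n, MvPolynomial.X v ^ 3)) ∧
    -- (ii), over a finite field
    (∀ (F Ω : Type*) [Field F] [Finite F] [Field Ω] [Algebra F Ω] [IsAlgClosure F Ω] (ξ : Ω),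
      ξ ^ 2 = -3 →
      (Nat.card F % 6 = 5 → Nat.gcd (2 * d + 1) (Nat.card F - 1) = 1 →
        Nat.card ↥(Xtilde ξ n d ∩ (toricT n).rationalPts F ξ) =
            Nat.card (ℙ F (Fin (2 * n + 1) → F)) ∧
        (Nat.card ↥(Xtilde ξ n d ∩ (toricT n).rationalPts F ξ) : ℚ) =
            ((Nat.card F : ℚ) ^ (2 * n + 1) - 1) / ((Nat.card F : ℚ) - 1)) ∧
      -- the explicit formula for `n = 1`
      (n = 1 → ∀ q s : ℕ, q = Nat.card F → s = Nat.gcd (2 * d + 1) (q - 1) →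
        (q % 6 = 5 → Nat.card ↥(Xtilde ξ n d ∩ (toricT n).rationalPts F ξ) =
          q ^ 2 + s * q + 1) ∧
        (q % 6 = 1 → Nat.card ↥(Xtilde ξ n d ∩ (toricT n).rationalPts F ξ) =
          q ^ 2 + (4 + s) * q + 1) ∧
        (q % 6 = 5 ∨ q % 6 = 2 → Nat.card ↥(hypersurfacePts F n d) = q ^ 2 + s * q + 1) ∧
        (q % 6 = 1 ∨ q % 6 = 4 → Nat.card ↥(hypersurfacePts F n d) = q ^ 2 + (4 + s) * q + 1) ∧
        (q % 6 = 3 → ∀ i g : ℕ, 2 * d + 1 = 3 ^ i * g → ¬ 3 ∣ g →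
          Nat.card ↥(hypersurfacePts F n d) = Nat.gcd g (q - 1) * q ^ 2 + q + 1))) ∧
    -- (iii), over a number field
    (∀ (K Ω : Type*) [Field K] [NumberField K] [Field Ω] [Algebra K Ω] [IsAlgClosure K Ω] (ξ : Ω),
      ξ ^ 2 = -3 →
      CountLower (XtildeBounded K ξ n d) ((2 * n + 1 : ℝ) / (2 * d + 2)) ∧
      (n = 1 → CountLower (XtildeBounded K ξ n d) (3 / (2 * d + 1 : ℝ))) ∧
      (¬ IsSquare (-3 : K) ∨ n = 1 → CountUpper (XtildeBounded K ξ n d) (4 * n + 2 : ℝ)) ∧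
      CountLower (hypersurfaceBounded K n d) ((2 * n + 1 : ℝ) / (2 * d + 2)) ∧
      (n = 1 → CountLower (hypersurfaceBounded K n d) (3 / (2 * d + 1 : ℝ))) ∧
      CountUpper (hypersurfaceBounded K n d) (4 * n + 2 : ℝ)) := by
  refine ⟨fun k Ω _ _ _ _ ξ hk hξ => ?_, fun F Ω _ _ _ _ _ ξ hξ => ?_,
    fun K Ω _ _ _ _ _ ξ hξ => ?_⟩
  · have h2 : (2 : Ω) ≠ 0 := two_ne_zero_of_not_isSquare hk
    have h3 : (3 : Ω) ≠ 0 := three_ne_zero_of_not_isSquare hk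
    have h0 := sqrt_neg_three_ne_zero h3 hξ
    have : IsAlgClosed Ω := IsAlgClosure.isAlgClosed k
    exact ⟨isWeightedHomogeneous_coxF ξ, Xtilde_eq_strictTransform h2 h3 hξ hn hd,
      ⟨_, neg_ne_zero.2 (one_div_ne_zero (mul_ne_zero h2 h0)),
        bind₁_blowDown_hypersurfaceEq h2 h0 hξ⟩,
      not_wp_dvd_coxF (three_add_ne_zero h2 h3 hξ), not_wm_dvd_coxF (three_sub_ne_zero h2 h3 hξ),
      isHomogeneous_phiBar, fun g hg => isUnit_of_dvd_phiBar h2 h3 hn hd hg,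
      inducesBirational_phiBar h2 h3 hξ hn hd, exists_birational_lift h2 h3 hξ hn hd,
      inducesBirational_blowDown h2 h3 hξ hn hd, fun h => by rw [h, hypersurfaceEq_one]⟩
  · refine ⟨fun hq hgcd => card_Xtilde_of_gcd_eq_one hξ hq hgcd, ?_⟩
    rintro rfl q s rfl rfl
    refine ⟨fun hq => ?_, fun hq => card_Xtilde_of_card_mod_six_eq_one hd hξ hq, fun hq => ?_,
      fun hq => ?_, fun hq i g hg _ => ?_⟩
    · rw [card_Xtilde_eq_of_card_mod hξ hq, card_hypersurfacePts_one_of_inert (.inl hq)]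
    · rw [card_hypersurfacePts_one_of_inert hq]
    · rw [card_hypersurfacePts_of_split hd (by omega)]
    · rw [card_hypersurfacePts_of_three_eq_zero (three_eq_zero_of_card_mod (by omega)),
        gcd_of_eq_three_pow_mul hq hg]
  · have : CharZero Ω := charZero_of_injective_algebraMap (algebraMap K Ω).injective
    have : IsGalois K Ω := isGalois_of_charZero
    have h2 : (2 : Ω) ≠ 0 := two_ne_zero
    have h3 : (3 : Ω) ≠ 0 := three_ne_zero
    refine ⟨countLower_XtildeBounded h2 h3 hξ (two_mul_add_one_div_le hn hd), ?_, ?_,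
      countLower_hypersurfaceBounded (two_mul_add_one_div_le hn hd), ?_,
      countUpper_hypersurfaceBounded n d⟩
    · rintro rfl
      exact countLower_XtildeBounded h2 h3 hξ (three_div_le hd)
    · rintro (hK | rfl)
      · exact countUpper_XtildeBounded_of_not_isSquare hξ hK
      · exact countUpper_XtildeBounded_one h2 h3 hξ hd
    · rintro rfl
      exact countLower_hypersurfaceBounded (three_div_le hd)
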